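/- Let $G$ be a Lie group acting smoothly, properly and isometrically on a Riemannian manifold $(Q,\mu)$, and suppose that the action is of single orbit type: there is a subgroup $H\subset G$ such that every stabilizer $G_q$ is conjugate to $H$ in $G$. (Manifolds are smooth, finite-dimensional, Hausdorff, second countable and without boundary.) Let the orbit space $B=Q/G$ carry the smooth structure and the Riemannian metric $\mu_0$ for which the projection $\pi:Q\to B$ is a Riemannian submersion. Let $\langle\cdot,\cdot\rangle$ be an $\mathrm{Ad}$-invariant inner product on the Lie algebra $\mathfrak g$ of $G$. For $X\in\mathfrak g$ let $\zeta_X(q)=\frac{d}{dt}\big|_0\exp(tX).q$. Let $\mathfrak g_q=\{X\in\mathfrak g:\zeta_X(q)=0\}$ be the infinitesimal stabilizer of $q\in Q$ and $\mathfrak g_q^\perp$ its orthogonal complement. The inertia tensor is $\mathbb I_q(X,Y)=\mu_q(\zeta_X(q),\zeta_Y(q))$. For each $q$ let $(e_\alpha)$ be an orthonormal basis of $\mathfrak g_q^\perp$, and put $$\delta(q)=\Big|\det\big(\mathbb I_q(e_\alpha,e_\beta)\big)_{\alpha\beta}\Big|^{\frac12}$$ (with the convention that an empty determinant is $1$). Let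 $\Delta^Q$ and $\Delta^B$ be the Laplace–Beltrami operators of $(Q,\mu)$ and $(B,\mu_0)$, and let $\nabla$ be the $\mu_0$-gradient. Then $\delta$ is positive and is the pull-back along $\pi$ of a smooth function on $B$, again denoted by $\delta$. There is a unique linear operator $\Delta^0$ on $C^\infty(B)$ with $\pi^*\circ\Delta^0=\Delta^Q\circ\pi^*$, where $\pi^*f=f\circ\pi$, and any operator $\Delta^0:C^\infty(B)\to C^\infty(B)$ with this property satisfies $$\Delta^0=\Delta^B+\nabla\log\delta,$$ where the vector field $\nabla\log\delta$ acts on functions by differentiation, that is, $\Delta^0f=\Delta^Bf+\mu_0(\nabla\log\delta,\nabla f)$ for all $f\in C^\infty(B)$. -/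

import Mathlib

open scoped Manifold ContDiff

noncomputable section

namespace RiemannianAction

/-- A smooth Riemannian metric on an `n`-dimensional manifold (without boundary). -/
abbrev Metric (n : ℕ) (M : Type*) [TopologicalSpace M]
    [ChartedSpace (EuclideanSpace ℝ (Fin n)) M] [IsManifold (𝓡 n) ∞ M] : Type _ :=
  Bundle.ContMDiffRiemannianMetric (𝓡 n) ∞ (EuclideanSpace ℝ (Fin n))
    (fun x : M => TangentSpace (𝓡 n) x)

section Riemannian

variable {n : ℕ} {M : Type*} [TopologicalSpace M]
  [ChartedSpace (EuclideanSpace ℝ (Fin n)) M] [IsManifold (𝓡 n) ∞ M]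

instance (x : M) : FiniteDimensional ℝ (TangentSpace (𝓡 n) x) :=
  inferInstanceAs (FiniteDimensional ℝ (EuclideanSpace ℝ (Fin n)))

/-- The scalar product on a tangent space, as a bilinear form. -/
def Metric.form (μ : Metric n M) (x : M) : LinearMap.BilinForm ℝ (TangentSpace (𝓡 n) x) :=
  LinearMap.mk₂ ℝ (fun v w => μ.inner x v w) (by simp) (by simp) (by simp) (by simp)

theorem Metric.form_nondegenerate (μ : Metric n M) (x : M) : (μ.form x).Nondegenerate := by
  have h : ∀ v, (∀ w, μ.form x v w = 0) → v = 0 := fun v hv => by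
    by_contra hne
    exact (μ.pos x v hne).ne' (hv v)
  refine ⟨h, fun v hv => h v fun w => ?_⟩
  exact (μ.symm x v w).trans (hv w)

/-- The Riemannian gradient of a function. -/
def gradient (μ : Metric n M) (f : M → ℝ) (x : M) : TangentSpace (𝓡 n) x :=
  ((μ.form x).toDual (μ.form_nondegenerate x)).symm
    (mfderiv (𝓡 n) 𝓘(ℝ, ℝ) f x : TangentSpace (𝓡 n) x →L[ℝ] ℝ).toLinearMap

/-- The action of a tangent vector `v` at `x` on a function, `v f = df_x(v)`. -/
def derivAlong {x : M} (v : TangentSpace (𝓡 n) x) (f : M → ℝ) : ℝ :=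
  (mfderiv (𝓡 n) 𝓘(ℝ, ℝ) f x : TangentSpace (𝓡 n) x →L[ℝ] ℝ) v

/-- The gradient is the metric dual of the differential. -/
theorem inner_gradient (μ : Metric n M) (f : M → ℝ) (x : M) (w : TangentSpace (𝓡 n) x) :
    μ.inner x (gradient μ f x) w = derivAlong w f := by
  have := LinearMap.BilinForm.apply_toDual_symm_apply (hB := μ.form_nondegenerate x)
    (mfderiv (𝓡 n) 𝓘(ℝ, ℝ) f x : TangentSpace (𝓡 n) x →L[ℝ] ℝ).toLinearMap w
  exact this

/-- The coordinate vector field `∂ᵢ` of a chart `φ`, at the point with coordinates `y`. -/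
def coordVector (φ : OpenPartialHomeomorph M (EuclideanSpace ℝ (Fin n)))
    (y : EuclideanSpace ℝ (Fin n)) (i : Fin n) : TangentSpace (𝓡 n) (φ.symm y) :=
  (mfderiv (𝓡 n) (𝓡 n) φ.symm y :
    EuclideanSpace ℝ (Fin n) →L[ℝ] TangentSpace (𝓡 n) (φ.symm y)) (EuclideanSpace.single i 1)

/-- The matrix `gᵢⱼ` of the metric in a chart, as a function of the coordinates. -/
def metricMatrix (μ : Metric n M) (φ : OpenPartialHomeomorph M (EuclideanSpace ℝ (Fin n)))
    (y : EuclideanSpace ℝ (Fin n)) : Matrix (Fin n) (Fin n) ℝ :=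
  Matrix.of fun i j => μ.inner (φ.symm y) (coordVector φ y i) (coordVector φ y j)

/-- The coordinate partial derivative `∂ᵢ u`. -/
def pderiv (i : Fin n) (u : EuclideanSpace ℝ (Fin n) → ℝ) (y : EuclideanSpace ℝ (Fin n)) : ℝ :=
  fderiv ℝ u y (EuclideanSpace.single i 1)

/-- The coordinate expression `(det g)^{-1/2} ∑ᵢ ∂ᵢ ((det g)^{1/2} ∑ⱼ gⁱʲ ∂ⱼ f)` in a chart. -/
def laplacianInChart (μ : Metric n M) (φ : OpenPartialHomeomorph M (EuclideanSpace ℝ (Fin n)))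
    (f : M → ℝ) (y : EuclideanSpace ℝ (Fin n)) : ℝ :=
  (√(metricMatrix μ φ y).det)⁻¹ *
    ∑ i, pderiv i (fun z => √(metricMatrix μ φ z).det *
      ∑ j, (metricMatrix μ φ z)⁻¹ i j * pderiv j (fun z' => f (φ.symm z')) z) y

/-- The Laplace–Beltrami operator, computed at each point in the preferred chart there (for a smooth
function the value does not depend on the chart). -/
def laplaceBeltrami (μ : Metric n M) (f : M → ℝ) (x : M) : ℝ :=
  laplacianInChart μ (chartAt (EuclideanSpace ℝ (Fin n)) x) f
    (chartAt (EuclideanSpace ℝ (Fin n)) x x)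

/-- A Riemannian submersion: a smooth map whose differential is everywhere surjective, and isometric
on the orthogonal complement of its kernel. -/
structure IsRiemannianSubmersion {m : ℕ} {B : Type*} [TopologicalSpace B]
    [ChartedSpace (EuclideanSpace ℝ (Fin m)) B] [IsManifold (𝓡 m) ∞ B]
    (μ : Metric n M) (μ₀ : Metric m B) (p : M → B) : Prop where
  contMDiff : ContMDiff (𝓡 n) (𝓡 m) ∞ p
  surjective : ∀ x, Function.Surjective (mfderiv (𝓡 n) (𝓡 m) p x)
  isometric : ∀ (x : M) (v w : TangentSpace (𝓡 n) x),
    (∀ u, mfderiv (𝓡 n) (𝓡 m) p x u = 0 → μ.inner x v u = 0) →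
    (∀ u, mfderiv (𝓡 n) (𝓡 m) p x u = 0 → μ.inner x w u = 0) →
    μ₀.inner (p x) (mfderiv (𝓡 n) (𝓡 m) p x v) (mfderiv (𝓡 n) (𝓡 m) p x w) = μ.inner x v w

end Riemannian

section Action

variable {d n : ℕ} {G : Type*} [TopologicalSpace G] [ChartedSpace (EuclideanSpace ℝ (Fin d)) G]
  [Group G]

/-- The adjoint action of a Lie group on its Lie algebra: the differential at `1` of
`h ↦ g * h * g⁻¹`. -/
def Ad (g : G) : GroupLieAlgebra (𝓡 d) G →ₗ[ℝ] GroupLieAlgebra (𝓡 d) G :=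
  (mfderiv (𝓡 d) (𝓡 d) (fun h : G => g * h * g⁻¹) 1 :
    EuclideanSpace ℝ (Fin d) →L[ℝ] EuclideanSpace ℝ (Fin d)).toLinearMap

/-- A bilinear form on the Lie algebra is an `Ad`-invariant inner product. -/
structure IsAdInvariantInner (ip : LinearMap.BilinForm ℝ (GroupLieAlgebra (𝓡 d) G)) : Prop where
  symm : ∀ X Y, ip X Y = ip Y X
  pos : ∀ X, X ≠ 0 → 0 < ip X X
  ad_invariant : ∀ (g : G) X Y, ip (Ad g X) (Ad g Y) = ip X Y

variable {Q : Type*} [TopologicalSpace Q] [ChartedSpace (EuclideanSpace ℝ (Fin n)) Q]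
  [IsManifold (𝓡 n) ∞ Q] [MulAction G Q]

/-- The group acts by isometries of the Riemannian metric. -/
def IsIsometricAction (G : Type*) [Group G] [MulAction G Q] (μ : Metric n Q) : Prop :=
  ∀ (g : G) (q : Q) (v w : TangentSpace (𝓡 n) q),
    μ.inner (g • q) (mfderiv (𝓡 n) (𝓡 n) (fun x : Q => g • x) q v)
      (mfderiv (𝓡 n) (𝓡 n) (fun x : Q => g • x) q w) = μ.inner q v w

/-- All stabilizers are conjugate to one subgroup. -/
def IsSingleOrbitType (G Q : Type*) [Group G] [MulAction G Q] : Prop :=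
  ∃ H : Subgroup G, ∀ q : Q, ∃ g : G,
    MulAction.stabilizer G q = H.map (MulAut.conj g).toMonoidHom

/-- The fundamental vector fields, `ζ_X(q) = d/dt|₀ exp(tX) • q`, that is, the differential at `1`
of the orbit map `g ↦ g • q` applied to `X`. -/
def fundamental (q : Q) : GroupLieAlgebra (𝓡 d) G →ₗ[ℝ] TangentSpace (𝓡 n) q :=
  (mfderiv (𝓡 d) (𝓡 n) (fun g : G => g • q) 1 :
    EuclideanSpace ℝ (Fin d) →L[ℝ] EuclideanSpace ℝ (Fin n)).toLinearMap

/-- The infinitesimal stabilizer `𝔤_q`. -/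
def isotropyAlgebra (q : Q) : Submodule ℝ (GroupLieAlgebra (𝓡 d) G) :=
  LinearMap.ker (fundamental (d := d) (n := n) (G := G) q)

/-- A finite family is an orthonormal basis of `𝔤_q^⊥`, the orthogonal complement of the
infinitesimal stabilizer. -/
structure IsOrthonormalBasisPerp (n : ℕ) {Q : Type*} [TopologicalSpace Q]
    [ChartedSpace (EuclideanSpace ℝ (Fin n)) Q] [MulAction G Q]
    (ip : LinearMap.BilinForm ℝ (GroupLieAlgebra (𝓡 d) G)) (q : Q)
    {k : ℕ} (e : Fin k → GroupLieAlgebra (𝓡 d) G) : Prop where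
  orthonormal : ∀ a b, ip (e a) (e b) = if a = b then 1 else 0
  span_eq : ∀ X, X ∈ Submodule.span ℝ (Set.range e) ↔
    ∀ Y ∈ isotropyAlgebra (n := n) q, ip X Y = 0

/-- The inertia tensor `I_q(X, Y) = μ_q(ζ_X(q), ζ_Y(q))`. -/
def inertia (μ : Metric n Q) (q : Q) (X Y : GroupLieAlgebra (𝓡 d) G) : ℝ :=
  μ.inner q (fundamental q X) (fundamental q Y)

/-- The function `|det (I_q(e_α, e_β))|^{1/2}` for a family `e` in the Lie algebra. -/
def inertiaDensity (μ : Metric n Q) (q : Q) {k : ℕ} (e : Fin k → GroupLieAlgebra (𝓡 d) G) : ℝ :=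
  √|(Matrix.of fun a b => inertia μ q (e a) (e b)).det|

/-- The projection onto the orbit space. -/
def orbitProj (G : Type*) {Q : Type*} [Group G] [MulAction G Q] (q : Q) :
    MulAction.orbitRel.Quotient G Q :=
  Quotient.mk _ q

end Action

end RiemannianAction

end

/-!
The Laplace–Beltrami operator has the expression `(det g)^{-1/2} ∑ ∂ᵢ ((det g)^{1/2} gⁱʲ ∂ⱼ f)` in
every local parametrization, not only in the charts of the atlas (`coordLaplacian_comp`, which
rests on the Piola identity `sum_pderiv_piola`, and `laplaceBeltrami_eq`). The formula is
therefore proved at one point `q₀` at a time, in a parametrization of `Q` adapted to the action.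

*The parametrization.* By the dimension count below, the orbits have dimension `r = n - m`. Let
`X` be an orthonormal basis of `𝔤_{q₀}^⊥`, and let `s` be a slice through `q₀` that is affine in a
chart and tangent to the orthogonal complement of the orbit. Then `(w, u) ↦ c(∑ wᵥ Xᵥ) • s(u)` is
a parametrization of `Q` near `q₀`, where `c` is the inverse of a chart of `G` at `1`, and `u ↦
π(s(u))` is one of `B`. A pulled back function depends on `u` only. To apply the coordinate
formula to such a function at the origin, it suffices to know the metric on the two coordinate
subspaces (`coordLaplacian_comp_coordProj`). On `w = 0` the block of `∂_w` is the inertia tensor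
on `X`, and its Schur complement is the matrix of `μ₀`, since `π` is a Riemannian submersion
(`schur_gram_eq`). Hence the determinant is a product, and the `u`-block of the inverse metric is
the inverse of the matrix of `μ₀`. On `u = 0` the metric has no mixed components, because
translates of horizontal vectors are horizontal. It follows that `Δ^Q (π^* f)` at `q₀` is `Δ^B f`
plus the derivative of `f` along the gradient of the logarithm of `σ(u) = det (I_{s(u)}(X_v,
X_w))^{1/2}`.

*The density.* The family `X` is orthonormal, but in general it spans `𝔤_q^⊥` only at `q = q₀`. By
Hadamard's inequality, `σ ≤ δ ∘ s` with equality at `q₀` (`det_gram_le`), so the two functions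
have the same differential there (`fderiv_sliceDensity`), and `σ` may be replaced by `δ`. Up to
sign, `δ²` is a coefficient of the characteristic polynomial of the inertia tensor in an
orthonormal basis of `𝔤` (`det_gram_eq_charpoly_coeff`). This shows that `δ` is smooth, and, by
the `Ad`-invariance of the inner product, that it is constant on orbits.

*The dimension count.* The tangent space of an orbit lies in the kernel of `dπ`. That it is the
whole kernel (`ker_projDeriv_eq_range`) is seen from Hausdorff dimensions: a fibre of `π` is a
submanifold of dimension `n - m`, and it is an orbit, hence the image of the second countable
manifold `G` under a smooth map of constant rank.
-/

noncomputable section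

namespace RiemannianAction

/-! ### Orthonormal families and Gram determinants -/

section InnerForm

open Module

variable {V : Type*} [AddCommGroup V] [Module ℝ V] {ip : LinearMap.BilinForm ℝ V}

theorem nondegenerate_of_pos (hpos : ∀ X, X ≠ 0 → 0 < ip X X) : ip.Nondegenerate := by
  refine ⟨fun v hv => ?_, fun v hv => ?_⟩ <;> by_contra hne <;> exact (hpos v hne).ne' (hv v)

theorem linearIndependent_of_orthonormal {ι : Type*} [DecidableEq ι] {e : ι → V}
    (he : ∀ a b, ip (e a) (e b) = if a = b then 1 else 0) : LinearIndependent ℝ e := by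
  rw [linearIndependent_iff']
  intro s g hg i hi
  have := congrArg (fun v => ip v (e i)) hg
  simpa [he, hi] using this

theorem span_eq_orthogonal (hsymm : ∀ X Y, ip X Y = ip Y X) {K : Submodule ℝ V} {ι : Type*}
    {e : ι → V} (hs : ∀ X, X ∈ Submodule.span ℝ (Set.range e) ↔ ∀ Y ∈ K, ip X Y = 0) :
    Submodule.span ℝ (Set.range e) = ip.orthogonal K := by
  ext Y
  rw [hs, LinearMap.BilinForm.mem_orthogonal_iff]
  exact forall₂_congr fun Z _ => by rw [hsymm]

/-- The orthogonal projection along the orthonormal family `e` takes values in the orthogonal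
complement of `span e`, which is `K`. -/
theorem sub_sum_mem_of_span_eq [FiniteDimensional ℝ V] (hsymm : ∀ X Y, ip X Y = ip Y X)
    (hpos : ∀ X, X ≠ 0 → 0 < ip X X) {K : Submodule ℝ V} {ι : Type*} [Fintype ι] [DecidableEq ι]
    {e : ι → V} (he : ∀ a b, ip (e a) (e b) = if a = b then 1 else 0)
    (hs : ∀ X, X ∈ Submodule.span ℝ (Set.range e) ↔ ∀ Y ∈ K, ip X Y = 0) (X : V) :
    X - ∑ a, ip X (e a) • e a ∈ K := by
  have hspan := span_eq_orthogonal hsymm hs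
  have hrefl : ip.IsRefl := fun X Y h => (hsymm Y X).trans h
  rw [← LinearMap.BilinForm.orthogonal_orthogonal (nondegenerate_of_pos hpos) hrefl K, ← hspan,
    LinearMap.BilinForm.mem_orthogonal_iff]
  intro Y hY
  induction hY using Submodule.span_induction with
  | mem Y hY =>
    obtain ⟨b, rfl⟩ := hY
    simp [he, hsymm]
  | zero => simp
  | add Y Z _ _ hY hZ => rw [map_add, LinearMap.add_apply, hY, hZ, add_zero]
  | smul c Y _ hY => rw [map_smul, LinearMap.smul_apply, hY, smul_zero]

theorem card_add_finrank_of_span_eq [FiniteDimensional ℝ V] (hsymm : ∀ X Y, ip X Y = ip Y X)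
    (hpos : ∀ X, X ≠ 0 → 0 < ip X X) {K : Submodule ℝ V} {ι : Type*} [Fintype ι] [DecidableEq ι]
    {e : ι → V} (he : ∀ a b, ip (e a) (e b) = if a = b then 1 else 0)
    (hs : ∀ X, X ∈ Submodule.span ℝ (Set.range e) ↔ ∀ Y ∈ K, ip X Y = 0) :
    Fintype.card ι + finrank ℝ K = finrank ℝ V := by
  have hspan := span_eq_orthogonal hsymm hs
  have h := LinearMap.BilinForm.finrank_orthogonal (nondegenerate_of_pos hpos) K
  rw [← hspan, finrank_span_eq_card (linearIndependent_of_orthonormal he)] at h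
  have := Submodule.finrank_le K
  omega

theorem exists_orthonormal_basis [FiniteDimensional ℝ V] (hsymm : ∀ X Y, ip X Y = ip Y X)
    (hpos : ∀ X, X ≠ 0 → 0 < ip X X) :
    ∃ b : Fin (finrank ℝ V) → V, (∀ i j, ip (b i) (b j) = if i = j then 1 else 0) := by
  obtain ⟨v, hv⟩ := LinearMap.BilinForm.exists_orthogonal_basis (B := ip)
    ⟨fun X Y => hsymm X Y⟩
  refine ⟨fun i => (√(ip (v i) (v i)))⁻¹ • v i, fun i j => ?_⟩
  have hvi := hpos _ (v.ne_zero i)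
  split_ifs with h
  · subst h
    simp only [map_smul, LinearMap.smul_apply, smul_eq_mul]
    rw [← mul_assoc, ← mul_inv, Real.mul_self_sqrt hvi.le, inv_mul_cancel₀ hvi.ne']
  · simp only [map_smul, LinearMap.smul_apply, smul_eq_mul]
    have h0 : ip (v i) (v j) = 0 := hv h
    rw [h0, mul_zero, mul_zero]

/-- A full orthonormal family satisfies the expansion `X = ∑ ip X (b i) • b i`. -/
theorem eq_sum_of_orthonormal [FiniteDimensional ℝ V] (hsymm : ∀ X Y, ip X Y = ip Y X)
    (hpos : ∀ X, X ≠ 0 → 0 < ip X X) {b : Fin (finrank ℝ V) → V}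
    (hb : ∀ i j, ip (b i) (b j) = if i = j then 1 else 0) (X : V) :
    X = ∑ i, ip X (b i) • b i := by
  have htop := (linearIndependent_of_orthonormal hb).span_eq_top_of_card_eq_finrank' (by simp)
  have := sub_sum_mem_of_span_eq hsymm hpos (K := ⊥) hb (by simp [htop]) X
  exact sub_eq_zero.1 (by simpa using this)

/-- If `K` lies in the radical of the symmetric form `B`, then the Gram matrix of `B` on any family
is obtained from the Gram matrix on an orthonormal basis of the complement of `K`. -/
theorem gram_eq_mul [FiniteDimensional ℝ V] (hsymm : ∀ X Y, ip X Y = ip Y X)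
    (hpos : ∀ X, X ≠ 0 → 0 < ip X X) {K : Submodule ℝ V} {ι : Type*} [Fintype ι] [DecidableEq ι]
    {e : ι → V} (he : ∀ a b, ip (e a) (e b) = if a = b then 1 else 0)
    (hs : ∀ X, X ∈ Submodule.span ℝ (Set.range e) ↔ ∀ Y ∈ K, ip X Y = 0)
    {B : V → V → ℝ} (hBs : ∀ X Y, B X Y = B Y X) (hBa : ∀ X Y Z, B (X + Y) Z = B X Z + B Y Z)
    (hBm : ∀ (c : ℝ) X Y, B (c • X) Y = c * B X Y) (hBK : ∀ X ∈ K, ∀ Y, B X Y = 0)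
    {κ : Type*} (b : κ → V) :
    (Matrix.of fun i j => B (b i) (b j)) =
      (Matrix.of fun i a => ip (b i) (e a)) * (Matrix.of fun a c => B (e a) (e c)) *
        (Matrix.of fun i a => ip (b i) (e a)).transpose := by
  classical
  have hsum : ∀ (f : ι → ℝ) (Y : V), B (∑ a, f a • e a) Y = ∑ a, f a * B (e a) Y := by
    intro f Y
    let L : V →ₗ[ℝ] ℝ :=
      { toFun := fun X => B X Y
        map_add' := fun X Z => hBa X Z Y
        map_smul' := fun c X => hBm c X Y }
    have := map_sum L (fun a => f a • e a) Finset.univ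
    simp only [map_smul, smul_eq_mul] at this
    exact this
  have key : ∀ X Y, B X Y = ∑ a, ip X (e a) * B (e a) Y := by
    intro X Y
    have h1 := hBK _ (sub_sum_mem_of_span_eq hsymm hpos he hs X) Y
    rw [← hsum, ← sub_eq_zero, ← h1]
    rw [show X - ∑ a, ip X (e a) • e a = X + (-1 : ℝ) • ∑ a, ip X (e a) • e a by
      rw [neg_one_smul, sub_eq_add_neg], hBa, hBm]
    ring
  ext i j
  simp only [Matrix.mul_apply, Matrix.of_apply, Matrix.transpose_apply]
  rw [hBs, key (b j)]
  refine Finset.sum_congr rfl fun c _ => ?_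
  rw [hBs, key (b i), mul_comm]

/-- The Gram determinant on an orthonormal basis of the complement of the radical is, up to sign, a
coefficient of the characteristic polynomial of the Gram matrix on a full orthonormal basis. -/
theorem det_gram_eq_charpoly_coeff [FiniteDimensional ℝ V] (hsymm : ∀ X Y, ip X Y = ip Y X)
    (hpos : ∀ X, X ≠ 0 → 0 < ip X X) {K : Submodule ℝ V} {k : ℕ}
    {e : Fin k → V} (he : ∀ a b, ip (e a) (e b) = if a = b then 1 else 0)
    (hs : ∀ X, X ∈ Submodule.span ℝ (Set.range e) ↔ ∀ Y ∈ K, ip X Y = 0)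
    {B : V → V → ℝ} (hBs : ∀ X Y, B X Y = B Y X) (hBa : ∀ X Y Z, B (X + Y) Z = B X Z + B Y Z)
    (hBm : ∀ (c : ℝ) X Y, B (c • X) Y = c * B X Y) (hBK : ∀ X ∈ K, ∀ Y, B X Y = 0)
    {b : Fin (finrank ℝ V) → V} (hb : ∀ i j, ip (b i) (b j) = if i = j then 1 else 0) :
    (Matrix.of fun a c => B (e a) (e c)).det =
      (-1) ^ k * (Matrix.of fun i j => B (b i) (b j)).charpoly.coeff (finrank ℝ V - k) := by
  have hk : k ≤ finrank ℝ V := by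
    have := card_add_finrank_of_span_eq hsymm hpos he hs
    rw [Fintype.card_fin] at this
    omega
  have hT : (Matrix.of fun i a => ip (b i) (e a)).transpose * (Matrix.of fun i a => ip (b i) (e a))
      = 1 := by
    ext a c
    have h := congrArg (fun X => ip X (e c)) (eq_sum_of_orthonormal hsymm hpos hb (e a))
    simp only [he, map_sum, LinearMap.sum_apply, map_smul, LinearMap.smul_apply,
      smul_eq_mul] at h
    rw [Matrix.one_apply, h, Matrix.mul_apply]
    simp [hsymm]
  rw [gram_eq_mul hsymm hpos he hs hBs hBa hBm hBK b, Matrix.mul_assoc,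
    Matrix.charpoly_mul_comm_of_le _ _ (by simpa using hk), Matrix.mul_assoc, hT, Matrix.mul_one,
    Fintype.card_fin, Fintype.card_fin, Polynomial.coeff_X_pow_mul', if_pos le_rfl, Nat.sub_self,
    Matrix.det_eq_sign_charpoly_coeff, Fintype.card_fin]

/-- Bessel's inequality. -/
theorem sum_sq_le_one [FiniteDimensional ℝ V] (hsymm : ∀ X Y, ip X Y = ip Y X)
    (hpos : ∀ X, X ≠ 0 → 0 < ip X X) {ι : Type*} [Fintype ι] [DecidableEq ι]
    {e : ι → V} (he : ∀ a b, ip (e a) (e b) = if a = b then 1 else 0) {X : V} (hX : ip X X = 1) :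
    ∑ a, ip X (e a) ^ 2 ≤ 1 := by
  have h0 : 0 ≤ ip (X - ∑ a, ip X (e a) • e a) (X - ∑ a, ip X (e a) • e a) := by
    by_cases h : X - ∑ a, ip X (e a) • e a = 0
    · rw [h]; simp
    · exact (hpos _ h).le
  have h1 : ip (X - ∑ a, ip X (e a) • e a) (X - ∑ a, ip X (e a) • e a)
      = 1 - ∑ a, ip X (e a) ^ 2 := by
    simp only [map_sub, LinearMap.sub_apply, hX, map_sum, LinearMap.sum_apply, map_smul,
      LinearMap.smul_apply, smul_eq_mul, he, mul_ite, mul_one, mul_zero, hsymm _ X]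
    simp [pow_two]
  linarith

/-- Hadamard's inequality, for a matrix with rows of length at most one. -/
theorem det_sq_le_one {k : ℕ} (T : Matrix (Fin k) (Fin k) ℝ) (hT : ∀ i, ∑ j, T i j ^ 2 ≤ 1) :
    T.det ^ 2 ≤ 1 := by
  have : Fact (finrank ℝ (EuclideanSpace ℝ (Fin k)) = k) := ⟨by simp⟩
  let b := EuclideanSpace.basisFun (Fin k) ℝ
  let v : Fin k → EuclideanSpace ℝ (Fin k) := fun i => WithLp.toLp 2 (T i)
  have h1 := b.toBasis.orientation.abs_volumeForm_apply_le v
  have h2 : b.toBasis.orientation.volumeForm v = T.transpose.det := by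
    rw [Orientation.volumeForm_robust _ b rfl, Module.Basis.det_apply]
    congr 1
  have h3 : ∏ i, ‖v i‖ ≤ 1 := by
    refine Finset.prod_le_one (fun i _ => norm_nonneg _) fun i _ => ?_
    rw [EuclideanSpace.norm_eq, Real.sqrt_le_one]
    simpa [v] using hT i
  rw [h2, Matrix.det_transpose] at h1
  rw [sq_le_one_iff_abs_le_one]
  exact h1.trans h3

/-- Among orthonormal families, an orthonormal basis of the complement of the radical maximizes the
Gram determinant. -/
theorem det_gram_le [FiniteDimensional ℝ V] (hsymm : ∀ X Y, ip X Y = ip Y X)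
    (hpos : ∀ X, X ≠ 0 → 0 < ip X X) {K : Submodule ℝ V} {k : ℕ}
    {e : Fin k → V} (he : ∀ a b, ip (e a) (e b) = if a = b then 1 else 0)
    (hs : ∀ X, X ∈ Submodule.span ℝ (Set.range e) ↔ ∀ Y ∈ K, ip X Y = 0)
    {B : V → V → ℝ} (hBs : ∀ X Y, B X Y = B Y X) (hBa : ∀ X Y Z, B (X + Y) Z = B X Z + B Y Z)
    (hBm : ∀ (c : ℝ) X Y, B (c • X) Y = c * B X Y) (hBK : ∀ X ∈ K, ∀ Y, B X Y = 0)
    (hdet : 0 ≤ (Matrix.of fun a c => B (e a) (e c)).det)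
    {b : Fin k → V} (hb : ∀ i j, ip (b i) (b j) = if i = j then 1 else 0) :
    (Matrix.of fun i j => B (b i) (b j)).det ≤ (Matrix.of fun a c => B (e a) (e c)).det := by
  rw [gram_eq_mul hsymm hpos he hs hBs hBa hBm hBK b, Matrix.det_mul, Matrix.det_mul,
    Matrix.det_transpose]
  have := det_sq_le_one (Matrix.of fun i a => ip (b i) (e a))
    fun i => sum_sq_le_one hsymm hpos he (by simp [hb])
  nlinarith

end InnerForm

/-! ### The Laplacian in coordinates -/

section Coordinates

open Filter Topology

variable {n : ℕ}

/-- The derivative of the determinant. -/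
theorem hasFDerivAt_det {E ι : Type*} [NormedAddCommGroup E] [NormedSpace ℝ E] [Fintype ι]
    [DecidableEq ι] {A : E → Matrix ι ι ℝ} {A' : ι → ι → E →L[ℝ] ℝ} {y : E}
    (h : ∀ i j, HasFDerivAt (fun z => A z i j) (A' i j) y) :
    HasFDerivAt (fun z => (A z).det) (∑ i, ∑ j, (A y).adjugate i j • A' j i) y := by
  have h1 : HasFDerivAt (fun z => (A z).det)
      (∑ σ : Equiv.Perm ι, ((Equiv.Perm.sign σ : ℤ) : ℝ) •
        ∑ i, (∏ j ∈ Finset.univ.erase i, A y (σ j) j) • A' (σ i) i) y := by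
    simp only [Matrix.det_apply']
    exact HasFDerivAt.fun_sum fun σ _ =>
      (HasFDerivAt.finsetProd fun i _ => h (σ i) i).const_mul _
  convert h1 using 1
  ext v
  have h2 : ∀ i, ∑ j, (A y).adjugate i j * A' j i v =
      ((A y).updateCol i fun j => A' j i v).det := by
    intro i
    rw [← Matrix.cramer_apply, Matrix.cramer_eq_adjugate_mulVec]
    rfl
  simp only [sum_apply, smul_apply, smul_eq_mul, h2,
    Matrix.det_apply', Finset.mul_sum]
  rw [Finset.sum_comm]
  refine Finset.sum_congr rfl fun σ _ => Finset.sum_congr rfl fun i _ => ?_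
  congr 1
  rw [← Finset.mul_prod_erase _ _ (Finset.mem_univ i), Matrix.updateCol_self, mul_comm]
  congr 1
  exact Finset.prod_congr rfl fun j hj => by
    rw [Matrix.updateCol_ne (Finset.ne_of_mem_erase hj)]

/-- The Jacobian matrix of a map. -/
def jacobian (τ : EuclideanSpace ℝ (Fin n) → EuclideanSpace ℝ (Fin n))
    (z : EuclideanSpace ℝ (Fin n)) : Matrix (Fin n) (Fin n) ℝ :=
  Matrix.of fun a i => pderiv i (fun z' => τ z' a) z

theorem pderiv_congr {i : Fin n} {u v : EuclideanSpace ℝ (Fin n) → ℝ}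
    {y : EuclideanSpace ℝ (Fin n)} (h : u =ᶠ[𝓝 y] v) : pderiv i u y = pderiv i v y := by
  rw [pderiv, h.fderiv_eq, pderiv]

theorem fderiv_eq_sum_pderiv (u : EuclideanSpace ℝ (Fin n) → ℝ) (y v : EuclideanSpace ℝ (Fin n)) :
    fderiv ℝ u y v = ∑ i, v i * pderiv i u y := by
  conv_lhs => rw [← (EuclideanSpace.basisFun (Fin n) ℝ).sum_repr v]
  simp [pderiv]

theorem pderiv_comp {F : EuclideanSpace ℝ (Fin n) → ℝ}
    {τ : EuclideanSpace ℝ (Fin n) → EuclideanSpace ℝ (Fin n)} {y : EuclideanSpace ℝ (Fin n)}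
    (hF : DifferentiableAt ℝ F (τ y)) (hτ : DifferentiableAt ℝ τ y) (i : Fin n) :
    pderiv i (fun z => F (τ z)) y = ∑ a, jacobian τ y a i * pderiv a F (τ y) := by
  have h : fderiv ℝ (fun z => F (τ z)) y = (fderiv ℝ F (τ y)).comp (fderiv ℝ τ y) :=
    fderiv_comp y hF hτ
  rw [pderiv, h, ContinuousLinearMap.comp_apply, fderiv_eq_sum_pderiv]
  refine Finset.sum_congr rfl fun a _ => ?_
  congr 1
  have h2 : fderiv ℝ (fun z => τ z a) y = (EuclideanSpace.proj a).comp (fderiv ℝ τ y) :=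
    ((EuclideanSpace.proj a : EuclideanSpace ℝ (Fin n) →L[ℝ] ℝ).hasFDerivAt.comp y
      hτ.hasFDerivAt).fderiv
  rw [jacobian, Matrix.of_apply, pderiv, h2]
  rfl

theorem contDiffAt_pderiv {u : EuclideanSpace ℝ (Fin n) → ℝ} {y : EuclideanSpace ℝ (Fin n)}
    (hu : ContDiffAt ℝ ∞ u y) (i : Fin n) : ContDiffAt ℝ ∞ (pderiv i u) y :=
  (hu.fderiv_right (m := ∞) (by simp)).clm_apply contDiffAt_const

theorem contDiffAt_det {E ι : Type*} [NormedAddCommGroup E] [NormedSpace ℝ E] [Fintype ι]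
    [DecidableEq ι] {A : E → Matrix ι ι ℝ} {y : E} {N : ℕ∞ω}
    (h : ∀ i j, ContDiffAt ℝ N (fun z => A z i j) y) :
    ContDiffAt ℝ N (fun z => (A z).det) y := by
  simp only [Matrix.det_apply']
  exact ContDiffAt.sum fun σ _ => contDiffAt_const.mul (contDiffAt_prod fun i _ => h _ _)

theorem contDiffAt_matrix_inv {E ι : Type*} [NormedAddCommGroup E] [NormedSpace ℝ E] [Fintype ι]
    [DecidableEq ι] {A : E → Matrix ι ι ℝ} {y : E} {N : ℕ∞ω}
    (h : ∀ i j, ContDiffAt ℝ N (fun z => A z i j) y) (hd : (A y).det ≠ 0) (i j : ι) :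
    ContDiffAt ℝ N (fun z => (A z)⁻¹ i j) y := by
  simp only [Matrix.inv_def, Ring.inverse_eq_inv', Matrix.smul_apply, smul_eq_mul,
    Matrix.adjugate_apply]
  refine ((contDiffAt_det h).inv hd).mul (contDiffAt_det fun a b => ?_)
  by_cases hja : a = j
  · subst hja
    simpa using contDiffAt_const
  · simpa [Matrix.updateRow_ne hja] using h a b

theorem eventually_differentiableAt {E E' : Type*} [NormedAddCommGroup E] [NormedSpace ℝ E]
    [NormedAddCommGroup E'] [NormedSpace ℝ E'] {u : E → E'} {y : E} (hu : ContDiffAt ℝ ∞ u y) :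
    ∀ᶠ z in 𝓝 y, DifferentiableAt ℝ u z :=
  ((hu.of_le (m := 1) (mod_cast le_top)).eventually (by simp)).mono fun _ hz =>
    hz.differentiableAt (by simp)

/-- Symmetry of second derivatives. -/
theorem pderiv_pderiv_comm {u : EuclideanSpace ℝ (Fin n) → ℝ} {y : EuclideanSpace ℝ (Fin n)}
    (hu : ContDiffAt ℝ ∞ u y) (i k : Fin n) :
    pderiv k (pderiv i u) y = pderiv i (pderiv k u) y := by
  have hd : DifferentiableAt ℝ (fderiv ℝ u) y :=
    (hu.fderiv_right (m := ∞) (by simp)).differentiableAt (by simp)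
  have key : ∀ i k : Fin n, pderiv k (pderiv i u) y =
      fderiv ℝ (fderiv ℝ u) y (EuclideanSpace.single k 1) (EuclideanSpace.single i 1) := by
    intro i k
    have : HasFDerivAt (pderiv i u)
        ((ContinuousLinearMap.apply ℝ ℝ (EuclideanSpace.single i (1 : ℝ))).comp
          (fderiv ℝ (fderiv ℝ u) y)) y :=
      (ContinuousLinearMap.apply ℝ ℝ (EuclideanSpace.single i (1 : ℝ))).hasFDerivAt.comp y
        hd.hasFDerivAt
    rw [pderiv, this.fderiv]
    rfl
  rw [key, key]
  exact (hu.isSymmSndFDerivAt (by simpa using ENat.LEInfty.out)).eq _ _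

/-- The Piola identity: `det J • J⁻¹ V` transforms the divergence by the factor `det J`. The
constant `c` leaves room for the sign in `√(det (Jᵀ g J)) = ± det J √(det g)`. -/
theorem sum_pderiv_piola {τ : EuclideanSpace ℝ (Fin n) → EuclideanSpace ℝ (Fin n)}
    {y : EuclideanSpace ℝ (Fin n)} (hτ : ContDiffAt ℝ ∞ τ y) (hJ : (jacobian τ y).det ≠ 0)
    {U V : Fin n → EuclideanSpace ℝ (Fin n) → ℝ} (hU : ∀ i, DifferentiableAt ℝ (U i) y)
    (hV : ∀ a, DifferentiableAt ℝ (V a) (τ y)) (c : ℝ)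
    (h : ∀ᶠ z in 𝓝 y, ∀ a, ∑ i, jacobian τ z a i * U i z = c * (jacobian τ z).det * V a (τ z)) :
    ∑ i, pderiv i (U i) y = c * (jacobian τ y).det * ∑ a, pderiv a (V a) (τ y) := by
  have hτd : DifferentiableAt ℝ τ y := hτ.differentiableAt (by simp)
  have hτa : ∀ a, ContDiffAt ℝ ∞ (fun z => τ z a) y := fun a =>
    (EuclideanSpace.proj a : EuclideanSpace ℝ (Fin n) →L[ℝ] ℝ).contDiff.contDiffAt.comp y hτ
  have hJs : ∀ a i, ContDiffAt ℝ ∞ (fun z => jacobian τ z a i) y := fun a i =>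
    contDiffAt_pderiv (hτa a) i
  have hJd : ∀ a i, DifferentiableAt ℝ (fun z => jacobian τ z a i) y := fun a i =>
    (hJs a i).differentiableAt (by simp)
  have hdet := hasFDerivAt_det fun a i => (hJd a i).hasFDerivAt
  set J := jacobian τ y with hJdef
  -- `w` is the gradient of the Jacobian determinant
  let w : Fin n → ℝ := fun k => pderiv k (fun z => (jacobian τ z).det) y
  let M : Matrix (Fin n) (Fin n) ℝ :=
    Matrix.of fun a k => ∑ i, pderiv k (fun z => jacobian τ z a i) y * U i y
  let U' : Matrix (Fin n) (Fin n) ℝ := Matrix.of fun i k => pderiv k (U i) y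
  let V' : Matrix (Fin n) (Fin n) ℝ := Matrix.of fun a b => pderiv b (V a) (τ y)
  let V0 : Fin n → ℝ := fun a => V a (τ y)
  let U0 : Fin n → ℝ := fun a => U a y
  have hw : ∀ k, w k = ∑ i, ∑ j, J.adjugate i j * pderiv k (fun z => jacobian τ z j i) y := by
    intro k
    simp only [w, pderiv, hdet.fderiv, sum_apply,
      smul_apply, smul_eq_mul]
  have hdiff : M + J * U' = c • Matrix.vecMulVec V0 w + (c * J.det) • (V' * J) := by
    ext a k
    have h1 : HasFDerivAt (fun z => ∑ i, jacobian τ z a i * U i z) _ y :=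
      HasFDerivAt.fun_sum fun i _ => (hJd a i).hasFDerivAt.mul (hU i).hasFDerivAt
    have h2 := ((hdet.const_mul c).mul ((hV a).hasFDerivAt.comp y hτd.hasFDerivAt))
    have h3 : (fun z => ∑ i, jacobian τ z a i * U i z) =ᶠ[𝓝 y]
        fun z => c * (jacobian τ z).det * V a (τ z) := h.mono fun z hz => hz a
    have h4 := congrArg (fun L : EuclideanSpace ℝ (Fin n) →L[ℝ] ℝ => L (EuclideanSpace.single k 1))
      (h1.unique (h2.congr_of_eventuallyEq h3))
    have h5 : fderiv ℝ (V a) (τ y) (fderiv ℝ τ y (EuclideanSpace.single k 1)) =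
        ∑ b, pderiv b (V a) (τ y) * J b k := by
      have := pderiv_comp (hV a) hτd k
      rw [pderiv, show fderiv ℝ (fun z => V a (τ z)) y = (fderiv ℝ (V a) (τ y)).comp (fderiv ℝ τ y)
        from fderiv_comp y (hV a) hτd, ContinuousLinearMap.comp_apply] at this
      rw [this]
      exact Finset.sum_congr rfl fun b _ => mul_comm _ _
    have h6 := hw k
    simp only [sum_apply, add_apply,
      smul_apply, smul_eq_mul, ContinuousLinearMap.comp_apply, h5,
      Finset.sum_add_distrib, Function.comp_apply] at h4
    simp only [pderiv] at h6
    simp only [Matrix.add_apply, Matrix.smul_apply, Matrix.vecMulVec_apply, smul_eq_mul,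
      Matrix.mul_apply, M, U', V', V0, Matrix.of_apply, h6]
    simp only [pderiv] at h4 ⊢
    rw [add_comm]
    convert h4 using 1
    · congr 1
      exact Finset.sum_congr rfl fun i _ => mul_comm _ _
    · ring
  have hU0 : U0 = c • J.adjugate.mulVec V0 := by
    have h0 : J.mulVec U0 = (c * J.det) • V0 := funext fun a => h.self_of_nhds a
    have h1 := congrArg (fun v => J.adjugate.mulVec v) h0
    simp only [Matrix.mulVec_mulVec, Matrix.adjugate_mul, Matrix.smul_mulVec, Matrix.one_mulVec,
      Matrix.mulVec_smul] at h1
    rw [mul_comm, mul_smul] at h1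
    exact smul_right_injective _ hJ h1
  have hM : (J.adjugate * M).trace = U0 ⬝ᵥ w := by
    simp only [Matrix.trace, Matrix.diag_apply, Matrix.mul_apply, M, Matrix.of_apply, dotProduct,
      hw, Finset.mul_sum, U0]
    rw [Finset.sum_congr rfl fun k _ => Finset.sum_comm, Finset.sum_comm]
    refine Finset.sum_congr rfl fun i _ => Finset.sum_congr rfl fun k _ =>
      Finset.sum_congr rfl fun a _ => ?_
    have : pderiv k (fun z => jacobian τ z a i) y = pderiv i (fun z => jacobian τ z a k) y :=
      pderiv_pderiv_comm (hτa a) i k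
    rw [this]
    ring
  have htr := congrArg (fun X => (J.adjugate * X).trace) hdiff
  have e1 : (J.adjugate * (J * U')).trace = J.det * U'.trace := by
    rw [← Matrix.mul_assoc, Matrix.adjugate_mul, Matrix.smul_mul, Matrix.one_mul, Matrix.trace_smul,
      smul_eq_mul]
  have e2 : (J.adjugate * Matrix.vecMulVec V0 w).trace = (J.adjugate.mulVec V0) ⬝ᵥ w := by
    rw [Matrix.mul_vecMulVec, Matrix.trace_vecMulVec]
  have e3 : (J.adjugate * (V' * J)).trace = J.det * V'.trace := by
    rw [Matrix.trace_mul_comm, Matrix.mul_assoc, Matrix.mul_adjugate, Matrix.mul_smul,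
      Matrix.mul_one, Matrix.trace_smul, smul_eq_mul]
  simp only [Matrix.mul_add, Matrix.trace_add, Matrix.mul_smul, Matrix.trace_smul, e1, e2, e3, hM,
    hU0, smul_dotProduct, smul_eq_mul] at htr
  have hfin : J.det * U'.trace = J.det * (c * J.det * V'.trace) := by linarith
  exact mul_left_cancel₀ hJ hfin

/-- The components of the density `√(det g) ∇F` in coordinates. -/
def gradientDensity (G : EuclideanSpace ℝ (Fin n) → Matrix (Fin n) (Fin n) ℝ)
    (F : EuclideanSpace ℝ (Fin n) → ℝ) (i : Fin n) (z : EuclideanSpace ℝ (Fin n)) : ℝ :=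
  √(G z).det * ∑ j, (G z)⁻¹ i j * pderiv j F z

/-- The Laplace–Beltrami operator of a matrix-valued function `G`, regarded as a metric in
coordinates. -/
def coordLaplacian (G : EuclideanSpace ℝ (Fin n) → Matrix (Fin n) (Fin n) ℝ)
    (F : EuclideanSpace ℝ (Fin n) → ℝ) (y : EuclideanSpace ℝ (Fin n)) : ℝ :=
  (√(G y).det)⁻¹ * ∑ i, pderiv i (gradientDensity G F i) y

theorem contDiffAt_gradientDensity {G : EuclideanSpace ℝ (Fin n) → Matrix (Fin n) (Fin n) ℝ}
    {F : EuclideanSpace ℝ (Fin n) → ℝ} {y : EuclideanSpace ℝ (Fin n)}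
    (hG : ∀ i j, ContDiffAt ℝ ∞ (fun z => G z i j) y) (hd : (G y).det ≠ 0)
    (hF : ContDiffAt ℝ ∞ F y) (i : Fin n) : ContDiffAt ℝ ∞ (gradientDensity G F i) y :=
  ((contDiffAt_det hG).sqrt hd).mul (ContDiffAt.sum fun j _ =>
    (contDiffAt_matrix_inv hG hd i j).mul (contDiffAt_pderiv hF j))

theorem contDiffAt_coordLaplacian {G : EuclideanSpace ℝ (Fin n) → Matrix (Fin n) (Fin n) ℝ}
    {F : EuclideanSpace ℝ (Fin n) → ℝ} {y : EuclideanSpace ℝ (Fin n)}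
    (hG : ∀ i j, ContDiffAt ℝ ∞ (fun z => G z i j) y) (hd : 0 < (G y).det)
    (hF : ContDiffAt ℝ ∞ F y) : ContDiffAt ℝ ∞ (coordLaplacian G F) y :=
  (((contDiffAt_det hG).sqrt hd.ne').inv (Real.sqrt_pos.2 hd).ne').mul (ContDiffAt.sum fun i _ =>
    contDiffAt_pderiv (contDiffAt_gradientDensity hG hd.ne' hF i) i)

theorem coordLaplacian_congr {G G' : EuclideanSpace ℝ (Fin n) → Matrix (Fin n) (Fin n) ℝ}
    {F F' : EuclideanSpace ℝ (Fin n) → ℝ} {y : EuclideanSpace ℝ (Fin n)}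
    (hG : G =ᶠ[𝓝 y] G') (hF : F =ᶠ[𝓝 y] F') :
    coordLaplacian G F y = coordLaplacian G' F' y := by
  have h : ∀ i, gradientDensity G F i =ᶠ[𝓝 y] gradientDensity G' F' i := by
    intro i
    filter_upwards [hG, hF.eventuallyEq_nhds] with z hz hz'
    simp only [gradientDensity, hz, pderiv_congr hz']
  rw [coordLaplacian, coordLaplacian, hG.self_of_nhds]
  congr 1
  exact Finset.sum_congr rfl fun i _ => pderiv_congr (h i)

theorem coordLaplacian_add {G : EuclideanSpace ℝ (Fin n) → Matrix (Fin n) (Fin n) ℝ}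
    {F F' : EuclideanSpace ℝ (Fin n) → ℝ} {y : EuclideanSpace ℝ (Fin n)}
    (hG : ∀ i j, ContDiffAt ℝ ∞ (fun z => G z i j) y) (hd : (G y).det ≠ 0)
    (hF : ContDiffAt ℝ ∞ F y) (hF' : ContDiffAt ℝ ∞ F' y) :
    coordLaplacian G (fun z => F z + F' z) y = coordLaplacian G F y + coordLaplacian G F' y := by
  have h1 : ∀ i, gradientDensity G (fun z => F z + F' z) i =ᶠ[𝓝 y]
      fun z => gradientDensity G F i z + gradientDensity G F' i z := by
    intro i
    filter_upwards [eventually_differentiableAt hF, eventually_differentiableAt hF'] with z hz hz'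
    have : ∀ j, pderiv j (fun z => F z + F' z) z = pderiv j F z + pderiv j F' z := fun j => by
      rw [pderiv, fderiv_fun_add hz hz']
      rfl
    simp only [gradientDensity, this, mul_add, Finset.sum_add_distrib]
  simp only [coordLaplacian, ← mul_add, ← Finset.sum_add_distrib]
  congr 1
  refine Finset.sum_congr rfl fun i _ => ?_
  rw [pderiv_congr (h1 i), pderiv, fderiv_fun_add
    ((contDiffAt_gradientDensity hG hd hF i).differentiableAt (by simp))
    ((contDiffAt_gradientDensity hG hd hF' i).differentiableAt (by simp))]
  rfl

theorem coordLaplacian_const_mul (G : EuclideanSpace ℝ (Fin n) → Matrix (Fin n) (Fin n) ℝ)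
    (F : EuclideanSpace ℝ (Fin n) → ℝ) (c : ℝ) (y : EuclideanSpace ℝ (Fin n)) :
    coordLaplacian G (fun z => c * F z) y = c * coordLaplacian G F y := by
  have h0 : ∀ (u : EuclideanSpace ℝ (Fin n) → ℝ) j z,
      pderiv j (fun z => c * u z) z = c * pderiv j u z := fun u j z => by
    have := congrArg (fun L : EuclideanSpace ℝ (Fin n) →L[ℝ] ℝ => L (EuclideanSpace.single j 1))
      (congrFun (fderiv_const_smul_field (𝕜 := ℝ) (f := u) c) z)
    exact this
  have h1 : ∀ i, gradientDensity G (fun z => c * F z) i =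
      fun z => c * gradientDensity G F i z := by
    intro i
    ext z
    simp only [gradientDensity, h0, Finset.mul_sum]
    exact Finset.sum_congr rfl fun j _ => by ring
  simp only [coordLaplacian, h1, h0, ← Finset.mul_sum]
  ring

/-- Invariance of the coordinate Laplacian under a change of coordinates `τ`. -/
theorem coordLaplacian_comp {τ : EuclideanSpace ℝ (Fin n) → EuclideanSpace ℝ (Fin n)}
    {y : EuclideanSpace ℝ (Fin n)} (hτ : ContDiffAt ℝ ∞ τ y) (hJ : (jacobian τ y).det ≠ 0)
    {G G' : EuclideanSpace ℝ (Fin n) → Matrix (Fin n) (Fin n) ℝ}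
    {F : EuclideanSpace ℝ (Fin n) → ℝ}
    (hG : ∀ i j, ContDiffAt ℝ ∞ (fun z => G z i j) (τ y)) (hd : 0 < (G (τ y)).det)
    (hF : ContDiffAt ℝ ∞ F (τ y))
    (hG' : ∀ᶠ z in 𝓝 y, G' z = (jacobian τ z).transpose * G (τ z) * jacobian τ z) :
    coordLaplacian G' (fun z => F (τ z)) y = coordLaplacian G F (τ y) := by
  have hτa : ∀ a, ContDiffAt ℝ ∞ (fun z => τ z a) y := fun a =>
    (EuclideanSpace.proj a : EuclideanSpace ℝ (Fin n) →L[ℝ] ℝ).contDiff.contDiffAt.comp y hτ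
  have hJs : ∀ a i, ContDiffAt ℝ ∞ (fun z => jacobian τ z a i) y := fun a i =>
    contDiffAt_pderiv (hτa a) i
  have hGs : ∀ i j, ContDiffAt ℝ ∞ (fun z => G' z i j) y := by
    intro i j
    refine ContDiffAt.congr_of_eventuallyEq (f := fun z =>
      ∑ b, (∑ a, jacobian τ z a i * G (τ z) a b) * jacobian τ z b j) ?_ ?_
    · exact ContDiffAt.sum fun b _ => (ContDiffAt.sum fun a _ =>
        (hJs a i).mul ((hG a b).comp y hτ)).mul (hJs b j)
    · filter_upwards [hG'] with z hz
      rw [hz]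
      simp [Matrix.mul_apply]
  -- `c` is the sign of the Jacobian determinant
  obtain ⟨c, hc1, hc⟩ : ∃ c : ℝ, |c| = 1 ∧ ∀ᶠ z in 𝓝 y, |(jacobian τ z).det| =
      c * (jacobian τ z).det := by
    have hcont : ContinuousAt (fun z => (jacobian τ z).det) y := (contDiffAt_det hJs).continuousAt
    rcases lt_or_gt_of_ne hJ with h | h
    · refine ⟨-1, by simp, ?_⟩
      filter_upwards [hcont.eventually_lt continuousAt_const h] with z hz
      rw [abs_of_neg hz, neg_one_mul]
    · refine ⟨1, by simp, ?_⟩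
      filter_upwards [(continuousAt_const).eventually_lt hcont h] with z hz
      rw [abs_of_pos hz, one_mul]
  have hdetG' : ∀ᶠ z in 𝓝 y, √(G' z).det = c * (jacobian τ z).det * √(G (τ z)).det := by
    filter_upwards [hG', hc] with z hz hcz
    rw [hz, Matrix.det_mul, Matrix.det_mul, Matrix.det_transpose, ← hcz,
      show (jacobian τ z).det * (G (τ z)).det * (jacobian τ z).det =
        (jacobian τ z).det ^ 2 * (G (τ z)).det by ring, Real.sqrt_mul (sq_nonneg _),
      Real.sqrt_sq_eq_abs]
  have hd' : (G' y).det ≠ 0 := by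
    rw [hG'.self_of_nhds, Matrix.det_mul, Matrix.det_mul, Matrix.det_transpose]
    exact mul_ne_zero (mul_ne_zero hJ hd.ne') hJ
  have hJne : ∀ᶠ z in 𝓝 y, (jacobian τ z).det ≠ 0 :=
    (contDiffAt_det hJs).continuousAt.eventually_ne hJ
  have hGne : ∀ᶠ z in 𝓝 y, (G (τ z)).det ≠ 0 :=
    ((contDiffAt_det hG).continuousAt.comp_of_eq hτ.continuousAt rfl).eventually_ne hd.ne'
  have hFτ : ContDiffAt ℝ ∞ (fun z => F (τ z)) y := hF.comp y hτ
  have key := sum_pderiv_piola hτ hJ (U := gradientDensity G' fun z => F (τ z))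
    (V := gradientDensity G F)
    (fun i => (contDiffAt_gradientDensity hGs hd' hFτ i).differentiableAt (by simp))
    (fun i => (contDiffAt_gradientDensity hG hd.ne' hF i).differentiableAt (by simp)) c (by
      filter_upwards [hG', hdetG', hJne, hGne, eventually_differentiableAt hτ,
        hτ.continuousAt.eventually (eventually_differentiableAt hF)] with z h1 h2 h3 h4 h5 h6 a
      have hp : ∀ j, pderiv j (fun z => F (τ z)) z = _ := fun j =>
        pderiv_comp h6 h5 j
      have hinv : jacobian τ z * (G' z)⁻¹ * (jacobian τ z).transpose = (G (τ z))⁻¹ := by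
        rw [h1, Matrix.mul_inv_rev, Matrix.mul_inv_rev, ← Matrix.mul_assoc,
          Matrix.mul_nonsing_inv _ (isUnit_iff_ne_zero.2 h3), Matrix.one_mul, Matrix.mul_assoc,
          Matrix.nonsing_inv_mul _ (by simpa using h3), Matrix.mul_one]
      let D : Fin n → ℝ := fun a => pderiv a F (τ z)
      have hpv : (fun j => pderiv j (fun z => F (τ z)) z) = (jacobian τ z).transpose.mulVec D := by
        ext j
        rw [hp]
        rfl
      have hU : ∀ i, gradientDensity G' (fun z => F (τ z)) i z =
          √(G' z).det * ((G' z)⁻¹.mulVec fun j => pderiv j (fun z => F (τ z)) z) i := fun i => rfl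
      have hV : gradientDensity G F a (τ z) = √(G (τ z)).det * ((G (τ z))⁻¹.mulVec D) a := rfl
      rw [hV, ← hinv, ← Matrix.mulVec_mulVec, ← hpv, ← Matrix.mulVec_mulVec]
      simp only [hU, h2]
      simp only [Matrix.mulVec, dotProduct, Finset.mul_sum]
      exact Finset.sum_congr rfl fun i _ => Finset.sum_congr rfl fun j _ => by ring)
  rw [coordLaplacian, key, coordLaplacian, hdetG'.self_of_nhds]
  have hcne : c ≠ 0 := fun h => by simp [h] at hc1
  have hs := (Real.sqrt_pos.2 hd).ne'
  field_simp

end Coordinates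

/-! ### Metrics and Laplacians in parametrizations -/

section Parametrizations

open Filter Topology Bundle

variable {n : ℕ} {M : Type*} [TopologicalSpace M]
  [ChartedSpace (EuclideanSpace ℝ (Fin n)) M] [IsManifold (𝓡 n) ∞ M]
  {E : Type*} [NormedAddCommGroup E] [NormedSpace ℝ E]
  {E' : Type*} [NormedAddCommGroup E'] [NormedSpace ℝ E']

/-- The pull-back of a Riemannian metric along a map `p` from a vector space, at the point `z`. -/
def pullbackForm (μ : Metric n M) (p : E → M) (z v w : E) : ℝ :=
  μ.inner (p z) (mfderiv 𝓘(ℝ, E) (𝓡 n) p z v) (mfderiv 𝓘(ℝ, E) (𝓡 n) p z w)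

theorem pullbackForm_symm (μ : Metric n M) (p : E → M) (z v w : E) :
    pullbackForm μ p z v w = pullbackForm μ p z w v :=
  μ.symm _ _ _

theorem exists_bilinForm_eq_pullbackForm (μ : Metric n M) (p : E → M) (z : E) :
    ∃ L : LinearMap.BilinForm ℝ E, ∀ v w, pullbackForm μ p z v w = L v w :=
  ⟨(μ.form (p z)).compl₁₂
    (mfderiv 𝓘(ℝ, E) (𝓡 n) p z : E →L[ℝ] TangentSpace (𝓡 n) (p z)).toLinearMap
    (mfderiv 𝓘(ℝ, E) (𝓡 n) p z : E →L[ℝ] TangentSpace (𝓡 n) (p z)).toLinearMap,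
    fun _ _ => rfl⟩

theorem contDiffAt_pullbackForm (μ : Metric n M) {p : E → M} {z : E}
    (hp : ContMDiffAt 𝓘(ℝ, E) (𝓡 n) ∞ p z) (v w : E) :
    ContDiffAt ℝ ∞ (fun z => pullbackForm μ p z v w) z := by
  have hv : ∀ v : E, ContMDiffAt 𝓘(ℝ, E) ((𝓡 n).prod 𝓘(ℝ, EuclideanSpace ℝ (Fin n))) ∞
      (fun z => TotalSpace.mk' (EuclideanSpace ℝ (Fin n))
        (E := fun x : M => TangentSpace (𝓡 n) x) (p z) (mfderiv 𝓘(ℝ, E) (𝓡 n) p z v)) z := by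
    intro v
    rw [contMDiffAt_totalSpace]
    refine ⟨hp, ?_⟩
    have h1 := ContMDiffAt.mfderiv_const hp (m := ∞) (by simp)
    refine (h1.clm_apply (contMDiffAt_const (c := v))).congr_of_eventuallyEq ?_
    filter_upwards [hp.continuousAt.preimage_mem_nhds
      ((chartAt (EuclideanSpace ℝ (Fin n)) (p z)).open_source.mem_nhds (mem_chart_source _ _))]
      with z' hz'
    have h2 := inTangentCoordinates_eq (I := 𝓘(ℝ, E)) (I' := 𝓡 n) id p
      (fun x => (mfderiv 𝓘(ℝ, E) (𝓡 n) p x : E →L[ℝ] EuclideanSpace ℝ (Fin n))) (x₀ := z) (x := z')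
      (by rw [chartAt_self_eq]; trivial) hz'
    rw [tangentBundleCore_coordChange_model_space] at h2
    exact (congrArg (fun L : E →L[ℝ] EuclideanSpace ℝ (Fin n) => L v) h2).symm
  have h : ContMDiffAt 𝓘(ℝ, E) ((𝓡 n).prod 𝓘(ℝ, ℝ)) ∞
      (fun m ↦ TotalSpace.mk' ℝ (E := Bundle.Trivial M ℝ) (p m) (pullbackForm μ p m v w)) z := by
    apply ContMDiffAt.clm_bundle_apply₂ (F₁ := EuclideanSpace ℝ (Fin n))
      (F₂ := EuclideanSpace ℝ (Fin n))
    · exact μ.contMDiff.contMDiffAt.comp z hp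
    · exact hv v
    · exact hv w
  rw [contMDiffAt_totalSpace] at h
  exact h.2.contDiffAt

/-- The matrix of the pull-back of a Riemannian metric along a map `p` from `ℝᵏ`. -/
def pullbackMatrix (μ : Metric n M) {k : ℕ} (p : EuclideanSpace ℝ (Fin k) → M)
    (z : EuclideanSpace ℝ (Fin k)) : Matrix (Fin k) (Fin k) ℝ :=
  Matrix.of fun i j => pullbackForm μ p z (EuclideanSpace.single i 1) (EuclideanSpace.single j 1)

theorem pullbackForm_comp (μ : Metric n M) {p : E → M} {q : E' → M} {τ : E → E'} {y : E}
    (hτ : DifferentiableAt ℝ τ y) (hq : MDifferentiableAt 𝓘(ℝ, E') (𝓡 n) q (τ y))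
    (h : p =ᶠ[𝓝 y] fun z => q (τ z)) (v w : E) :
    pullbackForm μ p y v w = pullbackForm μ q (τ y) (fderiv ℝ τ y v) (fderiv ℝ τ y w) := by
  have h1 : HasMFDerivAt 𝓘(ℝ, E) (𝓡 n) p y
      ((mfderiv 𝓘(ℝ, E') (𝓡 n) q (τ y) : E' →L[ℝ] EuclideanSpace ℝ (Fin n)).comp
        (fderiv ℝ τ y)) :=
    (hq.hasMFDerivAt.comp y hτ.hasFDerivAt.hasMFDerivAt).congr_of_eventuallyEq h
  have h2 : p y = q (τ y) := h.self_of_nhds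
  have h3 : ∀ (x x' : M) (_ : x = x') (v w : EuclideanSpace ℝ (Fin n)),
      μ.inner x v w = μ.inner x' v w := by
    rintro x _ rfl v w; rfl
  rw [pullbackForm, h1.mfderiv]
  exact h3 _ _ h2 _ _

theorem fderiv_single {τ : EuclideanSpace ℝ (Fin n) → EuclideanSpace ℝ (Fin n)}
    {y : EuclideanSpace ℝ (Fin n)} (hτ : DifferentiableAt ℝ τ y) (i : Fin n) :
    fderiv ℝ τ y (EuclideanSpace.single i 1) =
      ∑ a, jacobian τ y a i • EuclideanSpace.single a (1 : ℝ) := by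
  have h2 : ∀ a, fderiv ℝ (fun z => τ z a) y = (EuclideanSpace.proj a).comp (fderiv ℝ τ y) :=
    fun a => ((EuclideanSpace.proj a : EuclideanSpace ℝ (Fin n) →L[ℝ] ℝ).hasFDerivAt.comp y
      hτ.hasFDerivAt).fderiv
  ext b
  simp [jacobian, pderiv, h2, Pi.single_apply]

theorem pullbackMatrix_comp (μ : Metric n M) {p q : EuclideanSpace ℝ (Fin n) → M}
    {τ : EuclideanSpace ℝ (Fin n) → EuclideanSpace ℝ (Fin n)} {y : EuclideanSpace ℝ (Fin n)}
    (hτ : DifferentiableAt ℝ τ y) (hq : MDifferentiableAt (𝓡 n) (𝓡 n) q (τ y))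
    (h : p =ᶠ[𝓝 y] fun z => q (τ z)) :
    pullbackMatrix μ p y =
      (jacobian τ y).transpose * pullbackMatrix μ q (τ y) * jacobian τ y := by
  obtain ⟨L, hL⟩ := exists_bilinForm_eq_pullbackForm μ q (τ y)
  ext i j
  rw [pullbackMatrix, Matrix.of_apply, pullbackForm_comp μ hτ hq h, fderiv_single hτ,
    fderiv_single hτ, hL]
  simp only [map_sum, map_smul, LinearMap.sum_apply, LinearMap.smul_apply, smul_eq_mul,
    Matrix.mul_apply, Matrix.transpose_apply, Finset.sum_mul]
  refine Finset.sum_congr rfl fun b _ => ?_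
  rw [Finset.mul_sum]
  refine Finset.sum_congr rfl fun a _ => ?_
  rw [pullbackMatrix, Matrix.of_apply, hL]
  ring

theorem posDef_gram (μ : Metric n M) (x : M) {ι : Type*} [Fintype ι]
    {v : ι → TangentSpace (𝓡 n) x} (hv : LinearIndependent ℝ v) :
    (Matrix.of fun i j => μ.inner x (v i) (v j)).PosDef := by
  refine Matrix.PosDef.of_dotProduct_mulVec_pos ?_ fun c hc => ?_
  · ext i j
    exact μ.symm _ _ _
  · have hne : ∑ i, c i • v i ≠ 0 := fun h =>
      hc (funext (Fintype.linearIndependent_iff.1 hv c h))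
    have h := μ.pos x _ hne
    change 0 < μ.form x _ _ at h
    simp only [map_sum, map_smul, LinearMap.sum_apply, LinearMap.smul_apply, smul_eq_mul] at h
    refine h.trans_eq (Finset.sum_congr rfl fun a _ => congrArg (c a * ·)
      (Finset.sum_congr rfl fun b _ => ?_))
    rw [mul_comm]
    exact congrArg (· * c b) (μ.symm x _ _)

theorem linearIndependent_single {k : ℕ} :
    LinearIndependent ℝ fun i : Fin k => EuclideanSpace.single i (1 : ℝ) := by
  have h := (EuclideanSpace.basisFun (Fin k) ℝ).toBasis.linearIndependent
  have h2 : ⇑(EuclideanSpace.basisFun (Fin k) ℝ).toBasis = fun i => EuclideanSpace.single i 1 := by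
    ext1 i
    simp
  rwa [h2] at h

theorem contMDiffAt_chart_symm (x : M) {y : EuclideanSpace ℝ (Fin n)}
    (hy : y ∈ (chartAt (EuclideanSpace ℝ (Fin n)) x).target) :
    ContMDiffAt (𝓡 n) (𝓡 n) ∞ (chartAt (EuclideanSpace ℝ (Fin n)) x).symm y :=
  contMDiffAt_symm_of_mem_maximalAtlas (IsManifold.chart_mem_maximalAtlas x) hy

theorem metricMatrix_det_pos (μ : Metric n M) (x : M) {y : EuclideanSpace ℝ (Fin n)}
    (hy : y ∈ (chartAt (EuclideanSpace ℝ (Fin n)) x).target) :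
    0 < (metricMatrix μ (chartAt (EuclideanSpace ℝ (Fin n)) x) y).det := by
  have : IsManifold (𝓡 n) 1 M := IsManifold.of_le (n := ∞) (mod_cast le_top)
  have hinj := (mdifferentiable_chart (I := 𝓡 n) x).symm.mfderiv_injective hy
  refine (posDef_gram μ _ ?_).det_pos
  exact linearIndependent_single.map' _ (LinearMap.ker_eq_bot.2 hinj)

/-- The Laplace–Beltrami operator may be computed in any local parametrization. -/
theorem laplaceBeltrami_eq (μ : Metric n M) {f : M → ℝ} {p : EuclideanSpace ℝ (Fin n) → M}
    {y : EuclideanSpace ℝ (Fin n)} (hp : ContMDiffAt (𝓡 n) (𝓡 n) ∞ p y)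
    (hd : (pullbackMatrix μ p y).det ≠ 0) (hf : ContMDiffAt (𝓡 n) 𝓘(ℝ, ℝ) ∞ f (p y)) :
    laplaceBeltrami μ f (p y) = coordLaplacian (pullbackMatrix μ p) (fun z => f (p z)) y := by
  set φ := chartAt (EuclideanSpace ℝ (Fin n)) (p y) with hφ
  have hsrc : p y ∈ φ.source := mem_chart_source _ _
  have htgt : φ (p y) ∈ φ.target := φ.map_source hsrc
  have hφs : ContMDiffAt (𝓡 n) (𝓡 n) ∞ φ (p y) :=
    contMDiffAt_of_mem_maximalAtlas (IsManifold.chart_mem_maximalAtlas _) hsrc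
  have hτ : ContDiffAt ℝ ∞ (fun z => φ (p z)) y := (hφs.comp y hp).contDiffAt
  have hev : ∀ᶠ z in 𝓝 y, p z ∈ φ.source :=
    hp.continuousAt.eventually (φ.open_source.mem_nhds hsrc)
  have hG : ∀ i j, ContDiffAt ℝ ∞ (fun z => metricMatrix μ φ z i j) (φ (p y)) := fun i j =>
    contDiffAt_pullbackForm μ (contMDiffAt_chart_symm _ htgt) _ _
  have hF : ContDiffAt ℝ ∞ (fun z => f (φ.symm z)) (φ (p y)) := by
    refine ContMDiffAt.contDiffAt ?_
    refine ContMDiffAt.comp (φ (p y)) ?_ (contMDiffAt_chart_symm _ htgt)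
    rw [φ.left_inv hsrc]
    exact hf
  have hG' : ∀ᶠ z in 𝓝 y, pullbackMatrix μ p z =
      (jacobian (fun z => φ (p z)) z).transpose * metricMatrix μ φ (φ (p z)) *
        jacobian (fun z => φ (p z)) z := by
    filter_upwards [hev.eventually_nhds, eventually_differentiableAt hτ] with z hz hz'
    refine pullbackMatrix_comp μ hz' ((contMDiffAt_chart_symm _
      (φ.map_source hz.self_of_nhds)).mdifferentiableAt (by simp)) ?_
    filter_upwards [hz] with z' hz'
    exact (φ.left_inv hz').symm
  have hJ : (jacobian (fun z => φ (p z)) y).det ≠ 0 := by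
    intro h
    rw [hG'.self_of_nhds, Matrix.det_mul, h, mul_zero] at hd
    exact hd rfl
  have key := coordLaplacian_comp hτ hJ hG (metricMatrix_det_pos μ _ htgt) hF hG'
  have h2 : coordLaplacian (pullbackMatrix μ p) (fun z => f (p z)) y =
      coordLaplacian (pullbackMatrix μ p) (fun z => f (φ.symm (φ (p z)))) y := by
    refine coordLaplacian_congr EventuallyEq.rfl ?_
    filter_upwards [hev] with z hz
    rw [φ.left_inv hz]
  rw [h2, key]
  rfl

theorem laplaceBeltrami_eq_chart (μ : Metric n M) {f : M → ℝ} (x₀ : M) {x : M}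
    (hx : x ∈ (chartAt (EuclideanSpace ℝ (Fin n)) x₀).source)
    (hf : ContMDiffAt (𝓡 n) 𝓘(ℝ, ℝ) ∞ f x) :
    laplaceBeltrami μ f x = coordLaplacian (metricMatrix μ (chartAt (EuclideanSpace ℝ (Fin n)) x₀))
      (fun z => f ((chartAt (EuclideanSpace ℝ (Fin n)) x₀).symm z))
      (chartAt (EuclideanSpace ℝ (Fin n)) x₀ x) := by
  set φ := chartAt (EuclideanSpace ℝ (Fin n)) x₀
  have htgt : φ x ∈ φ.target := φ.map_source hx
  have hl : φ.symm (φ x) = x := φ.left_inv hx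
  have := laplaceBeltrami_eq μ (f := f) (p := φ.symm) (y := φ x)
    (contMDiffAt_chart_symm _ htgt) (metricMatrix_det_pos μ _ htgt).ne' (by rwa [hl])
  rwa [hl] at this

theorem contDiffAt_chart_symm {f : M → ℝ} (x₀ : M) {x : M}
    (hx : x ∈ (chartAt (EuclideanSpace ℝ (Fin n)) x₀).source)
    (hf : ContMDiffAt (𝓡 n) 𝓘(ℝ, ℝ) ∞ f x) :
    ContDiffAt ℝ ∞ (fun z => f ((chartAt (EuclideanSpace ℝ (Fin n)) x₀).symm z))
      (chartAt (EuclideanSpace ℝ (Fin n)) x₀ x) := by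
  set φ := chartAt (EuclideanSpace ℝ (Fin n)) x₀
  refine ContMDiffAt.contDiffAt ?_
  refine ContMDiffAt.comp (φ x) ?_ (contMDiffAt_chart_symm _ (φ.map_source hx))
  rwa [φ.left_inv hx]

theorem contMDiff_laplaceBeltrami (μ : Metric n M) {f : M → ℝ}
    (hf : ContMDiff (𝓡 n) 𝓘(ℝ, ℝ) ∞ f) :
    ContMDiff (𝓡 n) 𝓘(ℝ, ℝ) ∞ (laplaceBeltrami μ f) := by
  intro x₀
  set φ := chartAt (EuclideanSpace ℝ (Fin n)) x₀ with hφ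
  have hsrc : x₀ ∈ φ.source := mem_chart_source _ _
  have htgt : φ x₀ ∈ φ.target := φ.map_source hsrc
  have h1 : ContDiffAt ℝ ∞ (coordLaplacian (metricMatrix μ φ) fun z => f (φ.symm z)) (φ x₀) :=
    contDiffAt_coordLaplacian
      (fun i j => contDiffAt_pullbackForm μ (contMDiffAt_chart_symm _ htgt) _ _)
      (metricMatrix_det_pos μ _ htgt) (contDiffAt_chart_symm _ hsrc (hf x₀))
  have hφs : ContMDiffAt (𝓡 n) (𝓡 n) ∞ φ x₀ :=
    contMDiffAt_of_mem_maximalAtlas (IsManifold.chart_mem_maximalAtlas _) hsrc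
  refine (h1.contMDiffAt.comp x₀ hφs).congr_of_eventuallyEq ?_
  filter_upwards [φ.open_source.mem_nhds hsrc] with x hx
  exact laplaceBeltrami_eq_chart μ x₀ hx (hf x)

theorem laplaceBeltrami_add (μ : Metric n M) {f g : M → ℝ}
    (hf : ContMDiff (𝓡 n) 𝓘(ℝ, ℝ) ∞ f) (hg : ContMDiff (𝓡 n) 𝓘(ℝ, ℝ) ∞ g) (x : M) :
    laplaceBeltrami μ (fun x => f x + g x) x = laplaceBeltrami μ f x + laplaceBeltrami μ g x := by
  have hsrc := mem_chart_source (EuclideanSpace ℝ (Fin n)) x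
  have htgt := (chartAt (EuclideanSpace ℝ (Fin n)) x).map_source hsrc
  exact coordLaplacian_add
    (fun i j => contDiffAt_pullbackForm μ (contMDiffAt_chart_symm _ htgt) _ _)
    (metricMatrix_det_pos μ _ htgt).ne' (contDiffAt_chart_symm _ hsrc (hf x))
    (contDiffAt_chart_symm _ hsrc (hg x))

theorem laplaceBeltrami_const_mul (μ : Metric n M) (f : M → ℝ) (c : ℝ) (x : M) :
    laplaceBeltrami μ (fun x => c * f x) x = c * laplaceBeltrami μ f x :=
  coordLaplacian_const_mul _ _ _ _

end Parametrizations

/-! ### Maps of constant rank -/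

section ConstantRank

open Filter Topology Module

variable {E F : Type*} [NormedAddCommGroup E] [NormedSpace ℝ E] [FiniteDimensional ℝ E]
  [NormedAddCommGroup F] [NormedSpace ℝ F] [FiniteDimensional ℝ F]

/-- A subspace of a finite-dimensional space is the image of a continuous projection. -/
theorem exists_continuous_projection (K : Submodule ℝ E) :
    ∃ B : E →L[ℝ] K, ∀ k : K, B k = k := by
  obtain ⟨B, hB⟩ := K.subtype.exists_leftInverse_of_injective K.ker_subtype
  exact ⟨LinearMap.toContinuousLinearMap B, fun k => LinearMap.congr_fun hB k⟩

/-- The implicit function data of a function near a point, with a linear function as second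
component. -/
theorem exists_implicitFunctionData {R : Type*} [NormedAddCommGroup R] [NormedSpace ℝ R]
    [FiniteDimensional ℝ R] {f : E → R} {x₀ : E} (hf : ContDiffAt ℝ ∞ f x₀) {K : Submodule ℝ E}
    (hK : ∀ v, fderiv ℝ f x₀ v = 0 ↔ v ∈ K) (hsurj : Function.Surjective (fderiv ℝ f x₀))
    {B : E →L[ℝ] K} (hB : ∀ k : K, B k = k) :
    ∃ φ : ImplicitFunctionData ℝ E R K, φ.leftFun = f ∧ φ.rightFun = B ∧ φ.pt = x₀ := by
  refine ⟨⟨f, fderiv ℝ f x₀, B, B, x₀, hf.hasStrictFDerivAt (by simp), B.hasStrictFDerivAt,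
    LinearMap.range_eq_top.2 hsurj, LinearMap.range_eq_top.2 fun k => ⟨k, hB k⟩, ?_⟩, rfl, rfl, rfl⟩
  have hker : (fderiv ℝ f x₀).ker = K := by
    ext v
    exact hK v
  rw [hker]
  exact LinearMap.isCompl_of_proj hB

/-- The image of a map of locally constant rank `r` has locally Hausdorff dimension at most `r`. -/
theorem exists_nhds_dimH_image_le {f : E → F} {x₀ : E} {r : ℕ} (hf : ContDiffAt ℝ ∞ f x₀)
    (hr : ∀ᶠ x in 𝓝 x₀, finrank ℝ (fderiv ℝ f x).range = r) :
    ∃ U ∈ 𝓝 x₀, dimH (f '' U) ≤ r := by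
  obtain ⟨A, hA⟩ := exists_continuous_projection (fderiv ℝ f x₀).range
  obtain ⟨B, hB⟩ := exists_continuous_projection (fderiv ℝ f x₀).ker
  have hAf : ContDiffAt ℝ ∞ (fun x => A (f x)) x₀ := A.contDiff.contDiffAt.comp x₀ hf
  have hAd : ∀ v, fderiv ℝ (fun x => A (f x)) x₀ v = A (fderiv ℝ f x₀ v) := fun v => by
    have : fderiv ℝ (fun x => A (f x)) x₀ = A.comp (fderiv ℝ f x₀) :=
      (A.hasFDerivAt.comp x₀ (hf.differentiableAt (by simp)).hasFDerivAt).fderiv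
    rw [this]
    rfl
  have hAR : ∀ v, A (fderiv ℝ f x₀ v) = ⟨fderiv ℝ f x₀ v, v, rfl⟩ := fun v =>
    hA ⟨fderiv ℝ f x₀ v, v, rfl⟩
  obtain ⟨φ, hleft, hright, hpt⟩ := exists_implicitFunctionData hAf (K := (fderiv ℝ f x₀).ker)
    (fun v => by
      rw [hAd, hAR]
      exact Subtype.ext_iff)
    (fun ⟨y, v, hv⟩ => ⟨v, by rw [hAd, hAR]; exact Subtype.ext hv⟩) hB
  set ψ := φ.implicitFunction.uncurry with hψ
  set p₀ := φ.prodFun φ.pt with hp₀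
  have hψs : ContDiffAt ℝ ∞ ψ p₀ := φ.contDiffAt_implicitFunction (by rwa [hleft, hpt])
    (by rw [hright]; exact B.contDiff.contDiffAt) (by simp)
  have hψ₀ : ψ p₀ = x₀ := by
    rw [← hpt]
    exact φ.implicitFunction_apply_image.self_of_nhds
  have hψt : Tendsto ψ (𝓝 p₀) (𝓝 x₀) :=
    hψs.continuousAt.tendsto.trans (congrArg 𝓝 hψ₀).le
  have hg : ContDiffAt ℝ ∞ (f ∘ ψ) p₀ := by
    refine ContDiffAt.comp p₀ ?_ hψs
    rwa [hψ₀]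
  have hgood : ∀ᶠ p in 𝓝 p₀, ContDiffAt ℝ 1 (f ∘ ψ) p ∧
      ∀ k, fderiv ℝ (f ∘ ψ) p (0, k) = 0 := by
    filter_upwards [(hg.of_le (m := 1) (mod_cast le_top)).eventually (by simp),
      eventually_differentiableAt hψs, hψt.eventually (eventually_differentiableAt hf),
      φ.leftFun_implicitFunction.eventually_nhds, hψt.eventually hr] with p h1 h2 h3 h4 h5
    refine ⟨h1, ?_⟩
    have hcomp : fderiv ℝ (f ∘ ψ) p = (fderiv ℝ f (ψ p)).comp (fderiv ℝ ψ p) :=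
      fderiv_comp p h3 h2
    -- differentiating `A (f (ψ p)) = p.1`
    have hid : ∀ w, A (fderiv ℝ f (ψ p) (fderiv ℝ ψ p w)) = w.1 := by
      intro w
      have e1 : HasFDerivAt (fun p => A (f (ψ p)))
          (A.comp ((fderiv ℝ f (ψ p)).comp (fderiv ℝ ψ p))) p :=
        A.hasFDerivAt.comp p (h3.hasFDerivAt.comp p h2.hasFDerivAt)
      have e2 : (fun p => A (f (ψ p))) =ᶠ[𝓝 p] Prod.fst := by
        filter_upwards [h4] with z hz
        rw [hleft] at hz
        exact hz
      exact congrArg (fun L => L w)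
        (e1.unique (hasFDerivAt_fst.congr_of_eventuallyEq e2))
    have hinj : Function.Injective
        (A.toLinearMap.domRestrict (fderiv ℝ f (ψ p)).range) := by
      have hsurj : Function.Surjective
          (A.toLinearMap.domRestrict (fderiv ℝ f (ψ p)).range) := fun u =>
        ⟨⟨fderiv ℝ f (ψ p) (fderiv ℝ ψ p (u, 0)), _, rfl⟩, hid (u, 0)⟩
      exact (LinearMap.injective_iff_surjective_of_finrank_eq_finrank
        (by rw [h5, hr.self_of_nhds])).2 hsurj
    intro k
    rw [hcomp]
    have hk : A.toLinearMap.domRestrict (fderiv ℝ f (ψ p)).range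
        ⟨fderiv ℝ f (ψ p) (fderiv ℝ ψ p (0, k)), _, rfl⟩ = 0 := hid (0, k)
    exact congrArg Subtype.val (hinj (hk.trans (map_zero _).symm))
  obtain ⟨ε, hε, hball⟩ := Metric.eventually_nhds_iff_ball.1 hgood
  have hconst : ∀ p ∈ Metric.ball p₀ ε, f (ψ p) = f (ψ (p.1, p₀.2)) := by
    rintro ⟨u, k⟩ hp
    rw [Metric.mem_ball, Prod.dist_eq, max_lt_iff] at hp
    have hmem : ∀ k' ∈ Metric.ball p₀.2 ε, ((u, k') : _ × _) ∈ Metric.ball p₀ ε := fun k' hk' => by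
      rw [Metric.mem_ball, Prod.dist_eq, max_lt_iff]
      exact ⟨hp.1, hk'⟩
    have hder : ∀ k' ∈ Metric.ball p₀.2 ε, HasFDerivAt (fun k' => f (ψ (u, k')))
        (0 : (fderiv ℝ f x₀).ker →L[ℝ] F) k' := by
      intro k' hk'
      have h := hball _ (hmem k' hk')
      have e1 := (h.1.differentiableAt (by simp)).hasFDerivAt.comp k'
        (hasFDerivAt_prodMk_right u k')
      have h0 : (fderiv ℝ (f ∘ ψ) (u, k')).comp
          (ContinuousLinearMap.inr ℝ (fderiv ℝ f x₀).range (fderiv ℝ f x₀).ker) = 0 := by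
        ext1 w
        exact h.2 w
      rw [h0] at e1
      exact e1
    exact (Metric.isOpen_ball (x := p₀.2) (ε := ε)).is_const_of_fderiv_eq_zero (𝕜 := ℝ)
      (convex_ball _ _).isPreconnected
      (fun k' hk' => (hder k' hk').differentiableAt.differentiableWithinAt)
      (fun k' hk' => (hder k' hk').fderiv) hp.2 (Metric.mem_ball_self hε)
  refine ⟨{x | φ.prodFun x ∈ Metric.ball p₀ ε ∧
    φ.implicitFunction (φ.leftFun x) (φ.rightFun x) = x}, ?_, ?_⟩
  · have h2 := φ.implicitFunction_apply_image
    have h1 : ∀ᶠ x in 𝓝 φ.pt, φ.prodFun x ∈ Metric.ball p₀ ε :=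
      φ.hasStrictFDerivAt.continuousAt.eventually (Metric.ball_mem_nhds _ hε)
    rw [hpt] at h1 h2
    exact h1.and h2
  · have hsub : f '' {x | φ.prodFun x ∈ Metric.ball p₀ ε ∧
        φ.implicitFunction (φ.leftFun x) (φ.rightFun x) = x} ⊆
        (fun u => f (ψ (u, p₀.2))) '' Metric.ball p₀.1 ε := by
      rintro _ ⟨x, ⟨hx1, hx2⟩, rfl⟩
      refine ⟨φ.leftFun x, ?_, ?_⟩
      · have := hx1
        rw [Metric.mem_ball, Prod.dist_eq, max_lt_iff] at this
        exact this.1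
      · exact (hconst _ hx1).symm.trans (congrArg f hx2)
    have hcd : ContDiffOn ℝ 1 (fun u => f (ψ (u, p₀.2))) (Metric.ball p₀.1 ε) := by
      intro u hu
      have hm : ((u, p₀.2) : _ × _) ∈ Metric.ball p₀ ε := by
        rw [Metric.mem_ball, Prod.dist_eq, max_lt_iff]
        exact ⟨hu, by simpa using hε⟩
      exact ((hball _ hm).1.comp u (contDiffAt_id.prodMk contDiffAt_const)).contDiffWithinAt
    calc dimH _ ≤ _ := dimH_mono hsub
      _ ≤ dimH (Metric.ball p₀.1 ε) := hcd.dimH_image_le (convex_ball _ _) subset_rfl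
      _ ≤ dimH (Set.univ : Set (fderiv ℝ f x₀).range) := dimH_mono (Set.subset_univ _)
      _ = r := by rw [Real.dimH_univ_eq_finrank, hr.self_of_nhds]

end ConstantRank

/-! ### Orbits as fibres of the projection -/

/-- The chain rule, with derivatives typed between the model spaces. -/
theorem hasMFDerivAt_comp_of_eq {E₁ E₂ E₃ M₁ M₂ M₃ : Type*}
    [NormedAddCommGroup E₁] [NormedSpace ℝ E₁] [TopologicalSpace M₁] [ChartedSpace E₁ M₁]
    [NormedAddCommGroup E₂] [NormedSpace ℝ E₂] [TopologicalSpace M₂] [ChartedSpace E₂ M₂]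
    [NormedAddCommGroup E₃] [NormedSpace ℝ E₃] [TopologicalSpace M₃] [ChartedSpace E₃ M₃]
    {f : M₁ → M₂} {g : M₂ → M₃} {x : M₁} {y : M₂} {g' : E₂ →L[ℝ] E₃} {f' : E₁ →L[ℝ] E₂}
    (hg : HasMFDerivAt 𝓘(ℝ, E₂) 𝓘(ℝ, E₃) g y g') (hf : HasMFDerivAt 𝓘(ℝ, E₁) 𝓘(ℝ, E₂) f x f')
    (hy : f x = y) : HasMFDerivAt 𝓘(ℝ, E₁) 𝓘(ℝ, E₃) (fun z => g (f z)) x (g'.comp f') := by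
  subst hy
  exact hg.comp x hf

theorem hasMFDerivAt_unique_of_eq {E₁ E₂ M₁ M₂ : Type*}
    [NormedAddCommGroup E₁] [NormedSpace ℝ E₁] [TopologicalSpace M₁] [ChartedSpace E₁ M₁]
    [NormedAddCommGroup E₂] [NormedSpace ℝ E₂] [TopologicalSpace M₂] [ChartedSpace E₂ M₂]
    {f g : M₁ → M₂} {x : M₁} {f' g' : E₁ →L[ℝ] E₂}
    (hf : HasMFDerivAt 𝓘(ℝ, E₁) 𝓘(ℝ, E₂) f x f') (hg : HasMFDerivAt 𝓘(ℝ, E₁) 𝓘(ℝ, E₂) g x g')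
    (h : ∀ z, f z = g z) : f' = g' := by
  obtain rfl : f = g := funext h
  exact hasMFDerivAt_unique hf hg

theorem hasMFDerivAt_congr_deriv {E₁ E₂ M₁ M₂ : Type*}
    [NormedAddCommGroup E₁] [NormedSpace ℝ E₁] [TopologicalSpace M₁] [ChartedSpace E₁ M₁]
    [NormedAddCommGroup E₂] [NormedSpace ℝ E₂] [TopologicalSpace M₂] [ChartedSpace E₂ M₂]
    {f : M₁ → M₂} {x : M₁} {f' g' : E₁ →L[ℝ] E₂}
    (hf : HasMFDerivAt 𝓘(ℝ, E₁) 𝓘(ℝ, E₂) f x f') (h : f' = g') :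
    HasMFDerivAt 𝓘(ℝ, E₁) 𝓘(ℝ, E₂) f x g' :=
  h ▸ hf

theorem fderiv_eq_of_hasMFDerivAt {E₁ E₂ : Type*} [NormedAddCommGroup E₁] [NormedSpace ℝ E₁]
    [NormedAddCommGroup E₂] [NormedSpace ℝ E₂] {f : E₁ → E₂} {x : E₁} {f' : E₁ →L[ℝ] E₂}
    (h : HasMFDerivAt 𝓘(ℝ, E₁) 𝓘(ℝ, E₂) f x f') : fderiv ℝ f x = f' :=
  mfderiv_eq_fderiv.symm.trans h.mfderiv

theorem finrank_range_comp_comp {E₁ E₂ E₃ E₄ : Type*} [AddCommGroup E₁] [Module ℝ E₁]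
    [AddCommGroup E₂] [Module ℝ E₂] [AddCommGroup E₃] [Module ℝ E₃] [AddCommGroup E₄] [Module ℝ E₄]
    {L₁ : E₃ →ₗ[ℝ] E₄} {L : E₂ →ₗ[ℝ] E₃} {L₂ : E₁ →ₗ[ℝ] E₂} (h₁ : Function.Injective L₁)
    (h₂ : Function.Surjective L₂) :
    Module.finrank ℝ (LinearMap.range (L₁ ∘ₗ L ∘ₗ L₂)) = Module.finrank ℝ (LinearMap.range L) := by
  rw [LinearMap.range_comp, LinearMap.range_comp_of_range_eq_top _ (LinearMap.range_eq_top.2 h₂)]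
  exact (Submodule.equivMapOfInjective L₁ h₁ _).finrank_eq.symm

theorem orbitProj_smul {G Q : Type*} [Group G] [MulAction G Q] (g : G) (q : Q) :
    orbitProj G (g • q) = orbitProj G q :=
  Quotient.sound ⟨g, rfl⟩

theorem exists_smul_eq_of_orbitProj_eq {G Q : Type*} [Group G] [MulAction G Q] {x q : Q}
    (h : orbitProj G x = orbitProj G q) : ∃ g : G, g • q = x :=
  Quotient.exact h

/-- The differential of the orbit projection. -/
def projDeriv (m n : ℕ) (G : Type*) {Q : Type*} [Group G] [MulAction G Q] [TopologicalSpace Q]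
    [ChartedSpace (EuclideanSpace ℝ (Fin n)) Q]
    [ChartedSpace (EuclideanSpace ℝ (Fin m)) (MulAction.orbitRel.Quotient G Q)] (q : Q) :
    EuclideanSpace ℝ (Fin n) →L[ℝ] EuclideanSpace ℝ (Fin m) :=
  mfderiv (𝓡 n) (𝓡 m) (orbitProj G) q

theorem hasMFDerivAt_orbitProj {m n : ℕ} {G Q : Type*} [Group G] [MulAction G Q]
    [TopologicalSpace Q] [ChartedSpace (EuclideanSpace ℝ (Fin n)) Q]
    [ChartedSpace (EuclideanSpace ℝ (Fin m)) (MulAction.orbitRel.Quotient G Q)]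
    (hπ : ContMDiff (𝓡 n) (𝓡 m) ∞ (orbitProj G : Q → _)) (q : Q) :
    HasMFDerivAt (𝓡 n) (𝓡 m) (orbitProj G : Q → _) q (projDeriv m n G q) :=
  ((hπ q).mdifferentiableAt (by simp)).hasMFDerivAt

section Action

open Filter Topology Module

variable {d n m : ℕ}
    {G : Type*} [TopologicalSpace G]
    [ChartedSpace (EuclideanSpace ℝ (Fin d)) G] [Group G]
    {Q : Type*} [TopologicalSpace Q]
    [ChartedSpace (EuclideanSpace ℝ (Fin n)) Q]
    [MulAction G Q]

/-- The differential at `q` of the translation `x ↦ g • x`. -/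
def smulDeriv (g : G) (q : Q) : EuclideanSpace ℝ (Fin n) →L[ℝ] EuclideanSpace ℝ (Fin n) :=
  mfderiv (𝓡 n) (𝓡 n) (fun x : Q => g • x) q

/-- The differential at `1` of the orbit map `g ↦ g • q`. -/
def orbitDeriv (d n : ℕ) (G : Type*) [TopologicalSpace G]
    [ChartedSpace (EuclideanSpace ℝ (Fin d)) G] [Group G] {Q : Type*} [TopologicalSpace Q]
    [ChartedSpace (EuclideanSpace ℝ (Fin n)) Q] [MulAction G Q] (q : Q) :
    EuclideanSpace ℝ (Fin d) →L[ℝ] EuclideanSpace ℝ (Fin n) :=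
  mfderiv (𝓡 d) (𝓡 n) (fun g : G => g • q) 1

theorem contMDiff_const_smul [ContMDiffSMul (𝓡 d) (𝓡 n) ∞ G Q] (g : G) :
    ContMDiff (𝓡 n) (𝓡 n) ∞ fun x : Q => g • x :=
  (contMDiff_const (c := g)).smul (I := 𝓡 d) (I' := 𝓡 n) contMDiff_id

theorem contMDiff_orbit [ContMDiffSMul (𝓡 d) (𝓡 n) ∞ G Q] (q : Q) :
    ContMDiff (𝓡 d) (𝓡 n) ∞ fun g : G => g • q :=
  contMDiff_id.smul (I := 𝓡 d) (I' := 𝓡 n) (contMDiff_const (c := q))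

theorem hasMFDerivAt_smul [ContMDiffSMul (𝓡 d) (𝓡 n) ∞ G Q] (g : G) (q : Q) :
    HasMFDerivAt (𝓡 n) (𝓡 n) (fun x : Q => g • x) q (smulDeriv g q) :=
  ((contMDiff_const_smul (d := d) g q).mdifferentiableAt (by simp)).hasMFDerivAt

theorem hasMFDerivAt_orbit [ContMDiffSMul (𝓡 d) (𝓡 n) ∞ G Q] (q : Q) :
    HasMFDerivAt (𝓡 d) (𝓡 n) (fun g : G => g • q) 1 (orbitDeriv d n G q) :=
  ((contMDiff_orbit q (1 : G)).mdifferentiableAt (by simp)).hasMFDerivAt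

theorem smulDeriv_inv_comp [IsManifold (𝓡 n) ∞ Q] [ContMDiffSMul (𝓡 d) (𝓡 n) ∞ G Q]
    (g : G) (q : Q) :
    (smulDeriv g⁻¹ (g • q)).comp (smulDeriv g q) =
      ContinuousLinearMap.id ℝ (EuclideanSpace ℝ (Fin n)) := by
  have h1 := hasMFDerivAt_comp_of_eq (hasMFDerivAt_smul (d := d) (n := n) g⁻¹ (g • q))
    (hasMFDerivAt_smul (d := d) (n := n) g q) rfl
  exact hasMFDerivAt_unique_of_eq h1 (hasMFDerivAt_id q) fun z => inv_smul_smul g z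

theorem smulDeriv_injective [IsManifold (𝓡 n) ∞ Q] [ContMDiffSMul (𝓡 d) (𝓡 n) ∞ G Q]
    (g : G) (q : Q) : Function.Injective (smulDeriv (n := n) g q) :=
  Function.LeftInverse.injective (g := smulDeriv g⁻¹ (g • q)) fun v =>
    congrArg (fun L : EuclideanSpace ℝ (Fin n) →L[ℝ] EuclideanSpace ℝ (Fin n) => L v)
      (smulDeriv_inv_comp (d := d) g q)

theorem orbitDeriv_Ad [LieGroup (𝓡 d) ∞ G] [ContMDiffSMul (𝓡 d) (𝓡 n) ∞ G Q] (g : G) (q : Q)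
    (X : EuclideanSpace ℝ (Fin d)) :
    orbitDeriv d n G (g • q) (Ad g X) = smulDeriv g q (orbitDeriv d n G q X) := by
  have hAd : HasMFDerivAt (𝓡 d) (𝓡 d) (fun h : G => g * h * g⁻¹) 1
      (mfderiv (𝓡 d) (𝓡 d) (fun h : G => g * h * g⁻¹) 1) := by
    refine MDifferentiableAt.hasMFDerivAt (ContMDiffAt.mdifferentiableAt (n := ∞) ?_ (by simp))
    exact ((contMDiff_const.mul contMDiff_id).mul contMDiff_const) 1
  have h1 := hasMFDerivAt_comp_of_eq (hasMFDerivAt_orbit (d := d) (n := n) (G := G) (g • q)) hAd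
    (by simp)
  have h2 := hasMFDerivAt_comp_of_eq (hasMFDerivAt_smul (d := d) (n := n) g q)
    (hasMFDerivAt_orbit (d := d) (n := n) (G := G) q) (one_smul G q)
  exact congrArg (fun L : EuclideanSpace ℝ (Fin d) →L[ℝ] EuclideanSpace ℝ (Fin n) => L X)
    (hasMFDerivAt_unique_of_eq h1 h2 fun z => by simp only [mul_smul, inv_smul_smul])

variable [ChartedSpace (EuclideanSpace ℝ (Fin m)) (MulAction.orbitRel.Quotient G Q)]

theorem projDeriv_orbitDeriv [ContMDiffSMul (𝓡 d) (𝓡 n) ∞ G Q]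
    (hπ : ContMDiff (𝓡 n) (𝓡 m) ∞ (orbitProj G : Q → _)) (q : Q) (X : EuclideanSpace ℝ (Fin d)) :
    projDeriv m n G q (orbitDeriv d n G q X) = 0 := by
  have h1 := hasMFDerivAt_comp_of_eq (hasMFDerivAt_orbitProj hπ q)
    (hasMFDerivAt_orbit (d := d) (n := n) (G := G) q) (one_smul G q)
  exact congrArg (fun L : EuclideanSpace ℝ (Fin d) →L[ℝ] EuclideanSpace ℝ (Fin m) => L X)
    (hasMFDerivAt_unique_of_eq h1 (hasMFDerivAt_const (orbitProj G q) (1 : G))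
      fun g => orbitProj_smul g q)

theorem projDeriv_smulDeriv [ContMDiffSMul (𝓡 d) (𝓡 n) ∞ G Q]
    (hπ : ContMDiff (𝓡 n) (𝓡 m) ∞ (orbitProj G : Q → _)) (g : G) (q : Q)
    (v : EuclideanSpace ℝ (Fin n)) :
    projDeriv m n G (g • q) (smulDeriv g q v) = projDeriv m n G q v := by
  have h1 := hasMFDerivAt_comp_of_eq (hasMFDerivAt_orbitProj hπ (g • q))
    (hasMFDerivAt_smul (d := d) (n := n) g q) rfl
  exact congrArg (fun L : EuclideanSpace ℝ (Fin n) →L[ℝ] EuclideanSpace ℝ (Fin m) => L v)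
    (hasMFDerivAt_unique_of_eq h1 (hasMFDerivAt_orbitProj hπ q) fun x => orbitProj_smul g x)

theorem hasMFDerivAt_chart {k : ℕ} {M : Type*} [TopologicalSpace M]
    [ChartedSpace (EuclideanSpace ℝ (Fin k)) M] [IsManifold (𝓡 k) ∞ M] (x₀ : M) {x : M}
    (hx : x ∈ (chartAt (EuclideanSpace ℝ (Fin k)) x₀).source) :
    ∃ L : EuclideanSpace ℝ (Fin k) →L[ℝ] EuclideanSpace ℝ (Fin k), Function.Bijective L ∧
      HasMFDerivAt (𝓡 k) (𝓡 k) (chartAt (EuclideanSpace ℝ (Fin k)) x₀) x L := by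
  have : IsManifold (𝓡 k) 1 M := IsManifold.of_le (n := ∞) (mod_cast le_top)
  have h := mdifferentiable_chart (I := 𝓡 k) x₀
  exact ⟨_, h.mfderiv_bijective hx, (h.mdifferentiableAt hx).hasMFDerivAt⟩

theorem hasMFDerivAt_chart_symm {k : ℕ} {M : Type*} [TopologicalSpace M]
    [ChartedSpace (EuclideanSpace ℝ (Fin k)) M] [IsManifold (𝓡 k) ∞ M] (x₀ : M)
    {y : EuclideanSpace ℝ (Fin k)}
    (hy : y ∈ (chartAt (EuclideanSpace ℝ (Fin k)) x₀).target) :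
    ∃ L : EuclideanSpace ℝ (Fin k) →L[ℝ] EuclideanSpace ℝ (Fin k), Function.Bijective L ∧
      HasMFDerivAt (𝓡 k) (𝓡 k) (chartAt (EuclideanSpace ℝ (Fin k)) x₀).symm y L := by
  have : IsManifold (𝓡 k) 1 M := IsManifold.of_le (n := ∞) (mod_cast le_top)
  have h := (mdifferentiable_chart (I := 𝓡 k) x₀).symm
  exact ⟨_, h.mfderiv_bijective hy, (h.mdifferentiableAt hy).hasMFDerivAt⟩

variable [IsManifold (𝓡 n) ∞ Q]

/-- In a chart of `Q`, an orbit has Hausdorff dimension at most the rank of the differential of the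
orbit map at the identity. -/
theorem dimH_image_orbit_le [SecondCountableTopology G] [LieGroup (𝓡 d) ∞ G]
    [ContMDiffSMul (𝓡 d) (𝓡 n) ∞ G Q] (x₀ q : Q) {F : Type*} [NormedAddCommGroup F]
    [NormedSpace ℝ F] (B : EuclideanSpace ℝ (Fin n) →L[ℝ] F) :
    dimH ((fun g : G => B (chartAt (EuclideanSpace ℝ (Fin n)) x₀ (g • q))) ''
      {g | g • q ∈ (chartAt (EuclideanSpace ℝ (Fin n)) x₀).source}) ≤
      finrank ℝ (orbitDeriv d n G q).range := by
  set φ := chartAt (EuclideanSpace ℝ (Fin n)) x₀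
  set O : Set G := {g | g • q ∈ φ.source}
  have hO : IsOpen O := φ.open_source.preimage
    (contMDiff_orbit (d := d) (n := n) q).continuous
  have hloc : ∀ g₀ ∈ O, ∃ U ∈ 𝓝 g₀, dimH ((fun g : G => B (φ (g • q))) '' U) ≤
      finrank ℝ (orbitDeriv d n G q).range := by
    intro g₀ hg₀
    set γ := chartAt (EuclideanSpace ℝ (Fin d)) g₀
    have hsrc : g₀ ∈ γ.source := mem_chart_source _ _
    have htgt : γ g₀ ∈ γ.target := γ.map_source hsrc
    let f : EuclideanSpace ℝ (Fin d) → EuclideanSpace ℝ (Fin n) := fun x => φ (γ.symm x • q)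
    have hf : ContDiffAt ℝ ∞ f (γ g₀) := by
      have h1 : ContMDiffAt (𝓡 d) (𝓡 d) ∞ γ.symm (γ g₀) := contMDiffAt_chart_symm _ htgt
      have h2 : ContMDiffAt (𝓡 d) (𝓡 n) ∞ (fun x => γ.symm x • q) (γ g₀) :=
        (contMDiff_orbit q (γ.symm (γ g₀))).comp (γ g₀) h1
      have h3 : ContMDiffAt (𝓡 n) (𝓡 n) ∞ φ (γ.symm (γ g₀) • q) :=
        contMDiffAt_of_mem_maximalAtlas (IsManifold.chart_mem_maximalAtlas _)
          (by rw [γ.left_inv hsrc]; exact hg₀)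
      exact (h3.comp (γ g₀) h2).contDiffAt
    have hr : ∀ᶠ x in 𝓝 (γ g₀), finrank ℝ (fderiv ℝ f x).range =
        finrank ℝ (orbitDeriv d n G q).range := by
      have hcont : ContinuousAt γ.symm (γ g₀) := γ.continuousAt_symm htgt
      have hev : ∀ᶠ x in 𝓝 (γ g₀), γ.symm x ∈ O :=
        hcont.eventually (hO.mem_nhds (by rw [γ.left_inv hsrc]; exact hg₀))
      filter_upwards [hev, γ.open_target.mem_nhds htgt] with x hx hxt
      set g := γ.symm x with hg
      obtain ⟨L₁, hL₁, hL₁'⟩ := hasMFDerivAt_chart x₀ hx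
      obtain ⟨L₄, hL₄, hL₄'⟩ := hasMFDerivAt_chart_symm g₀ hxt
      have hmul : ∀ a b : G, HasMFDerivAt (𝓡 d) (𝓡 d) (fun h : G => a * h) b
          (smulDeriv (Q := G) (n := d) a b) := fun a b => hasMFDerivAt_smul (d := d) a b
      have h1 := hasMFDerivAt_comp_of_eq (hmul g⁻¹ g) hL₄' hg.symm
      have h2 := hasMFDerivAt_comp_of_eq (hasMFDerivAt_orbit (n := n) q) h1
        (by rw [← hg, inv_mul_cancel])
      have h3 := hasMFDerivAt_comp_of_eq (hasMFDerivAt_smul (d := d) g q) h2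
        (by rw [← hg, inv_mul_cancel, one_smul])
      have h4 := hasMFDerivAt_comp_of_eq hL₁' h3 (by rw [← hg, inv_mul_cancel, one_smul])
      have hfx : (fun z => φ (g • (g⁻¹ * γ.symm z) • q)) = f := funext fun z => by
        simp only [f, smul_smul, mul_inv_cancel_left]
      rw [← hfx, fderiv_eq_of_hasMFDerivAt h4]
      have hinj := smulDeriv_injective (d := d) (n := d) (Q := G) g⁻¹ g
      have hsurj := LinearMap.injective_iff_surjective.1
        (show Function.Injective (smulDeriv (Q := G) (n := d) g⁻¹ g).toLinearMap from hinj)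
      exact finrank_range_comp_comp (L₁ := (L₁.comp (smulDeriv g q)).toLinearMap)
        (L := (orbitDeriv d n G q).toLinearMap)
        (L₂ := ((smulDeriv (Q := G) (n := d) g⁻¹ g).comp L₄).toLinearMap)
        (hL₁.1.comp (smulDeriv_injective (d := d) g q)) (hsurj.comp hL₄.2)
    obtain ⟨U, hU, hdim⟩ := exists_nhds_dimH_image_le hf hr
    refine ⟨γ ⁻¹' U ∩ γ.source, Filter.inter_mem ((γ.continuousAt hsrc).preimage_mem_nhds hU)
      (γ.open_source.mem_nhds hsrc), ?_⟩
    have hsub : (fun g : G => B (φ (g • q))) '' (γ ⁻¹' U ∩ γ.source) ⊆ B '' (f '' U) := by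
      rintro _ ⟨g, ⟨hg1, hg2⟩, rfl⟩
      refine ⟨_, ⟨γ g, hg1, rfl⟩, ?_⟩
      simp only [f, γ.left_inv hg2]
    exact (dimH_mono hsub).trans ((B.lipschitz.dimH_image_le _).trans hdim)
  choose! U hU hdim using hloc
  obtain ⟨t, hts, htc, hcov⟩ := TopologicalSpace.countable_cover_nhdsWithin
    (fun g hg => mem_nhdsWithin_of_mem_nhds (s := U g) (t := O) (hU g hg))
  calc dimH ((fun g : G => B (φ (g • q))) '' O)
      ≤ dimH (⋃ g ∈ t, (fun g : G => B (φ (g • q))) '' U g) := by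
        refine dimH_mono ?_
        rw [← Set.image_iUnion₂]
        exact Set.image_mono hcov
    _ = ⨆ g ∈ t, dimH ((fun g : G => B (φ (g • q))) '' U g) := dimH_bUnion htc _
    _ ≤ finrank ℝ (orbitDeriv d n G q).range := iSup₂_le fun g hg => hdim g (hts hg)

/-- The tangent space of an orbit is the kernel of the differential of the projection: the fibre is
a submanifold of dimension `dim ker dπ`, and it is covered by the orbit map, which has constant
rank. -/
theorem ker_projDeriv_eq_range [SecondCountableTopology G] [LieGroup (𝓡 d) ∞ G]
    [ContMDiffSMul (𝓡 d) (𝓡 n) ∞ G Q] [IsManifold (𝓡 m) ∞ (MulAction.orbitRel.Quotient G Q)]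
    (hπ : ContMDiff (𝓡 n) (𝓡 m) ∞ (orbitProj G : Q → _)) (q : Q)
    (hsurj : Function.Surjective (projDeriv m n G q)) :
    (orbitDeriv d n G q).range = (projDeriv m n G q).ker := by
  have hle : (orbitDeriv d n G q).range ≤ (projDeriv m n G q).ker := by
    rintro _ ⟨X, rfl⟩
    exact projDeriv_orbitDeriv hπ q X
  refine Submodule.eq_of_le_of_finrank_le hle ?_
  set φ := chartAt (EuclideanSpace ℝ (Fin n)) q
  set β := chartAt (EuclideanSpace ℝ (Fin m)) (orbitProj G q)
  have hsrc : q ∈ φ.source := mem_chart_source _ _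
  have htgt : φ q ∈ φ.target := φ.map_source hsrc
  have hl : φ.symm (φ q) = q := φ.left_inv hsrc
  have hβ : orbitProj G q ∈ β.source := mem_chart_source _ _
  let f : EuclideanSpace ℝ (Fin n) → EuclideanSpace ℝ (Fin m) :=
    fun x => β (orbitProj G (φ.symm x))
  have hf : ContDiffAt ℝ ∞ f (φ q) := by
    have h1 : ContMDiffAt (𝓡 n) (𝓡 n) ∞ φ.symm (φ q) := contMDiffAt_chart_symm _ htgt
    have h2 : ContMDiffAt (𝓡 n) (𝓡 m) ∞ (fun x => orbitProj G (φ.symm x)) (φ q) :=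
      (hπ (φ.symm (φ q))).comp (φ q) h1
    have h3 : ContMDiffAt (𝓡 m) (𝓡 m) ∞ β (orbitProj G (φ.symm (φ q))) :=
      contMDiffAt_of_mem_maximalAtlas (IsManifold.chart_mem_maximalAtlas _) (by rwa [hl])
    exact (h3.comp (φ q) h2).contDiffAt
  obtain ⟨L₁, hL₁, hL₁'⟩ := hasMFDerivAt_chart (orbitProj G q) hβ
  obtain ⟨L₃, hL₃, hL₃'⟩ := hasMFDerivAt_chart_symm q htgt
  have h1 := hasMFDerivAt_comp_of_eq (hasMFDerivAt_orbitProj hπ q) hL₃' hl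
  have h2 := hasMFDerivAt_comp_of_eq hL₁' h1 (by rw [hl])
  have hfd : fderiv ℝ f (φ q) = L₁.comp ((projDeriv m n G q).comp L₃) :=
    fderiv_eq_of_hasMFDerivAt h2
  have hfs : Function.Surjective (fderiv ℝ f (φ q)) := by
    rw [hfd]
    exact hL₁.2.comp (hsurj.comp hL₃.2)
  set K := (fderiv ℝ f (φ q)).ker with hK
  have hfin : finrank ℝ K = finrank ℝ (projDeriv m n G q).ker := by
    have e1 := (fderiv ℝ f (φ q)).toLinearMap.finrank_range_add_finrank_ker
    have e2 := (projDeriv m n G q).toLinearMap.finrank_range_add_finrank_ker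
    rw [LinearMap.range_eq_top.2 hfs, finrank_top] at e1
    rw [LinearMap.range_eq_top.2 hsurj, finrank_top] at e2
    exact Nat.add_left_cancel (e1.trans e2.symm)
  obtain ⟨B, hB⟩ := exists_continuous_projection K
  obtain ⟨Φ, hleft, hright, hpt⟩ := exists_implicitFunctionData hf (K := K) (fun v => Iff.rfl)
    hfs hB
  -- points of the fibre with prescribed second component
  let j : K → EuclideanSpace ℝ (Fin n) := fun k => Φ.implicitFunction (Φ.leftFun Φ.pt) k
  have hpair : Tendsto (fun k : K => (Φ.leftFun Φ.pt, k)) (𝓝 (Φ.rightFun Φ.pt))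
      (𝓝 (Φ.prodFun Φ.pt)) := by
    have : Continuous fun k : K => (Φ.leftFun Φ.pt, k) := by fun_prop
    exact this.tendsto _
  have hj : Tendsto j (𝓝 (Φ.rightFun Φ.pt)) (𝓝 (φ q)) := by
    have h0 : j (Φ.rightFun Φ.pt) = φ q :=
      (Φ.implicitFunction_apply_image.self_of_nhds).trans hpt
    exact Φ.differentiableAt_implicitFunction.continuousAt.tendsto.trans (congrArg 𝓝 h0).le
  have hN : (fun g : G => B (φ (g • q))) '' {g | g • q ∈ φ.source} ∈ 𝓝 (Φ.rightFun Φ.pt) := by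
    have hcont : Tendsto (fun x => orbitProj G (φ.symm x)) (𝓝 (φ q)) (𝓝 (orbitProj G q)) := by
      have e1 : ContinuousAt (fun x => orbitProj G (φ.symm x)) (φ q) :=
        hπ.continuous.continuousAt.comp (φ.continuousAt_symm htgt)
      have e2 := e1.tendsto
      rwa [hl] at e2
    filter_upwards [hj.eventually (φ.open_target.mem_nhds htgt),
      hj.eventually (hcont.eventually (β.open_source.mem_nhds hβ)),
      hpair.eventually Φ.prodFun_implicitFunction] with k hk1 hk2 hk3
    have e1 : f (j k) = f (φ q) := by
      have := congrArg Prod.fst hk3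
      simp only [ImplicitFunctionData.prodFun_apply, hleft, hpt] at this
      rw [← this]
      simp only [j, hleft, hpt]
    have e2 : B (j k) = k := by
      have := congrArg Prod.snd hk3
      simp only [ImplicitFunctionData.prodFun_apply, hright] at this
      exact this
    have e3 : orbitProj G (φ.symm (j k)) = orbitProj G q := by
      refine β.injOn hk2 hβ (e1.trans ?_)
      simp only [f, hl]
    obtain ⟨g, hg⟩ := exists_smul_eq_of_orbitProj_eq e3
    refine ⟨g, ?_, ?_⟩
    · rw [Set.mem_ofPred_eq, hg]
      exact φ.map_target hk1
    · simp only [hg, φ.right_inv hk1, e2]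
  have hdim := dimH_image_orbit_le (d := d) (G := G) q q B
  rw [Real.dimH_of_mem_nhds hN, hfin] at hdim
  exact_mod_cast hdim

end Action

/-! ### Parametrizations adapted to the action -/

section AdaptedParametrization

open Filter Topology Module

theorem chart_add_zero_mem_target {k : ℕ} {M : Type*} [TopologicalSpace M]
    [ChartedSpace (EuclideanSpace ℝ (Fin k)) M] (x : M) :
    chartAt (EuclideanSpace ℝ (Fin k)) x x + 0 ∈ (chartAt (EuclideanSpace ℝ (Fin k)) x).target := by
  rw [add_zero]
  exact OpenPartialHomeomorph.map_source _ (mem_chart_source _ _)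

theorem hasMFDerivAt_chart_self {k : ℕ} {M : Type*} [TopologicalSpace M]
    [ChartedSpace (EuclideanSpace ℝ (Fin k)) M] [IsManifold (𝓡 k) ∞ M] (x : M) :
    HasMFDerivAt (𝓡 k) (𝓡 k) (chartAt (EuclideanSpace ℝ (Fin k)) x) x
      (ContinuousLinearMap.id ℝ (EuclideanSpace ℝ (Fin k))) := by
  have : IsManifold (𝓡 k) 1 M := IsManifold.of_le (n := ∞) (mod_cast le_top)
  have h := mfderiv_extChartAt_self (I := 𝓡 k) (x := x)
  have h2 := (mdifferentiableAt_extChartAt (I := 𝓡 k) (mem_chart_source _ x)).hasMFDerivAt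
  rw [h] at h2
  exact h2

theorem hasMFDerivAt_chart_symm_self {k : ℕ} {M : Type*} [TopologicalSpace M]
    [ChartedSpace (EuclideanSpace ℝ (Fin k)) M] [IsManifold (𝓡 k) ∞ M] (x : M) :
    HasMFDerivAt (𝓡 k) (𝓡 k) (chartAt (EuclideanSpace ℝ (Fin k)) x).symm
      (chartAt (EuclideanSpace ℝ (Fin k)) x x)
      (ContinuousLinearMap.id ℝ (EuclideanSpace ℝ (Fin k))) := by
  set φ := chartAt (EuclideanSpace ℝ (Fin k)) x with hφ
  have htgt : φ x ∈ φ.target := φ.map_source (mem_chart_source _ _)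
  obtain ⟨L, -, hL⟩ := hasMFDerivAt_chart_symm x htgt
  have h1 := hasMFDerivAt_comp_of_eq (hasMFDerivAt_chart_self x) hL
    (φ.left_inv (mem_chart_source _ _))
  have h2 : HasMFDerivAt (𝓡 k) (𝓡 k) (fun z => φ (φ.symm z)) (φ x)
      (ContinuousLinearMap.id ℝ (EuclideanSpace ℝ (Fin k))) := by
    refine (hasMFDerivAt_id (φ x)).congr_of_eventuallyEq ?_
    filter_upwards [φ.open_target.mem_nhds htgt] with z hz
    exact φ.right_inv hz
  have h3 : (ContinuousLinearMap.id ℝ (EuclideanSpace ℝ (Fin k))).comp L =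
      ContinuousLinearMap.id ℝ _ := hasMFDerivAt_unique_of_eq h1 h2 fun _ => rfl
  rw [ContinuousLinearMap.id_comp] at h3
  exact hasMFDerivAt_congr_deriv hL h3

variable {d n m : ℕ}
    {G : Type*} [TopologicalSpace G]
    [ChartedSpace (EuclideanSpace ℝ (Fin d)) G] [Group G]
    {Q : Type*} [TopologicalSpace Q]
    [ChartedSpace (EuclideanSpace ℝ (Fin n)) Q]
    [MulAction G Q]

/-- The map `(x, y) ↦ c(x) • φ⁻¹(y)`, where `φ` is the chart at `q₀` and `c` is the inverse of the
chart of the group at `1`, centred so that `c(0) = 1`. -/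
def actionParam (d n : ℕ) (G : Type*) [TopologicalSpace G]
    [ChartedSpace (EuclideanSpace ℝ (Fin d)) G] [Group G] {Q : Type*} [TopologicalSpace Q]
    [ChartedSpace (EuclideanSpace ℝ (Fin n)) Q] [MulAction G Q] (q₀ : Q)
    (p : EuclideanSpace ℝ (Fin d) × EuclideanSpace ℝ (Fin n)) : Q :=
  (chartAt (EuclideanSpace ℝ (Fin d)) (1 : G)).symm
    (chartAt (EuclideanSpace ℝ (Fin d)) (1 : G) 1 + p.1) •
    (chartAt (EuclideanSpace ℝ (Fin n)) q₀).symm p.2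

/-- The differential of `actionParam`. -/
def actionParamDeriv (d n : ℕ) (G : Type*) [TopologicalSpace G]
    [ChartedSpace (EuclideanSpace ℝ (Fin d)) G] [Group G] {Q : Type*} [TopologicalSpace Q]
    [ChartedSpace (EuclideanSpace ℝ (Fin n)) Q] [MulAction G Q] (q₀ : Q)
    (p : EuclideanSpace ℝ (Fin d) × EuclideanSpace ℝ (Fin n)) :
    EuclideanSpace ℝ (Fin d) × EuclideanSpace ℝ (Fin n) →L[ℝ] EuclideanSpace ℝ (Fin n) :=
  mfderiv 𝓘(ℝ, EuclideanSpace ℝ (Fin d) × EuclideanSpace ℝ (Fin n)) (𝓡 n)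
    (actionParam d n G q₀) p

theorem actionParam_zero (q₀ : Q) (y : EuclideanSpace ℝ (Fin n)) :
    actionParam d n G q₀ (0, y) = (chartAt (EuclideanSpace ℝ (Fin n)) q₀).symm y := by
  rw [actionParam, add_zero, OpenPartialHomeomorph.left_inv _ (mem_chart_source _ _), one_smul]

theorem orbitProj_actionParam (q₀ : Q)
    (p : EuclideanSpace ℝ (Fin d) × EuclideanSpace ℝ (Fin n)) :
    orbitProj G (actionParam d n G q₀ p) =
      orbitProj G ((chartAt (EuclideanSpace ℝ (Fin n)) q₀).symm p.2) :=
  orbitProj_smul _ _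

variable [IsManifold (𝓡 n) ∞ Q] [LieGroup (𝓡 d) ∞ G] [ContMDiffSMul (𝓡 d) (𝓡 n) ∞ G Q]

theorem contMDiffAt_actionParam (q₀ : Q)
    {p : EuclideanSpace ℝ (Fin d) × EuclideanSpace ℝ (Fin n)}
    (h₁ : chartAt (EuclideanSpace ℝ (Fin d)) (1 : G) 1 + p.1 ∈
      (chartAt (EuclideanSpace ℝ (Fin d)) (1 : G)).target)
    (h₂ : p.2 ∈ (chartAt (EuclideanSpace ℝ (Fin n)) q₀).target) :
    ContMDiffAt 𝓘(ℝ, EuclideanSpace ℝ (Fin d) × EuclideanSpace ℝ (Fin n)) (𝓡 n) ∞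
      (actionParam d n G q₀) p := by
  have e1 : ContMDiffAt 𝓘(ℝ, EuclideanSpace ℝ (Fin d) × EuclideanSpace ℝ (Fin n)) (𝓡 d) ∞
      (fun p : EuclideanSpace ℝ (Fin d) × EuclideanSpace ℝ (Fin n) =>
        chartAt (EuclideanSpace ℝ (Fin d)) (1 : G) 1 + p.1) p :=
    (contDiff_const.add contDiff_fst).contDiffAt.contMDiffAt
  have e2 : ContMDiffAt 𝓘(ℝ, EuclideanSpace ℝ (Fin d) × EuclideanSpace ℝ (Fin n)) (𝓡 n) ∞
      (fun p : EuclideanSpace ℝ (Fin d) × EuclideanSpace ℝ (Fin n) => p.2) p :=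
    contDiff_snd.contDiffAt.contMDiffAt
  exact ((contMDiffAt_chart_symm (1 : G) h₁).comp p e1).smul (I := 𝓡 d) (I' := 𝓡 n)
    ((contMDiffAt_chart_symm q₀ h₂).comp p e2)

theorem hasMFDerivAt_actionParam (q₀ : Q)
    {p : EuclideanSpace ℝ (Fin d) × EuclideanSpace ℝ (Fin n)}
    (h₁ : chartAt (EuclideanSpace ℝ (Fin d)) (1 : G) 1 + p.1 ∈
      (chartAt (EuclideanSpace ℝ (Fin d)) (1 : G)).target)
    (h₂ : p.2 ∈ (chartAt (EuclideanSpace ℝ (Fin n)) q₀).target) :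
    HasMFDerivAt 𝓘(ℝ, EuclideanSpace ℝ (Fin d) × EuclideanSpace ℝ (Fin n)) (𝓡 n)
      (actionParam d n G q₀) p (actionParamDeriv d n G q₀ p) :=
  ((contMDiffAt_actionParam q₀ h₁ h₂).mdifferentiableAt (by simp)).hasMFDerivAt

theorem actionParamDeriv_inl (q₀ : Q) {y : EuclideanSpace ℝ (Fin n)}
    (hy : y ∈ (chartAt (EuclideanSpace ℝ (Fin n)) q₀).target) (X : EuclideanSpace ℝ (Fin d)) :
    actionParamDeriv d n G q₀ (0, y) (X, 0) =
      orbitDeriv d n G (actionParam d n G q₀ (0, y)) X := by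
  rw [actionParam_zero]
  have h1 := hasMFDerivAt_actionParam (G := G) q₀ (p := (0, y))
    (chart_add_zero_mem_target (k := d) (1 : G)) hy
  have h2 := hasMFDerivAt_comp_of_eq h1
    (hasFDerivAt_prodMk_left (𝕜 := ℝ) (0 : EuclideanSpace ℝ (Fin d)) y).hasMFDerivAt rfl
  have h3 : HasMFDerivAt (𝓡 d) (𝓡 d)
      (fun x => chartAt (EuclideanSpace ℝ (Fin d)) (1 : G) 1 + x) 0
      (ContinuousLinearMap.id ℝ (EuclideanSpace ℝ (Fin d))) :=
    ((hasFDerivAt_id (𝕜 := ℝ) (0 : EuclideanSpace ℝ (Fin d))).const_add _).hasMFDerivAt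
  have h4 := hasMFDerivAt_comp_of_eq (hasMFDerivAt_chart_symm_self (1 : G)) h3 (add_zero _)
  have h5 := hasMFDerivAt_comp_of_eq (hasMFDerivAt_orbit (d := d) (n := n) (G := G)
    ((chartAt (EuclideanSpace ℝ (Fin n)) q₀).symm y)) h4
    (by rw [add_zero, OpenPartialHomeomorph.left_inv _ (mem_chart_source _ _)])
  exact congrArg (fun L : EuclideanSpace ℝ (Fin d) →L[ℝ] EuclideanSpace ℝ (Fin n) => L X)
    (hasMFDerivAt_unique_of_eq h2 h5 fun _ => rfl)

theorem actionParamDeriv_inr (q₀ : Q)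
    {x : EuclideanSpace ℝ (Fin d)} {v : EuclideanSpace ℝ (Fin n)}
    (hx : chartAt (EuclideanSpace ℝ (Fin d)) (1 : G) 1 + x ∈
      (chartAt (EuclideanSpace ℝ (Fin d)) (1 : G)).target) :
    actionParamDeriv d n G q₀ (x, chartAt (EuclideanSpace ℝ (Fin n)) q₀ q₀) (0, v) =
      smulDeriv ((chartAt (EuclideanSpace ℝ (Fin d)) (1 : G)).symm
        (chartAt (EuclideanSpace ℝ (Fin d)) (1 : G) 1 + x)) q₀ v := by
  set φ := chartAt (EuclideanSpace ℝ (Fin n)) q₀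
  have h1 := hasMFDerivAt_actionParam (G := G) q₀ (p := (x, φ q₀)) hx
    (φ.map_source (mem_chart_source _ _))
  have h2 := hasMFDerivAt_comp_of_eq h1
    (hasFDerivAt_prodMk_right (𝕜 := ℝ) x (φ q₀)).hasMFDerivAt rfl
  have h3 := hasMFDerivAt_comp_of_eq (hasMFDerivAt_smul (d := d) (n := n)
    ((chartAt (EuclideanSpace ℝ (Fin d)) (1 : G)).symm
        (chartAt (EuclideanSpace ℝ (Fin d)) (1 : G) 1 + x)) q₀)
    (hasMFDerivAt_chart_symm_self q₀) (φ.left_inv (mem_chart_source _ _))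
  exact congrArg (fun L : EuclideanSpace ℝ (Fin n) →L[ℝ] EuclideanSpace ℝ (Fin n) => L v)
    (hasMFDerivAt_unique_of_eq h2 h3 fun _ => rfl)

theorem pullbackForm_actionParam_inl (μ : Metric n Q) (q₀ : Q) {y : EuclideanSpace ℝ (Fin n)}
    (hy : y ∈ (chartAt (EuclideanSpace ℝ (Fin n)) q₀).target) (X Y : EuclideanSpace ℝ (Fin d)) :
    pullbackForm μ (actionParam d n G q₀) (0, y) (X, 0) (Y, 0) =
      inertia (G := G) μ ((chartAt (EuclideanSpace ℝ (Fin n)) q₀).symm y) X Y := by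
  rw [← actionParam_zero (d := d) (G := G)]
  have h : ∀ X, actionParamDeriv d n G q₀ (0, y) (X, 0) = _ := actionParamDeriv_inl q₀ hy
  exact congrArg₂ (fun v w : EuclideanSpace ℝ (Fin n) =>
    μ.inner (actionParam d n G q₀ (0, y)) v w) (h X) (h Y)

theorem contMDiff_inertia (μ : Metric n Q) (X Y : GroupLieAlgebra (𝓡 d) G) :
    ContMDiff (𝓡 n) 𝓘(ℝ, ℝ) ∞ fun q : Q => inertia μ q X Y := by
  intro q₀
  set φ := chartAt (EuclideanSpace ℝ (Fin n)) q₀ with hφ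
  have hsrc : q₀ ∈ φ.source := mem_chart_source _ _
  have htgt : φ q₀ ∈ φ.target := φ.map_source hsrc
  have h1 := contDiffAt_pullbackForm μ (contMDiffAt_actionParam (G := G) q₀ (p := (0, φ q₀))
    (chart_add_zero_mem_target _) htgt) (X, 0) (Y, 0)
  have h2 : ContDiffAt ℝ ∞ (fun y => pullbackForm μ (actionParam d n G q₀) (0, y) (X, 0) (Y, 0))
      (φ q₀) := h1.comp (φ q₀) (contDiffAt_const.prodMk contDiffAt_id)
  have hφs : ContMDiffAt (𝓡 n) (𝓡 n) ∞ φ q₀ :=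
    contMDiffAt_of_mem_maximalAtlas (IsManifold.chart_mem_maximalAtlas _) hsrc
  refine (h2.contMDiffAt.comp q₀ hφs).congr_of_eventuallyEq ?_
  filter_upwards [φ.open_source.mem_nhds hsrc] with q hq
  have h3 := pullbackForm_actionParam_inl (G := G) μ q₀ (φ.map_source hq) X Y
  rw [φ.left_inv hq] at h3
  exact h3.symm

end AdaptedParametrization

/-! ### Functions on the orbit space -/

section Descent

open Filter Topology Module

variable {n m : ℕ} {Q : Type*} [TopologicalSpace Q] [ChartedSpace (EuclideanSpace ℝ (Fin n)) Q]

/-- The affine slice `u ↦ φ⁻¹(φ(q₀) + ℓ(u))` through `q₀`, where `φ` is the chart at `q₀`. -/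
def affineSlice (q₀ : Q) (l : EuclideanSpace ℝ (Fin m) →L[ℝ] EuclideanSpace ℝ (Fin n))
    (u : EuclideanSpace ℝ (Fin m)) : Q :=
  (chartAt (EuclideanSpace ℝ (Fin n)) q₀).symm (chartAt (EuclideanSpace ℝ (Fin n)) q₀ q₀ + l u)

theorem affineSlice_zero (q₀ : Q) (l : EuclideanSpace ℝ (Fin m) →L[ℝ] EuclideanSpace ℝ (Fin n)) :
    affineSlice q₀ l 0 = q₀ := by
  rw [affineSlice, map_zero, add_zero, OpenPartialHomeomorph.left_inv _ (mem_chart_source _ _)]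

variable [IsManifold (𝓡 n) ∞ Q]

theorem contMDiffAt_affineSlice (q₀ : Q)
    (l : EuclideanSpace ℝ (Fin m) →L[ℝ] EuclideanSpace ℝ (Fin n)) {u : EuclideanSpace ℝ (Fin m)}
    (hu : chartAt (EuclideanSpace ℝ (Fin n)) q₀ q₀ + l u ∈
      (chartAt (EuclideanSpace ℝ (Fin n)) q₀).target) :
    ContMDiffAt (𝓡 m) (𝓡 n) ∞ (affineSlice q₀ l) u := by
  have h1 : ContMDiffAt (𝓡 m) (𝓡 n) ∞
      (fun u => chartAt (EuclideanSpace ℝ (Fin n)) q₀ q₀ + l u) u :=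
    (contDiff_const.add l.contDiff).contDiffAt.contMDiffAt
  exact (contMDiffAt_chart_symm q₀ hu).comp u h1

theorem hasMFDerivAt_affineSlice (q₀ : Q)
    (l : EuclideanSpace ℝ (Fin m) →L[ℝ] EuclideanSpace ℝ (Fin n)) :
    HasMFDerivAt (𝓡 m) (𝓡 n) (affineSlice q₀ l) 0 l := by
  have h1 : HasMFDerivAt (𝓡 m) (𝓡 n)
      (fun u => chartAt (EuclideanSpace ℝ (Fin n)) q₀ q₀ + l u) 0 l :=
    (l.hasFDerivAt.const_add _).hasMFDerivAt
  have h2 := hasMFDerivAt_comp_of_eq (hasMFDerivAt_chart_symm_self q₀) h1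
    (by rw [map_zero, add_zero])
  exact hasMFDerivAt_congr_deriv h2 (ContinuousLinearMap.id_comp l)

variable {G : Type*} [Group G] [MulAction G Q]
  [ChartedSpace (EuclideanSpace ℝ (Fin m)) (MulAction.orbitRel.Quotient G Q)]

/-- If `l` is a right inverse of the differential of the projection, then `π ∘ affineSlice q₀ l` is
a parametrization of the orbit space with differential the identity. -/
theorem hasMFDerivAt_orbitProj_affineSlice
    (hπ : ContMDiff (𝓡 n) (𝓡 m) ∞ (orbitProj G : Q → _)) (q₀ : Q)
    {l : EuclideanSpace ℝ (Fin m) →L[ℝ] EuclideanSpace ℝ (Fin n)}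
    (hl : ∀ u, projDeriv m n G q₀ (l u) = u) :
    HasMFDerivAt (𝓡 m) (𝓡 m) (fun u => orbitProj G (affineSlice q₀ l u)) 0
      (ContinuousLinearMap.id ℝ (EuclideanSpace ℝ (Fin m))) := by
  have h := hasMFDerivAt_comp_of_eq (hasMFDerivAt_orbitProj hπ q₀) (hasMFDerivAt_affineSlice q₀ l)
    (affineSlice_zero q₀ l)
  exact hasMFDerivAt_congr_deriv h (ContinuousLinearMap.ext hl)

theorem contMDiffAt_orbitProj_affineSlice
    (hπ : ContMDiff (𝓡 n) (𝓡 m) ∞ (orbitProj G : Q → _)) (q₀ : Q)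
    {l : EuclideanSpace ℝ (Fin m) →L[ℝ] EuclideanSpace ℝ (Fin n)} {u : EuclideanSpace ℝ (Fin m)}
    (hu : chartAt (EuclideanSpace ℝ (Fin n)) q₀ q₀ + l u ∈
      (chartAt (EuclideanSpace ℝ (Fin n)) q₀).target) :
    ContMDiffAt (𝓡 m) (𝓡 m) ∞ (fun u => orbitProj G (affineSlice q₀ l u)) u :=
  (hπ _).comp u (contMDiffAt_affineSlice q₀ l hu)

variable [IsManifold (𝓡 m) ∞ (MulAction.orbitRel.Quotient G Q)]

/-- A function on the orbit space is smooth if its pull-back is. -/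
theorem contMDiff_of_comp_orbitProj (hπ : ContMDiff (𝓡 n) (𝓡 m) ∞ (orbitProj G : Q → _))
    (hsurj : ∀ q : Q, Function.Surjective (projDeriv m n G q))
    {F : MulAction.orbitRel.Quotient G Q → ℝ}
    (hF : ContMDiff (𝓡 n) 𝓘(ℝ, ℝ) ∞ fun q => F (orbitProj G q)) :
    ContMDiff (𝓡 m) 𝓘(ℝ, ℝ) ∞ F := by
  intro b
  obtain ⟨q₀, rfl⟩ : ∃ q : Q, orbitProj G q = b := Quotient.exists_rep b
  obtain ⟨l₀, hl₀⟩ := (projDeriv m n G q₀).toLinearMap.exists_rightInverse_of_surjective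
    (LinearMap.range_eq_top.2 (hsurj q₀))
  let l : EuclideanSpace ℝ (Fin m) →L[ℝ] EuclideanSpace ℝ (Fin n) :=
    LinearMap.toContinuousLinearMap l₀
  have hl : ∀ u, projDeriv m n G q₀ (l u) = u := fun u => LinearMap.congr_fun hl₀ u
  set β := chartAt (EuclideanSpace ℝ (Fin m)) (orbitProj G q₀)
  have hβ : orbitProj G q₀ ∈ β.source := mem_chart_source _ _
  have h0 : orbitProj G (affineSlice q₀ l 0) = orbitProj G q₀ := by rw [affineSlice_zero]
  let τ : EuclideanSpace ℝ (Fin m) → EuclideanSpace ℝ (Fin m) :=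
    fun u => β (orbitProj G (affineSlice q₀ l u))
  have hps : ContMDiffAt (𝓡 m) (𝓡 m) ∞ (fun u => orbitProj G (affineSlice q₀ l u)) 0 :=
    contMDiffAt_orbitProj_affineSlice hπ q₀ (by rw [map_zero]; exact chart_add_zero_mem_target q₀)
  have hβs : ContMDiffAt (𝓡 m) (𝓡 m) ∞ β (orbitProj G q₀) :=
    contMDiffAt_of_mem_maximalAtlas (IsManifold.chart_mem_maximalAtlas _) hβ
  have hτs : ContDiffAt ℝ ∞ τ 0 := by
    refine ContMDiffAt.contDiffAt (ContMDiffAt.comp 0 (g := β) ?_ hps)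
    rwa [h0]
  have hτd : fderiv ℝ τ 0 = ContinuousLinearMap.id ℝ _ := by
    have h1 := hasMFDerivAt_comp_of_eq (hasMFDerivAt_chart_self (orbitProj G q₀))
      (hasMFDerivAt_orbitProj_affineSlice hπ q₀ hl) h0
    exact (fderiv_eq_of_hasMFDerivAt h1).trans (ContinuousLinearMap.id_comp _)
  have hτd' : HasFDerivAt τ
      (ContinuousLinearEquiv.refl ℝ (EuclideanSpace ℝ (Fin m)) :
        EuclideanSpace ℝ (Fin m) →L[ℝ] EuclideanSpace ℝ (Fin m)) 0 := by
    have := (hτs.differentiableAt (by simp)).hasFDerivAt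
    rwa [hτd] at this
  have hτ0 : τ 0 = β (orbitProj G q₀) := congrArg β h0
  set σ := hτs.localInverse hτd' (by simp) with hσ
  have hσs : ContDiffAt ℝ ∞ σ (β (orbitProj G q₀)) := by
    rw [← hτ0]
    exact hτs.to_localInverse hτd' (by simp)
  have hstrict := hτs.hasStrictFDerivAt' hτd' (by simp)
  have hinv : ∀ᶠ y in 𝓝 (β (orbitProj G q₀)), τ (σ y) = y := by
    rw [← hτ0]
    exact hstrict.eventually_right_inverse
  have hσ0 : σ (β (orbitProj G q₀)) = 0 := by
    rw [← hτ0]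
    exact hstrict.localInverse_apply_image
  have hmem : ∀ᶠ y in 𝓝 (β (orbitProj G q₀)), orbitProj G (affineSlice q₀ l (σ y)) ∈ β.source := by
    have h1 : Tendsto σ (𝓝 (β (orbitProj G q₀))) (𝓝 0) :=
      hσs.continuousAt.tendsto.trans (congrArg 𝓝 hσ0).le
    exact h1.eventually (hps.continuousAt.eventually (β.open_source.mem_nhds
      (by simp only [h0]; exact hβ)))
  have hsmooth : ContMDiffAt (𝓡 m) 𝓘(ℝ, ℝ) ∞
      (fun b => F (orbitProj G (affineSlice q₀ l (σ (β b))))) (orbitProj G q₀) := by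
    have h1 : ContMDiffAt (𝓡 m) (𝓡 m) ∞ (fun b => σ (β b)) (orbitProj G q₀) :=
      hσs.contMDiffAt.comp (orbitProj G q₀) hβs
    have h2 : ContMDiffAt (𝓡 m) (𝓡 n) ∞ (fun b => affineSlice q₀ l (σ (β b)))
        (orbitProj G q₀) := by
      refine ContMDiffAt.comp (orbitProj G q₀) (g := affineSlice q₀ l) ?_ h1
      rw [hσ0]
      exact contMDiffAt_affineSlice q₀ l (by rw [map_zero]; exact chart_add_zero_mem_target q₀)
    exact (hF _).comp (orbitProj G q₀) h2
  refine hsmooth.congr_of_eventuallyEq ?_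
  have hβc : ContinuousAt β (orbitProj G q₀) := β.continuousAt hβ
  filter_upwards [hβc.eventually hinv, hβc.eventually hmem, β.open_source.mem_nhds hβ]
    with b h1 h2 h3
  rw [β.injOn h2 h3 h1]

end Descent

/-! ### The density of the orbits -/

section Density

open Filter Topology Module

theorem contMDiff_charpoly_coeff {n : ℕ} {M : Type*} [TopologicalSpace M]
    [ChartedSpace (EuclideanSpace ℝ (Fin n)) M] {ι : Type*} [Fintype ι] [DecidableEq ι]
    {A : M → Matrix ι ι ℝ} (hA : ∀ i j, ContMDiff (𝓡 n) 𝓘(ℝ, ℝ) ∞ fun x => A x i j) (k : ℕ) :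
    ContMDiff (𝓡 n) 𝓘(ℝ, ℝ) ∞ fun x => (A x).charpoly.coeff k := by
  have h : ∀ x, (A x).charpoly.coeff k =
      MvPolynomial.eval (fun ij : ι × ι => A x ij.1 ij.2)
        ((Matrix.charpoly.univ ℝ ι).coeff k) := fun x =>
    (Matrix.charpoly.univ_coeff_eval₂Hom (R := ℝ) ι (RingHom.id ℝ)
      (fun ij : ι × ι => A x ij.1 ij.2) k).symm
  simp only [h]
  generalize (Matrix.charpoly.univ ℝ ι).coeff k = p
  induction p using MvPolynomial.induction_on with
  | C a => simpa using contMDiff_const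
  | add p q hp hq =>
    simp only [map_add]
    exact hp.add hq
  | mul_X p i hp =>
    simp only [map_mul, MvPolynomial.eval_X]
    exact hp.mul (hA i.1 i.2)

variable {d n m : ℕ}
    {G : Type*} [TopologicalSpace G] [ChartedSpace (EuclideanSpace ℝ (Fin d)) G] [Group G]
    {Q : Type*} [TopologicalSpace Q] [ChartedSpace (EuclideanSpace ℝ (Fin n)) Q]
    [MulAction G Q] {ip : LinearMap.BilinForm ℝ (GroupLieAlgebra (𝓡 d) G)}

/-- The fundamental vector fields of an orthonormal basis of `𝔤_q^⊥` are linearly independent at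
`q`. -/
theorem linearIndependent_fundamental (hip : IsAdInvariantInner ip) {q : Q} {k : ℕ}
    {e : Fin k → GroupLieAlgebra (𝓡 d) G} (he : IsOrthonormalBasisPerp n ip q e) :
    LinearIndependent ℝ fun a => fundamental (n := n) q (e a) := by
  refine (linearIndependent_of_orthonormal he.orthonormal).map ?_
  rw [Submodule.disjoint_def]
  intro X hX hX'
  by_contra hne
  exact (hip.pos X hne).ne' ((he.span_eq X).1 hX X hX')

variable [IsManifold (𝓡 n) ∞ Q]

theorem inertia_symm (μ : Metric n Q) (q : Q) (X Y : GroupLieAlgebra (𝓡 d) G) :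
    inertia μ q X Y = inertia μ q Y X :=
  μ.symm _ _ _

theorem inertia_add_left (μ : Metric n Q) (q : Q) (X Y Z : GroupLieAlgebra (𝓡 d) G) :
    inertia μ q (X + Y) Z = inertia μ q X Z + inertia μ q Y Z := by
  change μ.form q _ _ = μ.form q _ _ + μ.form q _ _
  rw [map_add, map_add, LinearMap.add_apply]

theorem inertia_smul_left (μ : Metric n Q) (q : Q) (c : ℝ) (X Y : GroupLieAlgebra (𝓡 d) G) :
    inertia μ q (c • X) Y = c * inertia μ q X Y := by
  change μ.form q _ _ = c * μ.form q _ _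
  rw [map_smul, map_smul, LinearMap.smul_apply, smul_eq_mul]

theorem inertia_of_mem_isotropyAlgebra (μ : Metric n Q) (q : Q) {X : GroupLieAlgebra (𝓡 d) G}
    (hX : X ∈ isotropyAlgebra (n := n) q) (Y : GroupLieAlgebra (𝓡 d) G) : inertia μ q X Y = 0 := by
  have h : fundamental (n := n) q X = 0 := hX
  change μ.form q _ _ = 0
  rw [h, map_zero, LinearMap.zero_apply]

theorem inertia_smul [LieGroup (𝓡 d) ∞ G] [ContMDiffSMul (𝓡 d) (𝓡 n) ∞ G Q] {μ : Metric n Q}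
    (hμ : IsIsometricAction G μ) (g : G) (q : Q) (X Y : GroupLieAlgebra (𝓡 d) G) :
    inertia μ (g • q) (Ad g X) (Ad g Y) = inertia μ q X Y :=
  (congrArg₂ (fun v w : EuclideanSpace ℝ (Fin n) => μ.inner (g • q) v w)
    (orbitDeriv_Ad (n := n) g q X) (orbitDeriv_Ad (n := n) g q Y)).trans (hμ g q _ _)

theorem gram_inertia_posDef (μ : Metric n Q) (hip : IsAdInvariantInner ip) {q : Q} {k : ℕ}
    {e : Fin k → GroupLieAlgebra (𝓡 d) G} (he : IsOrthonormalBasisPerp n ip q e) :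
    (Matrix.of fun a b => inertia μ q (e a) (e b)).PosDef :=
  posDef_gram μ q (linearIndependent_fundamental hip he)

theorem inertiaDensity_pos (μ : Metric n Q) (hip : IsAdInvariantInner ip) {q : Q} {k : ℕ}
    {e : Fin k → GroupLieAlgebra (𝓡 d) G} (he : IsOrthonormalBasisPerp n ip q e) :
    0 < inertiaDensity μ q e :=
  Real.sqrt_pos.2 (abs_pos.2 (gram_inertia_posDef μ hip he).det_pos.ne')

theorem sq_inertiaDensity (μ : Metric n Q) (hip : IsAdInvariantInner ip) {q : Q} {k : ℕ}
    {e : Fin k → GroupLieAlgebra (𝓡 d) G} (he : IsOrthonormalBasisPerp n ip q e) :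
    inertiaDensity μ q e ^ 2 = (Matrix.of fun a b => inertia μ q (e a) (e b)).det := by
  rw [inertiaDensity, Real.sq_sqrt (abs_nonneg _),
    abs_of_pos (gram_inertia_posDef μ hip he).det_pos]

/-- An orthonormal family of the right cardinality has inertia determinant at most the squared
density, even if it does not span `𝔤_q^⊥`. -/
theorem det_inertia_le_sq (μ : Metric n Q) (hip : IsAdInvariantInner ip) {q : Q} {k : ℕ}
    {e : Fin k → GroupLieAlgebra (𝓡 d) G} (he : IsOrthonormalBasisPerp n ip q e)
    {b : Fin k → GroupLieAlgebra (𝓡 d) G} (hb : ∀ i j, ip (b i) (b j) = if i = j then 1 else 0) :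
    (Matrix.of fun i j => inertia μ q (b i) (b j)).det ≤ inertiaDensity μ q e ^ 2 := by
  rw [sq_inertiaDensity μ hip he]
  exact det_gram_le hip.symm hip.pos he.orthonormal he.span_eq (inertia_symm μ q)
    (inertia_add_left μ q) (inertia_smul_left μ q)
    (fun X hX => inertia_of_mem_isotropyAlgebra μ q hX) (gram_inertia_posDef μ hip he).det_pos.le hb

/-- The density is constant along orbits. -/
theorem inertiaDensity_smul [LieGroup (𝓡 d) ∞ G] [ContMDiffSMul (𝓡 d) (𝓡 n) ∞ G Q]
    {μ : Metric n Q} (hμ : IsIsometricAction G μ) (hip : IsAdInvariantInner ip) (g : G) {q : Q}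
    {k : ℕ} {e e' : Fin k → GroupLieAlgebra (𝓡 d) G} (he : IsOrthonormalBasisPerp n ip q e)
    (he' : IsOrthonormalBasisPerp n ip (g • q) e') :
    inertiaDensity μ (g • q) e' = inertiaDensity μ q e := by
  obtain ⟨b, hb⟩ := exists_orthonormal_basis hip.symm hip.pos
  have h1 := det_gram_eq_charpoly_coeff hip.symm hip.pos he.orthonormal he.span_eq
    (inertia_symm μ q) (inertia_add_left μ q) (inertia_smul_left μ q)
    (fun X hX => inertia_of_mem_isotropyAlgebra μ q hX) hb
  have h2 := det_gram_eq_charpoly_coeff hip.symm hip.pos he'.orthonormal he'.span_eq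
    (inertia_symm μ (g • q)) (inertia_add_left μ (g • q)) (inertia_smul_left μ (g • q))
    (fun X hX => inertia_of_mem_isotropyAlgebra μ (g • q) hX) (b := fun i => Ad g (b i))
    (fun i j => (hip.ad_invariant g _ _).trans (hb i j))
  simp only [inertia_smul hμ] at h2
  rw [inertiaDensity, inertiaDensity, h1, h2]

theorem contMDiff_inertiaDensity [LieGroup (𝓡 d) ∞ G] [ContMDiffSMul (𝓡 d) (𝓡 n) ∞ G Q]
    (μ : Metric n Q) (hip : IsAdInvariantInner ip) {k : ℕ}
    {e : Q → Fin k → GroupLieAlgebra (𝓡 d) G} (he : ∀ q, IsOrthonormalBasisPerp n ip q (e q)) :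
    ContMDiff (𝓡 n) 𝓘(ℝ, ℝ) ∞ fun q => inertiaDensity μ q (e q) := by
  obtain ⟨b, hb⟩ := exists_orthonormal_basis hip.symm hip.pos
  have h1 := fun q => det_gram_eq_charpoly_coeff hip.symm hip.pos (he q).orthonormal (he q).span_eq
    (inertia_symm μ q) (inertia_add_left μ q) (inertia_smul_left μ q)
    (fun X hX => inertia_of_mem_isotropyAlgebra μ q hX) hb
  have h2 : ContMDiff (𝓡 n) 𝓘(ℝ, ℝ) ∞ fun q => inertiaDensity μ q (e q) ^ 2 := by
    simp only [sq_inertiaDensity μ hip (he _), h1]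
    exact contMDiff_const.mul
      (contMDiff_charpoly_coeff (fun i j => contMDiff_inertia μ (b i) (b j)) _)
  intro q
  have hpos := inertiaDensity_pos μ hip (he q)
  refine ((Real.contDiffAt_sqrt (pow_pos hpos 2).ne').contMDiffAt.comp q
    (h2 q)).congr_of_eventuallyEq (Eventually.of_forall fun q => ?_)
  exact (Real.sqrt_sq (inertiaDensity_pos μ hip (he q)).le).symm

end Density

section OrbitSpace

open Filter Topology Module

variable {d n m : ℕ}
    {G : Type*} [Group G]
    {Q : Type*} [TopologicalSpace Q] [ChartedSpace (EuclideanSpace ℝ (Fin n)) Q]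
    [MulAction G Q]
    [ChartedSpace (EuclideanSpace ℝ (Fin m)) (MulAction.orbitRel.Quotient G Q)]

theorem finrank_ker_projDeriv {q : Q} (hsurj : Function.Surjective (projDeriv m n G q)) :
    finrank ℝ (projDeriv m n G q).ker + m = n := by
  have h := LinearMap.finrank_range_add_finrank_ker (projDeriv m n G q).toLinearMap
  rw [LinearMap.range_eq_top.2 hsurj, finrank_top, finrank_euclideanSpace_fin,
    finrank_euclideanSpace_fin] at h
  omega

variable [TopologicalSpace G] [ChartedSpace (EuclideanSpace ℝ (Fin d)) G]
    [LieGroup (𝓡 d) ∞ G] [IsManifold (𝓡 n) ∞ Q] [ContMDiffSMul (𝓡 d) (𝓡 n) ∞ G Q]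
    [IsManifold (𝓡 m) ∞ (MulAction.orbitRel.Quotient G Q)]
    {ip : LinearMap.BilinForm ℝ (GroupLieAlgebra (𝓡 d) G)}

/-- The orbits have dimension `n - m`. -/
theorem card_add_of_isOrthonormalBasisPerp [SecondCountableTopology G]
    (hπ : ContMDiff (𝓡 n) (𝓡 m) ∞ (orbitProj G : Q → _)) (hip : IsAdInvariantInner ip)
    {q : Q} (hsurj : Function.Surjective (projDeriv m n G q)) {k : ℕ}
    {e : Fin k → GroupLieAlgebra (𝓡 d) G} (he : IsOrthonormalBasisPerp n ip q e) : k + m = n := by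
  have h1 := card_add_finrank_of_span_eq hip.symm hip.pos he.orthonormal he.span_eq
  have h2 : finrank ℝ (orbitDeriv d n G q).range +
      finrank ℝ (isotropyAlgebra (d := d) (n := n) (G := G) q) =
      finrank ℝ (GroupLieAlgebra (𝓡 d) G) :=
    LinearMap.finrank_range_add_finrank_ker (orbitDeriv d n G q).toLinearMap
  rw [ker_projDeriv_eq_range hπ q hsurj] at h2
  have h3 := finrank_ker_projDeriv hsurj
  rw [Fintype.card_fin] at h1
  omega

/-- The density descends to a smooth function on the orbit space. -/
theorem exists_orbitProj_eq_inertiaDensity (hπ : ContMDiff (𝓡 n) (𝓡 m) ∞ (orbitProj G : Q → _))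
    (hsurj : ∀ q : Q, Function.Surjective (projDeriv m n G q))
    {μ : Metric n Q} (hμ : IsIsometricAction G μ) (hip : IsAdInvariantInner ip) {k : ℕ}
    {e : Q → Fin k → GroupLieAlgebra (𝓡 d) G} (he : ∀ q, IsOrthonormalBasisPerp n ip q (e q)) :
    ∃ δ : C^∞⟮𝓡 m, MulAction.orbitRel.Quotient G Q; ℝ⟯,
      ∀ q, δ (orbitProj G q) = inertiaDensity μ q (e q) := by
  let δ : MulAction.orbitRel.Quotient G Q → ℝ :=
    Quotient.lift (fun q => inertiaDensity μ q (e q)) (by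
      rintro _ q ⟨g, rfl⟩
      exact inertiaDensity_smul hμ hip g (he q) (he (g • q)))
  exact ⟨⟨δ, contMDiff_of_comp_orbitProj hπ hsurj (contMDiff_inertiaDensity μ hip he)⟩,
    fun q => rfl⟩

end OrbitSpace

/-! ### The Laplacian of a metric in block form -/

section Block

open Filter Topology

variable {m n r : ℕ}

/-- The linear inclusion of `ℝᵐ` into `ℝⁿ` sending the `a`-th basis vector to the `j a`-th. -/
def coordIncl (j : Fin m → Fin n) : EuclideanSpace ℝ (Fin m) →L[ℝ] EuclideanSpace ℝ (Fin n) :=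
  ∑ a, (EuclideanSpace.proj a : EuclideanSpace ℝ (Fin m) →L[ℝ] ℝ).smulRight
    (EuclideanSpace.single (j a) 1)

/-- The linear projection of `ℝⁿ` onto the coordinates selected by `j`. -/
def coordProj (j : Fin m → Fin n) : EuclideanSpace ℝ (Fin n) →L[ℝ] EuclideanSpace ℝ (Fin m) :=
  ∑ a, (EuclideanSpace.proj (j a) : EuclideanSpace ℝ (Fin n) →L[ℝ] ℝ).smulRight
    (EuclideanSpace.single a 1)

theorem coordIncl_single (j : Fin m → Fin n) (a : Fin m) :
    coordIncl j (EuclideanSpace.single a 1) = EuclideanSpace.single (j a) 1 := by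
  simp [coordIncl, sum_apply]

theorem coordProj_apply (j : Fin m → Fin n) (y : EuclideanSpace ℝ (Fin n)) (a : Fin m) :
    coordProj j y a = y (j a) := by
  simp [coordProj, sum_apply, Pi.single_apply]

theorem coordProj_single {j : Fin m → Fin n} (hj : Function.Injective j) (a : Fin m) :
    coordProj j (EuclideanSpace.single (j a) 1) = EuclideanSpace.single a 1 := by
  ext b
  simp [coordProj_apply, hj.eq_iff]

theorem coordProj_single_of_ne {j : Fin m → Fin n} {i : Fin n} (hi : ∀ a, j a ≠ i) :
    coordProj j (EuclideanSpace.single i 1) = 0 := by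
  ext b
  simp [coordProj_apply, hi]

theorem coordProj_inl_single_inr (ε : Fin m ⊕ Fin r ≃ Fin n) (v : Fin r) :
    coordProj (ε ∘ Sum.inl) (EuclideanSpace.single (ε (Sum.inr v)) 1) = 0 :=
  coordProj_single_of_ne fun _ h => Sum.inl_ne_inr (ε.injective h)

theorem coordIncl_apply (j : Fin m → Fin n) (u : EuclideanSpace ℝ (Fin m)) :
    coordIncl j u = ∑ a, u a • EuclideanSpace.single (j a) (1 : ℝ) := by
  simp [coordIncl, sum_apply]

theorem coordProj_coordIncl {j : Fin m → Fin n} (hj : Function.Injective j)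
    (u : EuclideanSpace ℝ (Fin m)) : coordProj j (coordIncl j u) = u := by
  ext b
  simp [coordProj_apply, coordIncl_apply, hj.eq_iff]

theorem pderiv_eq_zero_of_line {u : EuclideanSpace ℝ (Fin n) → ℝ} {i : Fin n}
    (hu : DifferentiableAt ℝ u 0)
    (h : ∀ᶠ t : ℝ in 𝓝 0, u (t • EuclideanSpace.single i 1) = 0) : pderiv i u 0 = 0 := by
  have h1 : HasFDerivAt u (fderiv ℝ u 0) ((0 : ℝ) • EuclideanSpace.single i 1) := by
    rw [zero_smul]
    exact hu.hasFDerivAt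
  have h2 := h1.comp_hasDerivAt (0 : ℝ)
    ((hasDerivAt_id (0 : ℝ)).smul_const (EuclideanSpace.single i (1 : ℝ)))
  have h3 : HasDerivAt (fun t : ℝ => u (t • EuclideanSpace.single i 1)) 0 0 :=
    (hasDerivAt_const (0 : ℝ) (0 : ℝ)).congr_of_eventuallyEq h
  have := h2.unique h3
  rwa [one_smul] at this

theorem pderiv_comp_coordIncl {u : EuclideanSpace ℝ (Fin n) → ℝ} (j : Fin m → Fin n) (a : Fin m)
    (hu : DifferentiableAt ℝ u 0) :
    pderiv a (fun x => u (coordIncl j x)) 0 = pderiv (j a) u 0 := by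
  have h1 : HasFDerivAt u (fderiv ℝ u 0) (coordIncl j 0) := by
    rw [map_zero]
    exact hu.hasFDerivAt
  have h2 := h1.comp (0 : EuclideanSpace ℝ (Fin m)) (coordIncl j).hasFDerivAt
  rw [pderiv, pderiv, ← coordIncl_single]
  exact congrArg (fun L : EuclideanSpace ℝ (Fin m) →L[ℝ] ℝ => L (EuclideanSpace.single a 1))
    h2.fderiv

theorem fderiv_comp_coordProj {F : EuclideanSpace ℝ (Fin m) → ℝ} (j : Fin m → Fin n)
    {y : EuclideanSpace ℝ (Fin n)} (hF : DifferentiableAt ℝ F (coordProj j y)) (i : Fin n) :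
    pderiv i (fun y => F (coordProj j y)) y =
      fderiv ℝ F (coordProj j y) (coordProj j (EuclideanSpace.single i 1)) :=
  congrArg (fun L : EuclideanSpace ℝ (Fin n) →L[ℝ] ℝ => L (EuclideanSpace.single i 1))
    (hF.hasFDerivAt.comp y (coordProj j).hasFDerivAt).fderiv

/-- The determinant and the upper block of the inverse of a block matrix with Schur complement
`H`. -/
theorem det_and_inv_of_schur (ε : Fin m ⊕ Fin r ≃ Fin n) (A : Matrix (Fin n) (Fin n) ℝ)
    {H : Matrix (Fin m) (Fin m) ℝ} {S : Matrix (Fin r) (Fin r) ℝ} (hS : S.det ≠ 0)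
    (hAS : (A.submatrix ε ε).toBlocks₂₂ = S)
    (hH : H.det ≠ 0)
    (hAH : (A.submatrix ε ε).toBlocks₁₁ -
      (A.submatrix ε ε).toBlocks₁₂ * S⁻¹ * (A.submatrix ε ε).toBlocks₂₁ = H) :
    A.det = S.det * H.det ∧
      ∀ a b, A⁻¹ (ε (Sum.inl a)) (ε (Sum.inl b)) = H⁻¹ a b := by
  have hSi : Invertible S := S.invertibleOfIsUnitDet (isUnit_iff_ne_zero.2 hS)
  have hHi : Invertible H := H.invertibleOfIsUnitDet (isUnit_iff_ne_zero.2 hH)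
  have hb := Matrix.fromBlocks_toBlocks (A.submatrix ε ε)
  rw [hAS] at hb
  rw [← Matrix.invOf_eq_nonsing_inv S] at hAH
  have hdet : A.det = S.det * H.det := by
    rw [← Matrix.det_submatrix_equiv_self ε A, ← hb, Matrix.det_fromBlocks₂₂, hAH]
  refine ⟨hdet, fun a b => ?_⟩
  have hschur : Invertible ((A.submatrix ε ε).toBlocks₁₁ -
      (A.submatrix ε ε).toBlocks₁₂ * ⅟S * (A.submatrix ε ε).toBlocks₂₁) := by rwa [hAH]
  have hAi : Invertible (Matrix.fromBlocks (A.submatrix ε ε).toBlocks₁₁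
      (A.submatrix ε ε).toBlocks₁₂ (A.submatrix ε ε).toBlocks₂₁ S) :=
    Matrix.fromBlocks₂₂Invertible _ _ _ _
  have h1 := Matrix.invOf_fromBlocks₂₂_eq (A.submatrix ε ε).toBlocks₁₁
      (A.submatrix ε ε).toBlocks₁₂ (A.submatrix ε ε).toBlocks₂₁ S
  have h2 : (A.submatrix ε ε)⁻¹ (Sum.inl a) (Sum.inl b) = A⁻¹ (ε (Sum.inl a)) (ε (Sum.inl b)) := by
    rw [Matrix.inv_submatrix_equiv, Matrix.submatrix_apply]
  rw [← h2, ← hb, ← Matrix.invOf_eq_nonsing_inv (Matrix.fromBlocks _ _ _ _), h1,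
    Matrix.fromBlocks_apply₁₁, Matrix.invOf_eq_nonsing_inv, hAH]

/-- If the off-diagonal blocks of an invertible matrix vanish, so do those of its inverse. -/
theorem inv_inr_inl_eq_zero (ε : Fin m ⊕ Fin r ≃ Fin n) {A : Matrix (Fin n) (Fin n) ℝ}
    (hA : A.det ≠ 0) (h₁₂ : ∀ a v, A (ε (Sum.inl a)) (ε (Sum.inr v)) = 0)
    (h₂₁ : ∀ v a, A (ε (Sum.inr v)) (ε (Sum.inl a)) = 0) (v : Fin r) (a : Fin m) :
    A⁻¹ (ε (Sum.inr v)) (ε (Sum.inl a)) = 0 := by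
  have hb := Matrix.fromBlocks_toBlocks (A.submatrix ε ε)
  have h1 : (A.submatrix ε ε).toBlocks₁₂ = 0 := Matrix.ext h₁₂
  have h2 : (A.submatrix ε ε).toBlocks₂₁ = 0 := Matrix.ext h₂₁
  rw [h1, h2] at hb
  have hdet : (A.submatrix ε ε).toBlocks₁₁.det * (A.submatrix ε ε).toBlocks₂₂.det ≠ 0 := by
    rwa [← Matrix.det_fromBlocks_zero₂₁ _ 0, hb, Matrix.det_submatrix_equiv_self]
  have h3 : (A.submatrix ε ε)⁻¹ (Sum.inr v) (Sum.inl a) = A⁻¹ (ε (Sum.inr v)) (ε (Sum.inl a)) := by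
    rw [Matrix.inv_submatrix_equiv, Matrix.submatrix_apply]
  rw [← h3, ← hb, Matrix.inv_fromBlocks_zero₂₁_of_isUnit_iff]
  · rfl
  · simp only [Matrix.isUnit_iff_isUnit_det, isUnit_iff_ne_zero, left_ne_zero_of_mul hdet,
      right_ne_zero_of_mul hdet, ne_eq, not_false_eq_true]

/-- The Laplacian, in coordinates `(u, w)`, of a function of `u` alone. On `w = 0`, the `u`-block of
the inverse metric is the inverse of the metric `H` on the base, and the volume density is `σ` times
the one of `H`; the mixed components of the inverse metric vanish on `u = 0`. -/
theorem coordLaplacian_comp_coordProj (ε : Fin m ⊕ Fin r ≃ Fin n)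
    {G : EuclideanSpace ℝ (Fin n) → Matrix (Fin n) (Fin n) ℝ}
    {H : EuclideanSpace ℝ (Fin m) → Matrix (Fin m) (Fin m) ℝ}
    {σ F : EuclideanSpace ℝ (Fin m) → ℝ}
    (hG : ∀ i j, ContDiffAt ℝ ∞ (fun z => G z i j) 0) (hG0 : 0 < (G 0).det)
    (hH : ∀ i j, ContDiffAt ℝ ∞ (fun z => H z i j) 0) (hH0 : 0 < (H 0).det)
    (hσ : DifferentiableAt ℝ σ 0) (hF : ContDiffAt ℝ ∞ F 0)
    (hdet : ∀ᶠ u in 𝓝 0, √(G (coordIncl (ε ∘ Sum.inl) u)).det = σ u * √(H u).det)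
    (hinv : ∀ᶠ u in 𝓝 0, ∀ a b,
      (G (coordIncl (ε ∘ Sum.inl) u))⁻¹ (ε (Sum.inl a)) (ε (Sum.inl b)) = (H u)⁻¹ a b)
    (hoff : ∀ v a, ∀ᶠ t : ℝ in 𝓝 0,
      (G (t • EuclideanSpace.single (ε (Sum.inr v)) 1))⁻¹ (ε (Sum.inr v)) (ε (Sum.inl a)) = 0) :
    coordLaplacian G (fun y => F (coordProj (ε ∘ Sum.inl) y)) 0 = coordLaplacian H F 0 +
      ∑ a, pderiv a σ 0 / σ 0 * ∑ c, (H 0)⁻¹ a c * pderiv c F 0 := by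
  set j : Fin m → Fin n := ε ∘ Sum.inl with hj
  have hjinj : Function.Injective j := ε.injective.comp Sum.inl_injective
  have hp0 : coordProj j 0 = 0 := map_zero _
  have hF' : ContDiffAt ℝ ∞ (fun y => F (coordProj j y)) 0 := by
    refine ContDiffAt.comp 0 (g := F) ?_ (coordProj j).contDiff.contDiffAt
    rwa [hp0]
  have hexp : ∀ᶠ z in 𝓝 (0 : EuclideanSpace ℝ (Fin n)), ∀ i,
      gradientDensity G (fun y => F (coordProj j y)) i z =
        √(G z).det * ∑ c, (G z)⁻¹ i (ε (Sum.inl c)) * pderiv c F (coordProj j z) := by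
    have hev : ∀ᶠ z in 𝓝 (0 : EuclideanSpace ℝ (Fin n)), DifferentiableAt ℝ F (coordProj j z) :=
      ((coordProj j).continuous.tendsto' 0 0 hp0).eventually (eventually_differentiableAt hF)
    filter_upwards [hev] with z hz i
    rw [gradientDensity, ← ε.sum_comp, Fintype.sum_sum_type]
    have h1 : ∀ c, pderiv (ε (Sum.inl c)) (fun y => F (coordProj j y)) z =
        pderiv c F (coordProj j z) := fun c =>
      (fderiv_comp_coordProj j hz _).trans (congrArg _ (coordProj_single hjinj c))
    have h2 : ∀ c, pderiv (ε (Sum.inr c)) (fun y => F (coordProj j y)) z = 0 := fun c => by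
      rw [fderiv_comp_coordProj j hz, coordProj_inl_single_inr, map_zero]
    simp only [h1, h2, mul_zero, Finset.sum_const_zero, add_zero]
  have hd : ∀ i, DifferentiableAt ℝ (gradientDensity G (fun y => F (coordProj j y)) i) 0 := fun i =>
    (contDiffAt_gradientDensity hG hG0.ne' hF' i).differentiableAt (by simp)
  have hdH : ∀ a, DifferentiableAt ℝ (gradientDensity H F a) 0 := fun a =>
    (contDiffAt_gradientDensity hH hH0.ne' hF a).differentiableAt (by simp)
  have hinr : ∀ v, pderiv (ε (Sum.inr v)) (gradientDensity G (fun y => F (coordProj j y))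
      (ε (Sum.inr v))) 0 = 0 := by
    intro v
    refine pderiv_eq_zero_of_line (hd _) ?_
    have ht : Tendsto (fun t : ℝ => t • EuclideanSpace.single (ε (Sum.inr v)) (1 : ℝ)) (𝓝 0)
        (𝓝 0) :=
      (by fun_prop : Continuous fun t : ℝ => t • EuclideanSpace.single (ε (Sum.inr v)) (1 : ℝ))
        |>.tendsto' 0 0 (zero_smul _ _)
    filter_upwards [ht.eventually hexp, eventually_all.2 (hoff v)] with t h1 h2
    rw [h1]
    simp only [h2, zero_mul, Finset.sum_const_zero, mul_zero]
  have hinl : ∀ a, pderiv (ε (Sum.inl a)) (gradientDensity G (fun y => F (coordProj j y))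
      (ε (Sum.inl a))) 0 = pderiv a σ 0 * gradientDensity H F a 0 +
        σ 0 * pderiv a (gradientDensity H F a) 0 := by
    intro a
    rw [show ε (Sum.inl a) = j a from rfl, ← pderiv_comp_coordIncl j a (hd _)]
    have hc : Tendsto (coordIncl j) (𝓝 0) (𝓝 0) :=
      (coordIncl j).continuous.tendsto' 0 0 (map_zero _)
    have h1 : (fun x => gradientDensity G (fun y => F (coordProj j y)) (j a) (coordIncl j x))
        =ᶠ[𝓝 0] fun u => σ u * gradientDensity H F a u := by
      filter_upwards [hc.eventually hexp, hdet, hinv] with u h1 h2 h3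
      rw [h1, h2, coordProj_coordIncl hjinj, gradientDensity, mul_assoc]
      congr 2
      exact Finset.sum_congr rfl fun c _ => congrArg (· * _) (h3 a c)
    rw [pderiv_congr h1]
    have h2 := (hσ.hasFDerivAt.mul (hdH a).hasFDerivAt).fderiv
    rw [pderiv, show (fun u => σ u * gradientDensity H F a u) = σ * gradientDensity H F a from rfl,
      h2]
    simp only [add_apply, smul_apply, smul_eq_mul, pderiv]
    ring
  have hσ0 : √(G 0).det = σ 0 * √(H 0).det := by simpa using hdet.self_of_nhds
  have hs1 : √(G 0).det ≠ 0 := (Real.sqrt_pos.2 hG0).ne'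
  have hs2 : √(H 0).det ≠ 0 := (Real.sqrt_pos.2 hH0).ne'
  have hs3 : σ 0 ≠ 0 := by
    rintro h
    rw [h, zero_mul] at hσ0
    exact hs1 hσ0
  rw [coordLaplacian, ← ε.sum_comp, Fintype.sum_sum_type]
  simp only [hinr, hinl, Finset.sum_const_zero, add_zero]
  rw [hσ0, coordLaplacian, Finset.sum_add_distrib, mul_add, ← Finset.mul_sum, add_comm]
  congr 1
  · field_simp
  · rw [Finset.mul_sum]
    refine Finset.sum_congr rfl fun a _ => ?_
    rw [gradientDensity]
    field_simp

end Block

/-! ### The metric in the adapted parametrization -/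

section Schur

open Filter Topology Module

theorem linearIndependent_of_det_gram_ne_zero {V : Type*} [AddCommGroup V] [Module ℝ V]
    {L : LinearMap.BilinForm ℝ V} {ι : Type*} [Fintype ι] [DecidableEq ι] {z : ι → V}
    (hz : (Matrix.of fun a b => L (z a) (z b)).det ≠ 0) : LinearIndependent ℝ z := by
  rw [Fintype.linearIndependent_iff]
  intro c hc
  refine congrFun (Matrix.eq_zero_of_mulVec_eq_zero hz (v := c) (funext fun a => ?_))
  have := congrArg (L (z a)) hc
  simp only [map_sum, map_smul, smul_eq_mul, map_zero] at this
  simp only [Matrix.mulVec, dotProduct, Matrix.of_apply, Pi.zero_apply]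
  rw [← this]
  exact Finset.sum_congr rfl fun b _ => mul_comm _ _

/-- For a linear map `D` that is isometric on the orthogonal complement of its kernel, the Schur
complement of the Gram matrix of a basis `z` of the kernel is the Gram matrix downstairs. -/
theorem schur_gram_eq {V W : Type*} [AddCommGroup V] [Module ℝ V] [AddCommGroup W] [Module ℝ W]
    [FiniteDimensional ℝ V] {L : LinearMap.BilinForm ℝ V}
    {M : LinearMap.BilinForm ℝ W} {D : V →ₗ[ℝ] W}
    (hD : ∀ v w, (∀ u, D u = 0 → L v u = 0) → (∀ u, D u = 0 → L w u = 0) → M (D v) (D w) = L v w)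
    {κ ι : Type*} [Fintype ι] [DecidableEq ι] (x : κ → V) {z : ι → V} (hz : ∀ a, D (z a) = 0)
    (hdet : (Matrix.of fun a b => L (z a) (z b)).det ≠ 0)
    (hrank : finrank ℝ (LinearMap.ker D) = Fintype.card ι) :
    (Matrix.of fun a b => L (x a) (x b)) - (Matrix.of fun a b => L (x a) (z b)) *
      (Matrix.of fun a b => L (z a) (z b))⁻¹ * (Matrix.of fun a b => L (z a) (x b)) =
      Matrix.of fun a b => M (D (x a)) (D (x b)) := by
  set S := Matrix.of fun a b => L (z a) (z b) with hS
  set T := (Matrix.of fun a b => L (x a) (z b)) * S⁻¹ with hT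
  have hTS : T * S = Matrix.of fun a b => L (x a) (z b) := by
    rw [hT, Matrix.mul_assoc, Matrix.nonsing_inv_mul _ (isUnit_iff_ne_zero.2 hdet), Matrix.mul_one]
  have hspan : Submodule.span ℝ (Set.range z) = LinearMap.ker D := by
    refine Submodule.eq_of_le_of_finrank_le (Submodule.span_le.2 ?_) ?_
    · rintro _ ⟨a, rfl⟩
      exact hz a
    · rw [hrank, finrank_span_eq_card (linearIndependent_of_det_gram_ne_zero hdet)]
  -- the horizontal parts of the vectors `x a`
  let y : κ → V := fun a => x a - ∑ v, T a v • z v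
  have hy : ∀ a u, D u = 0 → L (y a) u = 0 := by
    intro a u hu
    have hu' : u ∈ Submodule.span ℝ (Set.range z) := by rw [hspan]; exact hu
    induction hu' using Submodule.span_induction with
    | mem u hu' =>
      obtain ⟨w, rfl⟩ := hu'
      have := congrFun (congrFun hTS a) w
      rw [Matrix.mul_apply] at this
      simp only [y, map_sub, LinearMap.sub_apply, map_sum, LinearMap.sum_apply, map_smul,
        LinearMap.smul_apply, smul_eq_mul]
      exact sub_eq_zero.2 this.symm
    | zero => exact map_zero _
    | add u w hu1 hw1 hu2 hw2 =>
      rw [map_add, hu2 (by rw [← LinearMap.mem_ker, ← hspan]; exact hu1),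
        hw2 (by rw [← LinearMap.mem_ker, ← hspan]; exact hw1), add_zero]
    | smul c u hu1 hu2 =>
      rw [map_smul, hu2 (by rw [← LinearMap.mem_ker, ← hspan]; exact hu1), smul_zero]
  have hDy : ∀ a, D (y a) = D (x a) := by
    intro a
    simp [y, hz]
  have hsum : ∀ a, D (∑ v, T a v • z v) = 0 := fun a => by simp [hz]
  ext a b
  have h1 := hD (y a) (y b) (hy a) (hy b)
  rw [hDy, hDy] at h1
  rw [Matrix.of_apply, h1, Matrix.sub_apply, Matrix.mul_apply]
  have h2 : L (y a) (y b) = L (y a) (x b) := by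
    simp only [y, map_sub (L _) (x b)]
    rw [sub_eq_self]
    exact hy a _ (hsum b)
  rw [h2]
  simp only [y, map_sub, LinearMap.sub_apply, map_sum, LinearMap.sum_apply, map_smul,
    LinearMap.smul_apply, smul_eq_mul, Matrix.of_apply]

end Schur

section AdaptedMetric

open Filter Topology Module

variable {d n m r : ℕ}
    {G : Type*} [TopologicalSpace G] [ChartedSpace (EuclideanSpace ℝ (Fin d)) G] [Group G]
    {Q : Type*} [TopologicalSpace Q] [ChartedSpace (EuclideanSpace ℝ (Fin n)) Q]

/-- The coordinates `(w, u)`, as arguments of `actionParam`: the vector `∑ wᵥ Xᵥ` of the Lie algebra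
and the point with coordinates `φ(q₀) + ℓ(u)` in the chart `φ` at `q₀`. -/
def adaptedArg (ε : Fin m ⊕ Fin r ≃ Fin n) (X : Fin r → EuclideanSpace ℝ (Fin d))
    (l : EuclideanSpace ℝ (Fin m) →L[ℝ] EuclideanSpace ℝ (Fin n)) (q₀ : Q)
    (y : EuclideanSpace ℝ (Fin n)) : EuclideanSpace ℝ (Fin d) × EuclideanSpace ℝ (Fin n) :=
  (∑ v, y (ε (Sum.inr v)) • X v,
    chartAt (EuclideanSpace ℝ (Fin n)) q₀ q₀ + l (coordProj (ε ∘ Sum.inl) y))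

/-- The linear part of `adaptedArg`. -/
def adaptedArgDeriv (ε : Fin m ⊕ Fin r ≃ Fin n) (X : Fin r → EuclideanSpace ℝ (Fin d))
    (l : EuclideanSpace ℝ (Fin m) →L[ℝ] EuclideanSpace ℝ (Fin n)) :
    EuclideanSpace ℝ (Fin n) →L[ℝ] EuclideanSpace ℝ (Fin d) × EuclideanSpace ℝ (Fin n) :=
  (∑ v, (EuclideanSpace.proj (ε (Sum.inr v)) : EuclideanSpace ℝ (Fin n) →L[ℝ] ℝ).smulRight
    (X v)).prod (l.comp (coordProj (ε ∘ Sum.inl)))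

variable {ε : Fin m ⊕ Fin r ≃ Fin n} {X : Fin r → EuclideanSpace ℝ (Fin d)}
  {l : EuclideanSpace ℝ (Fin m) →L[ℝ] EuclideanSpace ℝ (Fin n)} {q₀ : Q}

theorem adaptedArg_eq (y : EuclideanSpace ℝ (Fin n)) : adaptedArg ε X l q₀ y =
    (0, chartAt (EuclideanSpace ℝ (Fin n)) q₀ q₀) + adaptedArgDeriv ε X l y := by
  ext1 <;> simp [adaptedArg, adaptedArgDeriv, sum_apply]

theorem hasFDerivAt_adaptedArg (y : EuclideanSpace ℝ (Fin n)) :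
    HasFDerivAt (adaptedArg ε X l q₀) (adaptedArgDeriv ε X l) y := by
  rw [show adaptedArg ε X l q₀ = _ from funext adaptedArg_eq]
  exact (adaptedArgDeriv ε X l).hasFDerivAt.const_add _

theorem contDiff_adaptedArg : ContDiff ℝ ∞ (adaptedArg ε X l q₀) := by
  rw [show adaptedArg ε X l q₀ = _ from funext adaptedArg_eq]
  exact contDiff_const.add (adaptedArgDeriv ε X l).contDiff

theorem adaptedArgDeriv_inl (a : Fin m) :
    adaptedArgDeriv ε X l (EuclideanSpace.single (ε (Sum.inl a)) 1) =
      (0, l (EuclideanSpace.single a 1)) := by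
  have h := coordProj_single (j := ε ∘ Sum.inl) (ε.injective.comp Sum.inl_injective) a
  ext1
  · simp [adaptedArgDeriv, sum_apply]
  · exact congrArg l h

theorem adaptedArgDeriv_inr (v : Fin r) :
    adaptedArgDeriv ε X l (EuclideanSpace.single (ε (Sum.inr v)) 1) = (X v, 0) := by
  have h := coordProj_inl_single_inr ε v
  ext1
  · simp [adaptedArgDeriv, sum_apply]
  · exact (congrArg l h).trans (map_zero l)

theorem adaptedArg_coordIncl (u : EuclideanSpace ℝ (Fin m)) :
    adaptedArg ε X l q₀ (coordIncl (ε ∘ Sum.inl) u) =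
      (0, chartAt (EuclideanSpace ℝ (Fin n)) q₀ q₀ + l u) := by
  have h := coordProj_coordIncl (j := ε ∘ Sum.inl) (ε.injective.comp Sum.inl_injective) u
  ext1
  · simp [adaptedArg, coordIncl_apply]
  · simp only [adaptedArg, h]

variable (d G) in
/-- The domain on which `actionParam` is known to be smooth. -/
def paramDomain (q₀ : Q) : Set (EuclideanSpace ℝ (Fin d) × EuclideanSpace ℝ (Fin n)) :=
  {p | chartAt (EuclideanSpace ℝ (Fin d)) (1 : G) 1 + p.1 ∈
      (chartAt (EuclideanSpace ℝ (Fin d)) (1 : G)).target ∧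
    p.2 ∈ (chartAt (EuclideanSpace ℝ (Fin n)) q₀).target}

theorem eventually_adaptedArg_mem_paramDomain :
    ∀ᶠ y in 𝓝 0, adaptedArg ε X l q₀ y ∈ paramDomain d G q₀ := by
  have h0 : adaptedArg ε X l q₀ 0 = (0, chartAt (EuclideanSpace ℝ (Fin n)) q₀ q₀) := by
    rw [adaptedArg_eq, map_zero, add_zero]
  have h1 : Tendsto (adaptedArg ε X l q₀) (𝓝 0) (𝓝 (0, chartAt (EuclideanSpace ℝ (Fin n)) q₀ q₀)) :=
    contDiff_adaptedArg.continuous.tendsto' _ _ h0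
  refine h1.eventually (Filter.inter_mem ?_ ?_)
  · refine (by fun_prop : Continuous fun p : EuclideanSpace ℝ (Fin d) × EuclideanSpace ℝ (Fin n) =>
      chartAt (EuclideanSpace ℝ (Fin d)) (1 : G) 1 + p.1).continuousAt.preimage_mem_nhds ?_
    exact (chartAt (EuclideanSpace ℝ (Fin d)) (1 : G)).open_target.mem_nhds
      (chart_add_zero_mem_target (k := d) (1 : G))
  · exact continuous_snd.continuousAt.preimage_mem_nhds
      ((chartAt (EuclideanSpace ℝ (Fin n)) q₀).open_target.mem_nhds
        (OpenPartialHomeomorph.map_source _ (mem_chart_source _ _)))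

variable [MulAction G Q]

variable (G) in
/-- The parametrization `(w, u) ↦ c(∑ wᵥ Xᵥ) • φ⁻¹(φ(q₀) + ℓ(u))` of `Q` near `q₀`, where `c` is the
inverse of a chart of `G` at `1`. -/
def adaptedParam (ε : Fin m ⊕ Fin r ≃ Fin n) (X : Fin r → EuclideanSpace ℝ (Fin d))
    (l : EuclideanSpace ℝ (Fin m) →L[ℝ] EuclideanSpace ℝ (Fin n)) (q₀ : Q)
    (y : EuclideanSpace ℝ (Fin n)) : Q :=
  actionParam d n G q₀ (adaptedArg ε X l q₀ y)

theorem adaptedParam_zero : adaptedParam G ε X l q₀ 0 = q₀ := by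
  rw [adaptedParam, adaptedArg_eq, map_zero, add_zero, actionParam_zero,
    OpenPartialHomeomorph.left_inv _ (mem_chart_source _ _)]

theorem orbitProj_adaptedParam (y : EuclideanSpace ℝ (Fin n)) :
    orbitProj G (adaptedParam G ε X l q₀ y) =
      orbitProj G (affineSlice q₀ l (coordProj (ε ∘ Sum.inl) y)) :=
  orbitProj_actionParam q₀ _

variable [IsManifold (𝓡 n) ∞ Q] [LieGroup (𝓡 d) ∞ G] [ContMDiffSMul (𝓡 d) (𝓡 n) ∞ G Q]

theorem contMDiffAt_adaptedParam {y : EuclideanSpace ℝ (Fin n)}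
    (hy : adaptedArg ε X l q₀ y ∈ paramDomain d G q₀) :
    ContMDiffAt (𝓡 n) (𝓡 n) ∞ (adaptedParam G ε X l q₀) y :=
  (contMDiffAt_actionParam q₀ hy.1 hy.2).comp y contDiff_adaptedArg.contDiffAt.contMDiffAt

theorem hasMFDerivAt_adaptedParam {y : EuclideanSpace ℝ (Fin n)}
    (hy : adaptedArg ε X l q₀ y ∈ paramDomain d G q₀) :
    HasMFDerivAt (𝓡 n) (𝓡 n) (adaptedParam G ε X l q₀) y
      ((actionParamDeriv d n G q₀ (adaptedArg ε X l q₀ y)).comp (adaptedArgDeriv ε X l)) := by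
  have h := hasMFDerivAt_comp_of_eq (hasMFDerivAt_actionParam (G := G) q₀ hy.1 hy.2)
    (hasFDerivAt_adaptedArg y).hasMFDerivAt rfl
  exact h

theorem pullbackForm_adaptedParam (μ : Metric n Q) {y : EuclideanSpace ℝ (Fin n)}
    (hy : adaptedArg ε X l q₀ y ∈ paramDomain d G q₀) (v w : EuclideanSpace ℝ (Fin n)) :
    pullbackForm μ (adaptedParam G ε X l q₀) y v w =
      pullbackForm μ (actionParam d n G q₀) (adaptedArg ε X l q₀ y) (adaptedArgDeriv ε X l v)
        (adaptedArgDeriv ε X l w) := by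
  have h := pullbackForm_comp μ (p := adaptedParam G ε X l q₀)
    (hasFDerivAt_adaptedArg (ε := ε) (X := X) (l := l) (q₀ := q₀) y).differentiableAt
    ((contMDiffAt_actionParam (G := G) q₀ hy.1 hy.2).mdifferentiableAt (by simp))
    EventuallyEq.rfl v w
  rwa [(hasFDerivAt_adaptedArg y).fderiv] at h

/-- On `w = 0`, the fibre block of the metric is the inertia tensor. -/
theorem pullbackMatrix_adaptedParam_inr (μ : Metric n Q) {u : EuclideanSpace ℝ (Fin m)}
    (hu : adaptedArg ε X l q₀ (coordIncl (ε ∘ Sum.inl) u) ∈ paramDomain d G q₀) (v w : Fin r) :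
    pullbackMatrix μ (adaptedParam G ε X l q₀) (coordIncl (ε ∘ Sum.inl) u)
      (ε (Sum.inr v)) (ε (Sum.inr w)) = inertia (G := G) μ (affineSlice q₀ l u) (X v) (X w) := by
  rw [pullbackMatrix, Matrix.of_apply, pullbackForm_adaptedParam μ hu, adaptedArgDeriv_inr,
    adaptedArgDeriv_inr]
  have h2 := hu.2
  rw [adaptedArg_coordIncl] at h2 ⊢
  exact pullbackForm_actionParam_inl μ q₀ h2 (X v) (X w)

variable [ChartedSpace (EuclideanSpace ℝ (Fin m)) (MulAction.orbitRel.Quotient G Q)]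

theorem projDeriv_adaptedParam (hπ : ContMDiff (𝓡 n) (𝓡 m) ∞ (orbitProj G : Q → _))
    {y : EuclideanSpace ℝ (Fin n)} (hy : adaptedArg ε X l q₀ y ∈ paramDomain d G q₀)
    {β' : EuclideanSpace ℝ (Fin m) →L[ℝ] EuclideanSpace ℝ (Fin m)}
    (hβ' : HasMFDerivAt (𝓡 m) (𝓡 m) (fun u => orbitProj G (affineSlice q₀ l u))
      (coordProj (ε ∘ Sum.inl) y) β') (v : EuclideanSpace ℝ (Fin n)) :
    projDeriv m n G (adaptedParam G ε X l q₀ y)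
      (actionParamDeriv d n G q₀ (adaptedArg ε X l q₀ y) (adaptedArgDeriv ε X l v)) =
      β' (coordProj (ε ∘ Sum.inl) v) := by
  have h1 := hasMFDerivAt_comp_of_eq (hasMFDerivAt_orbitProj hπ _) (hasMFDerivAt_adaptedParam hy)
    rfl
  have h2 := hasMFDerivAt_comp_of_eq hβ'
    (coordProj (ε ∘ Sum.inl)).hasFDerivAt.hasMFDerivAt rfl
  exact congrArg (fun L : EuclideanSpace ℝ (Fin n) →L[ℝ] EuclideanSpace ℝ (Fin m) => L v)
    (hasMFDerivAt_unique_of_eq h1 h2 orbitProj_adaptedParam)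

theorem inner_congr_point {k : ℕ} {M : Type*} [TopologicalSpace M]
    [ChartedSpace (EuclideanSpace ℝ (Fin k)) M] [IsManifold (𝓡 k) ∞ M] (μ : Metric k M) {x x' : M}
    (h : x = x') (v w : EuclideanSpace ℝ (Fin k)) : μ.inner x v w = μ.inner x' v w := by
  subst h
  rfl

/-- On `u = 0`, the metric has no mixed components: the translates of horizontal vectors are
horizontal. -/
theorem pullbackMatrix_adaptedParam_mixed {μ : Metric n Q} (hμ : IsIsometricAction G μ)
    (hπ : ContMDiff (𝓡 n) (𝓡 m) ∞ (orbitProj G : Q → _))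
    (hl : ∀ u w, projDeriv m n G q₀ w = 0 → μ.inner q₀ (l u) w = 0) {y : EuclideanSpace ℝ (Fin n)}
    (hy : adaptedArg ε X l q₀ y ∈ paramDomain d G q₀)
    (hy0 : coordProj (ε ∘ Sum.inl) y = 0)
    {β' : EuclideanSpace ℝ (Fin m) →L[ℝ] EuclideanSpace ℝ (Fin m)}
    (hβ : HasMFDerivAt (𝓡 m) (𝓡 m) (fun u => orbitProj G (affineSlice q₀ l u)) 0 β')
    (a : Fin m) (v : Fin r) :
    pullbackMatrix μ (adaptedParam G ε X l q₀) y (ε (Sum.inl a)) (ε (Sum.inr v)) = 0 := by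
  set A := actionParamDeriv d n G q₀ (adaptedArg ε X l q₀ y)
  set g := (chartAt (EuclideanSpace ℝ (Fin d)) (1 : G)).symm
    (chartAt (EuclideanSpace ℝ (Fin d)) (1 : G) 1 + (adaptedArg ε X l q₀ y).1) with hg
  have harg : adaptedArg ε X l q₀ y =
      ((adaptedArg ε X l q₀ y).1, chartAt (EuclideanSpace ℝ (Fin n)) q₀ q₀) := by
    ext1
    · rfl
    · simp only [adaptedArg, hy0, map_zero, add_zero]
  have hpt : adaptedParam G ε X l q₀ y = g • q₀ := by
    rw [adaptedParam, harg, actionParam,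
      OpenPartialHomeomorph.left_inv _ (mem_chart_source _ q₀)]
  have h1 : A (adaptedArgDeriv ε X l (EuclideanSpace.single (ε (Sum.inl a)) 1)) =
      smulDeriv g q₀ (l (EuclideanSpace.single a 1)) := by
    have h := actionParamDeriv_inr (G := G) (n := n) q₀ (v := l (EuclideanSpace.single a 1)) hy.1
    rw [← harg] at h
    rw [adaptedArgDeriv_inl]
    exact h
  set z := A (adaptedArgDeriv ε X l (EuclideanSpace.single (ε (Sum.inr v)) 1)) with hz
  have h2 : projDeriv m n G (adaptedParam G ε X l q₀ y) z = 0 := by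
    refine (projDeriv_adaptedParam hπ hy (by rw [hy0]; exact hβ) _).trans ?_
    exact (congrArg β' (coordProj_inl_single_inr ε v)).trans (map_zero β')
  rw [hpt] at h2
  -- the vertical vector `z` at `g • q₀` is the translate of a vertical vector at `q₀`
  obtain ⟨w, hw⟩ : ∃ w, smulDeriv g q₀ w = z :=
    LinearMap.injective_iff_surjective.1 (show Function.Injective
      (smulDeriv (Q := Q) (n := n) g q₀).toLinearMap from smulDeriv_injective (d := d) g q₀) z
  rw [← hw, projDeriv_smulDeriv (d := d) hπ] at h2
  have h3 : pullbackMatrix μ (adaptedParam G ε X l q₀) y (ε (Sum.inl a)) (ε (Sum.inr v)) =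
      μ.inner (adaptedParam G ε X l q₀ y)
        (A (adaptedArgDeriv ε X l (EuclideanSpace.single (ε (Sum.inl a)) 1))) z :=
    pullbackForm_adaptedParam μ hy _ _
  rw [h3, h1, ← hw]
  exact (inner_congr_point μ hpt _ _).trans ((hμ g q₀ _ _).trans (hl _ w h2))

variable [IsManifold (𝓡 m) ∞ (MulAction.orbitRel.Quotient G Q)]
    {μ : Metric n Q} {μ₀ : Metric m (MulAction.orbitRel.Quotient G Q)}

/-- Away from degenerate points, the Schur complement of the fibre block of the metric is the metric
of the base. -/
theorem schur_pullbackMatrix_adaptedParam (hπ : IsRiemannianSubmersion μ μ₀ (orbitProj G : Q → _))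
    {y : EuclideanSpace ℝ (Fin n)} (hy : adaptedArg ε X l q₀ y ∈ paramDomain d G q₀)
    (hβ : MDifferentiableAt (𝓡 m) (𝓡 m) (fun u => orbitProj G (affineSlice q₀ l u))
      (coordProj (ε ∘ Sum.inl) y))
    (hdet : ((pullbackMatrix μ (adaptedParam G ε X l q₀) y).submatrix ε ε).toBlocks₂₂.det ≠ 0) :
    ((pullbackMatrix μ (adaptedParam G ε X l q₀) y).submatrix ε ε).toBlocks₁₁ -
      ((pullbackMatrix μ (adaptedParam G ε X l q₀) y).submatrix ε ε).toBlocks₁₂ *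
      ((pullbackMatrix μ (adaptedParam G ε X l q₀) y).submatrix ε ε).toBlocks₂₂⁻¹ *
      ((pullbackMatrix μ (adaptedParam G ε X l q₀) y).submatrix ε ε).toBlocks₂₁ =
    pullbackMatrix μ₀ (fun u => orbitProj G (affineSlice q₀ l u))
      (coordProj (ε ∘ Sum.inl) y) := by
  set q := adaptedParam G ε X l q₀ y with hq
  let D : EuclideanSpace ℝ (Fin n) →L[ℝ] EuclideanSpace ℝ (Fin n) :=
    (actionParamDeriv d n G q₀ (adaptedArg ε X l q₀ y)).comp (adaptedArgDeriv ε X l)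
  let β' : EuclideanSpace ℝ (Fin m) →L[ℝ] EuclideanSpace ℝ (Fin m) :=
    mfderiv (𝓡 m) (𝓡 m) (fun u => orbitProj G (affineSlice q₀ l u)) (coordProj (ε ∘ Sum.inl) y)
  have hD : ∀ i j, pullbackMatrix μ (adaptedParam G ε X l q₀) y i j =
      μ.inner q (D (EuclideanSpace.single i 1)) (D (EuclideanSpace.single j 1)) := by
    intro i j
    have h := (hasMFDerivAt_adaptedParam hy).mfderiv
    exact congrArg (fun L : EuclideanSpace ℝ (Fin n) →L[ℝ] EuclideanSpace ℝ (Fin n) =>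
      μ.inner q (L (EuclideanSpace.single i 1)) (L (EuclideanSpace.single j 1))) h
  have hproj : ∀ v, projDeriv m n G q (D v) = β' (coordProj (ε ∘ Sum.inl) v) :=
    projDeriv_adaptedParam hπ.contMDiff hy hβ.hasMFDerivAt
  have hG : pullbackMatrix μ (adaptedParam G ε X l q₀) y = Matrix.of fun i j =>
      (show LinearMap.BilinForm ℝ (EuclideanSpace ℝ (Fin n)) from μ.form q)
        (D (EuclideanSpace.single i 1)) (D (EuclideanSpace.single j 1)) := Matrix.ext hD
  have hr : finrank ℝ (LinearMap.ker (projDeriv m n G q).toLinearMap) = Fintype.card (Fin r) := by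
    have h1 := finrank_ker_projDeriv (m := m) (n := n) (G := G) (q := q) (hπ.surjective q)
    have h2 := Fintype.card_congr ε
    simp only [Fintype.card_sum, Fintype.card_fin] at h2 ⊢
    omega
  rw [hG] at hdet ⊢
  refine (schur_gram_eq (L := μ.form q) (M := μ₀.form (orbitProj G q))
    (D := (projDeriv m n G q).toLinearMap) (fun v w hv hw => hπ.isometric q v w hv hw)
    (fun a => D (EuclideanSpace.single (ε (Sum.inl a)) 1))
    (z := fun v => D (EuclideanSpace.single (ε (Sum.inr v)) 1)) (fun v => ?_) hdet hr).trans ?_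
  · exact (hproj _).trans ((congrArg β' (coordProj_inl_single_inr ε v)).trans (map_zero β'))
  · have h3 : ∀ a, projDeriv m n G q (D (EuclideanSpace.single (ε (Sum.inl a)) 1)) =
        β' (EuclideanSpace.single a 1) := fun a => (hproj _).trans (congrArg β'
      (coordProj_single (j := ε ∘ Sum.inl) (ε.injective.comp Sum.inl_injective) a))
    ext a b
    refine (congrArg₂ (fun v w : EuclideanSpace ℝ (Fin m) => μ₀.inner (orbitProj G q) v w)
      (h3 a) (h3 b)).trans ?_
    exact inner_congr_point μ₀ (orbitProj_adaptedParam y) _ _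

end AdaptedMetric

/-! ### The Laplacian of a function pulled back from the orbit space -/

section LinearAlgebra

open Module

/-- A surjective linear map has a right inverse with values in the orthogonal complement of its
kernel. -/
theorem exists_rightInverse_orthogonal_ker {V W : Type*} [AddCommGroup V] [Module ℝ V]
    [AddCommGroup W] [Module ℝ W] [FiniteDimensional ℝ V] {L : LinearMap.BilinForm ℝ V}
    (hsymm : ∀ v w, L v w = L w v) (hpos : ∀ v, v ≠ 0 → 0 < L v v) {D : V →ₗ[ℝ] W}
    (hD : Function.Surjective D) :
    ∃ l : W →ₗ[ℝ] V, (∀ u, D (l u) = u) ∧ ∀ u w, D w = 0 → L (l u) w = 0 := by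
  obtain ⟨l₀, hl₀⟩ := D.exists_rightInverse_of_surjective (LinearMap.range_eq_top.2 hD)
  have hrefl : L.IsRefl := fun v w h => (hsymm w v).trans h
  have hc : IsCompl (LinearMap.ker D) (L.orthogonal (LinearMap.ker D)) := by
    rw [LinearMap.BilinForm.isCompl_orthogonal_iff_disjoint hrefl, Submodule.disjoint_def]
    intro v hv hv'
    by_contra hne
    exact (hpos v hne).ne' (LinearMap.BilinForm.mem_orthogonal_iff.1 hv' v hv)
  refine ⟨(Submodule.projection _ _ hc.symm) ∘ₗ l₀, fun u => ?_, fun u w hw => ?_⟩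
  · have h1 := Submodule.projection_add_projection_eq_self hc (l₀ u)
    have h2 : D (Submodule.projection _ _ hc (l₀ u)) = 0 :=
      Submodule.projection_apply_mem hc (l₀ u)
    have h3 := congrArg D h1
    rw [map_add, h2, zero_add] at h3
    exact h3.trans (LinearMap.congr_fun hl₀ u)
  · rw [hsymm]
    exact LinearMap.BilinForm.mem_orthogonal_iff.1
      (Submodule.projection_apply_mem hc.symm (l₀ u)) w hw

/-- The coordinate expression of the pairing of a gradient with a differential. -/
theorem apply_eq_sum_inv_mul {m : ℕ} {H : Matrix (Fin m) (Fin m) ℝ} (hH : H.det ≠ 0)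
    {g : EuclideanSpace ℝ (Fin m)} {L M : EuclideanSpace ℝ (Fin m) →L[ℝ] ℝ}
    (hg : ∀ j, ∑ i, g i * H i j = L (EuclideanSpace.single j 1)) :
    M g = ∑ a, L (EuclideanSpace.single a 1) *
      ∑ c, H⁻¹ a c * M (EuclideanSpace.single c 1) := by
  have h1 : Matrix.vecMul (fun a => L (EuclideanSpace.single a 1)) H⁻¹ = fun i => g i := by
    have h : Matrix.vecMul (fun i => g i) H = fun a => L (EuclideanSpace.single a 1) := funext hg
    rw [← h, Matrix.vecMul_vecMul, Matrix.mul_nonsing_inv _ (isUnit_iff_ne_zero.2 hH),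
      Matrix.vecMul_one]
  have h2 : M g = ∑ c, g c * M (EuclideanSpace.single c 1) := by
    conv_lhs => rw [← (EuclideanSpace.basisFun (Fin m) ℝ).sum_repr g]
    simp
  rw [h2]
  simp only [Finset.mul_sum]
  rw [Finset.sum_comm]
  refine Finset.sum_congr rfl fun c _ => ?_
  rw [← congrFun h1 c, Matrix.vecMul, dotProduct, Finset.sum_mul]
  exact Finset.sum_congr rfl fun a _ => mul_assoc _ _ _

end LinearAlgebra

section BaseParametrization

open Filter Topology Module

variable {m : ℕ} {B : Type*} [TopologicalSpace B] [ChartedSpace (EuclideanSpace ℝ (Fin m)) B]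
  [IsManifold (𝓡 m) ∞ B] {μ₀ : Metric m B} {β : EuclideanSpace ℝ (Fin m) → B}

theorem pullbackMatrix_of_hasMFDerivAt_id {u : EuclideanSpace ℝ (Fin m)}
    (hβ : HasMFDerivAt (𝓡 m) (𝓡 m) β u (ContinuousLinearMap.id ℝ (EuclideanSpace ℝ (Fin m)))) :
    pullbackMatrix μ₀ β u = Matrix.of fun i j =>
      μ₀.inner (β u) (EuclideanSpace.single i (1 : ℝ) : EuclideanSpace ℝ (Fin m))
        (EuclideanSpace.single j (1 : ℝ) : EuclideanSpace ℝ (Fin m)) := by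
  ext i j
  exact congrArg (fun L : EuclideanSpace ℝ (Fin m) →L[ℝ] EuclideanSpace ℝ (Fin m) =>
    μ₀.inner (β u) (L (EuclideanSpace.single i 1)) (L (EuclideanSpace.single j 1))) hβ.mfderiv

theorem pullbackMatrix_det_pos_of_hasMFDerivAt_id {u : EuclideanSpace ℝ (Fin m)}
    (hβ : HasMFDerivAt (𝓡 m) (𝓡 m) β u (ContinuousLinearMap.id ℝ (EuclideanSpace ℝ (Fin m)))) :
    0 < (pullbackMatrix μ₀ β u).det := by
  rw [pullbackMatrix_of_hasMFDerivAt_id hβ]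
  exact (posDef_gram μ₀ (β u) linearIndependent_single).det_pos

/-- The pairing of a gradient with a differential, in a parametrization with differential the
identity. -/
theorem derivAlong_gradient_eq {u : EuclideanSpace ℝ (Fin m)}
    (hβ : HasMFDerivAt (𝓡 m) (𝓡 m) β u (ContinuousLinearMap.id ℝ (EuclideanSpace ℝ (Fin m))))
    {h f : B → ℝ} (hh : MDifferentiableAt (𝓡 m) 𝓘(ℝ, ℝ) h (β u))
    (hf : MDifferentiableAt (𝓡 m) 𝓘(ℝ, ℝ) f (β u)) :
    derivAlong (gradient μ₀ h (β u)) f =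
      ∑ a, pderiv a (fun z => h (β z)) u *
        ∑ c, (pullbackMatrix μ₀ β u)⁻¹ a c * pderiv c (fun z => f (β z)) u := by
  have hd : ∀ k : B → ℝ, MDifferentiableAt (𝓡 m) 𝓘(ℝ, ℝ) k (β u) →
      ∀ a, pderiv a (fun z => k (β z)) u = derivAlong (x := β u) (EuclideanSpace.single a 1) k := by
    intro k hk a
    have h1 := hasMFDerivAt_comp_of_eq hk.hasMFDerivAt hβ rfl
    exact congrArg (fun L : EuclideanSpace ℝ (Fin m) →L[ℝ] ℝ => L (EuclideanSpace.single a 1))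
      (fderiv_eq_of_hasMFDerivAt h1)
  simp only [hd h hh, hd f hf]
  refine apply_eq_sum_inv_mul (pullbackMatrix_det_pos_of_hasMFDerivAt_id hβ).ne'
    (g := gradient μ₀ h (β u)) (L := mfderiv (𝓡 m) 𝓘(ℝ, ℝ) h (β u))
    (M := mfderiv (𝓡 m) 𝓘(ℝ, ℝ) f (β u)) fun j => ?_
  have h2 := inner_gradient μ₀ h (β u)
    (EuclideanSpace.single j (1 : ℝ) : EuclideanSpace ℝ (Fin m))
  refine Eq.trans ?_ h2
  rw [pullbackMatrix_of_hasMFDerivAt_id hβ]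
  set g : EuclideanSpace ℝ (Fin m) := gradient μ₀ h (β u)
  have h3 : g = ∑ i, g i • EuclideanSpace.single i (1 : ℝ) := by
    conv_lhs => rw [← (EuclideanSpace.basisFun (Fin m) ℝ).sum_repr g]
    simp
  let L : EuclideanSpace ℝ (Fin m) →ₗ[ℝ] ℝ :=
    (show LinearMap.BilinForm ℝ (EuclideanSpace ℝ (Fin m)) from μ₀.form (β u)).flip
      (EuclideanSpace.single j 1)
  have h4 : L g = ∑ i, g i * L (EuclideanSpace.single i 1) := by
    conv_lhs => rw [h3]
    simp
  exact h4.symm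

end BaseParametrization

section Formula

open Filter Topology Module

variable {d n m r : ℕ}
    {G : Type*} [TopologicalSpace G]
    [ChartedSpace (EuclideanSpace ℝ (Fin d)) G] [Group G]
    {Q : Type*} [TopologicalSpace Q]
    [ChartedSpace (EuclideanSpace ℝ (Fin n)) Q] [IsManifold (𝓡 n) ∞ Q]
    [MulAction G Q] {μ : Metric n Q} {ip : LinearMap.BilinForm ℝ (GroupLieAlgebra (𝓡 d) G)}

variable (G) in
/-- The density of the vector fields `X` along the affine slice through `q₀`. -/
def sliceDensity (μ : Metric n Q) (X : Fin r → GroupLieAlgebra (𝓡 d) G)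
    (l : EuclideanSpace ℝ (Fin m) →L[ℝ] EuclideanSpace ℝ (Fin n)) (q₀ : Q)
    (u : EuclideanSpace ℝ (Fin m)) : ℝ :=
  √(Matrix.of fun v w => inertia μ (affineSlice q₀ l u) (X v) (X w)).det

theorem det_gram_inertia_affineSlice_pos (hip : IsAdInvariantInner ip) {q₀ : Q}
    {X : Fin r → GroupLieAlgebra (𝓡 d) G} (hX : IsOrthonormalBasisPerp n ip q₀ X)
    (l : EuclideanSpace ℝ (Fin m) →L[ℝ] EuclideanSpace ℝ (Fin n)) :
    0 < (Matrix.of fun v w => inertia μ (affineSlice q₀ l 0) (X v) (X w)).det := by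
  rw [affineSlice_zero]
  exact (gram_inertia_posDef μ hip hX).det_pos

variable [LieGroup (𝓡 d) ∞ G] [ContMDiffSMul (𝓡 d) (𝓡 n) ∞ G Q]

theorem contDiffAt_gram_inertia_affineSlice (X : Fin r → GroupLieAlgebra (𝓡 d) G)
    (l : EuclideanSpace ℝ (Fin m) →L[ℝ] EuclideanSpace ℝ (Fin n)) (q₀ : Q) :
    ContDiffAt ℝ ∞ (fun u : EuclideanSpace ℝ (Fin m) =>
      (Matrix.of fun v w => inertia μ (affineSlice q₀ l u) (X v) (X w)).det) 0 := by
  refine contDiffAt_det (A := fun u : EuclideanSpace ℝ (Fin m) =>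
    Matrix.of fun v w => inertia μ (affineSlice q₀ l u) (X v) (X w)) fun v w => ?_
  refine ContMDiffAt.contDiffAt ?_
  exact (contMDiff_inertia μ (X v) (X w) _).comp 0
    (contMDiffAt_affineSlice q₀ l (by rw [map_zero]; exact chart_add_zero_mem_target q₀))

/-- Along a slice, the density of a fixed orthonormal family that is a basis of `𝔤_q^⊥` at the
centre has the same first derivative as the density of the orbits: it is bounded by the latter, with
equality at the centre. -/
theorem fderiv_sliceDensity (hip : IsAdInvariantInner ip)
    {e : Q → Fin r → GroupLieAlgebra (𝓡 d) G} (he : ∀ q, IsOrthonormalBasisPerp n ip q (e q))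
    (l : EuclideanSpace ℝ (Fin m) →L[ℝ] EuclideanSpace ℝ (Fin n)) (q₀ : Q)
    {ρ : EuclideanSpace ℝ (Fin m) → ℝ} (hρ : DifferentiableAt ℝ ρ 0)
    (hρe : ∀ u, ρ u = inertiaDensity μ (affineSlice q₀ l u) (e (affineSlice q₀ l u))) :
    sliceDensity G μ (e q₀) l q₀ 0 = ρ 0 ∧
      fderiv ℝ (sliceDensity G μ (e q₀) l q₀) 0 = fderiv ℝ ρ 0 := by
  have h0 : sliceDensity G μ (e q₀) l q₀ 0 = ρ 0 := by
    rw [hρe, sliceDensity, affineSlice_zero, inertiaDensity,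
      abs_of_pos (gram_inertia_posDef μ hip (he q₀)).det_pos]
  have hd : DifferentiableAt ℝ (sliceDensity G μ (e q₀) l q₀) 0 :=
    ((contDiffAt_gram_inertia_affineSlice (e q₀) l q₀).sqrt
      (det_gram_inertia_affineSlice_pos hip (he q₀) l).ne').differentiableAt (by simp)
  refine ⟨h0, ?_⟩
  -- the difference attains its minimum `0` at the centre of the slice
  have hmin : IsLocalMin (fun u => ρ u - sliceDensity G μ (e q₀) l q₀ u) 0 := by
    refine Eventually.of_forall fun u => ?_
    simp only [h0, sub_self, sub_nonneg]
    rw [hρe, sliceDensity]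
    exact (Real.sqrt_le_left (Real.sqrt_nonneg _)).2
      (det_inertia_le_sq μ hip (he _) (he q₀).orthonormal)
  have h1 := hmin.fderiv_eq_zero
  rw [fderiv_fun_sub hρ hd, sub_eq_zero] at h1
  exact h1.symm

variable [ChartedSpace (EuclideanSpace ℝ (Fin m)) (MulAction.orbitRel.Quotient G Q)]
    [IsManifold (𝓡 m) ∞ (MulAction.orbitRel.Quotient G Q)]
    {μ₀ : Metric m (MulAction.orbitRel.Quotient G Q)}

/-- On `w = 0`, near the origin, the determinant of the metric in the adapted parametrization is the
product of those of the inertia tensor and of the metric of the base, and the base block of its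
inverse is the inverse metric of the base. -/
theorem eventually_det_and_inv_pullbackMatrix_adaptedParam
    (hπ : IsRiemannianSubmersion μ μ₀ (orbitProj G : Q → _)) (ε : Fin m ⊕ Fin r ≃ Fin n) {q₀ : Q}
    {X : Fin r → EuclideanSpace ℝ (Fin d)}
    {l : EuclideanSpace ℝ (Fin m) →L[ℝ] EuclideanSpace ℝ (Fin n)}
    (hX : 0 < (Matrix.of fun v w => inertia (G := G) μ (affineSlice q₀ l 0) (X v) (X w)).det)
    (hl : ∀ u, projDeriv m n G q₀ (l u) = u) :
    ∀ᶠ u in 𝓝 0,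
      0 < (Matrix.of fun v w => inertia (G := G) μ (affineSlice q₀ l u) (X v) (X w)).det ∧
      (pullbackMatrix μ (adaptedParam G ε X l q₀) (coordIncl (ε ∘ Sum.inl) u)).det =
        (Matrix.of fun v w => inertia (G := G) μ (affineSlice q₀ l u) (X v) (X w)).det *
          (pullbackMatrix μ₀ (fun u => orbitProj G (affineSlice q₀ l u)) u).det ∧
      ∀ a b, (pullbackMatrix μ (adaptedParam G ε X l q₀) (coordIncl (ε ∘ Sum.inl) u))⁻¹
          (ε (Sum.inl a)) (ε (Sum.inl b)) =
        (pullbackMatrix μ₀ (fun u => orbitProj G (affineSlice q₀ l u)) u)⁻¹ a b := by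
  have hι : Tendsto (coordIncl (ε ∘ Sum.inl)) (𝓝 0) (𝓝 0) :=
    (coordIncl (ε ∘ Sum.inl)).continuous.tendsto' 0 0 (map_zero _)
  have hβs : ContMDiffAt (𝓡 m) (𝓡 m) ∞ (fun u => orbitProj G (affineSlice q₀ l u)) 0 :=
    contMDiffAt_orbitProj_affineSlice hπ.contMDiff q₀
      (by rw [map_zero]; exact chart_add_zero_mem_target q₀)
  have hH0 := pullbackMatrix_det_pos_of_hasMFDerivAt_id (μ₀ := μ₀)
    (hasMFDerivAt_orbitProj_affineSlice hπ.contMDiff q₀ hl)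
  have hHs : ContDiffAt ℝ ∞ (fun u =>
      (pullbackMatrix μ₀ (fun u => orbitProj G (affineSlice q₀ l u)) u).det) 0 :=
    contDiffAt_det fun i j => contDiffAt_pullbackForm μ₀ hβs _ _
  have hSd := contDiffAt_gram_inertia_affineSlice (G := G) (μ := μ) X l q₀
  filter_upwards [hι.eventually (eventually_adaptedArg_mem_paramDomain (G := G) (ε := ε) (X := X)
      (l := l) (q₀ := q₀)), hSd.continuousAt.eventually (lt_mem_nhds hX),
    hHs.continuousAt.eventually (lt_mem_nhds hH0)] with u h1 h2 h3
  have h4 : coordProj (ε ∘ Sum.inl) (coordIncl (ε ∘ Sum.inl) u) = u :=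
    coordProj_coordIncl (ε.injective.comp Sum.inl_injective) u
  have h5 : ((pullbackMatrix μ (adaptedParam G ε X l q₀)
      (coordIncl (ε ∘ Sum.inl) u)).submatrix ε ε).toBlocks₂₂ =
      Matrix.of fun v w => inertia (G := G) μ (affineSlice q₀ l u) (X v) (X w) :=
    Matrix.ext fun v w => pullbackMatrix_adaptedParam_inr μ h1 v w
  have h6 := h1.2
  rw [adaptedArg_coordIncl] at h6
  have h7 := schur_pullbackMatrix_adaptedParam hπ h1
    (by rw [h4]; exact (contMDiffAt_orbitProj_affineSlice hπ.contMDiff q₀ h6).mdifferentiableAt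
          (by simp))
    (by rw [h5]; exact ne_of_gt h2)
  rw [h4, h5] at h7
  exact ⟨h2, det_and_inv_of_schur ε _ (ne_of_gt h2) h5 (ne_of_gt h3) h7⟩

/-- The Laplacian of a pulled back function, in the adapted parametrization. -/
theorem laplaceBeltrami_comp_orbitProj_eq (hμ : IsIsometricAction G μ)
    (hπ : IsRiemannianSubmersion μ μ₀ (orbitProj G : Q → _)) (ε : Fin m ⊕ Fin r ≃ Fin n) {q₀ : Q}
    {X : Fin r → EuclideanSpace ℝ (Fin d)}
    {l : EuclideanSpace ℝ (Fin m) →L[ℝ] EuclideanSpace ℝ (Fin n)}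
    (hX : 0 < (Matrix.of fun v w => inertia (G := G) μ (affineSlice q₀ l 0) (X v) (X w)).det)
    (hl : ∀ u, projDeriv m n G q₀ (l u) = u)
    (hl' : ∀ u w, projDeriv m n G q₀ w = 0 → μ.inner q₀ (l u) w = 0)
    {f : MulAction.orbitRel.Quotient G Q → ℝ} (hf : ContMDiff (𝓡 m) 𝓘(ℝ, ℝ) ∞ f) :
    laplaceBeltrami μ (fun q => f (orbitProj G q)) q₀ =
      laplaceBeltrami μ₀ f (orbitProj G q₀) +
        ∑ a, pderiv a (sliceDensity G μ X l q₀) 0 / sliceDensity G μ X l q₀ 0 *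
          ∑ c, (pullbackMatrix μ₀ (fun u => orbitProj G (affineSlice q₀ l u)) 0)⁻¹ a c *
            pderiv c (fun u => f (orbitProj G (affineSlice q₀ l u))) 0 := by
  have hΨ0 : adaptedParam G ε X l q₀ 0 = q₀ := adaptedParam_zero
  have hβ0 : orbitProj G (affineSlice q₀ l 0) = orbitProj G q₀ :=
    congrArg (orbitProj G) (affineSlice_zero q₀ l)
  have hdom := eventually_adaptedArg_mem_paramDomain (G := G) (ε := ε) (X := X) (l := l) (q₀ := q₀)
  have hβd := hasMFDerivAt_orbitProj_affineSlice hπ.contMDiff q₀ hl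
  have hβs : ContMDiffAt (𝓡 m) (𝓡 m) ∞ (fun u => orbitProj G (affineSlice q₀ l u)) 0 :=
    contMDiffAt_orbitProj_affineSlice hπ.contMDiff q₀
      (by rw [map_zero]; exact chart_add_zero_mem_target q₀)
  have hHs : ∀ i j, ContDiffAt ℝ ∞ (fun z =>
      pullbackMatrix μ₀ (fun u => orbitProj G (affineSlice q₀ l u)) z i j) 0 := fun i j =>
    contDiffAt_pullbackForm μ₀ hβs _ _
  have hH0 := pullbackMatrix_det_pos_of_hasMFDerivAt_id (μ₀ := μ₀) hβd
  have hΨs : ContMDiffAt (𝓡 n) (𝓡 n) ∞ (adaptedParam G ε X l q₀) 0 :=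
    contMDiffAt_adaptedParam hdom.self_of_nhds
  have hGs : ∀ i j, ContDiffAt ℝ ∞ (fun z => pullbackMatrix μ (adaptedParam G ε X l q₀) z i j) 0 :=
    fun i j => contDiffAt_pullbackForm μ hΨs _ _
  have hblock := eventually_det_and_inv_pullbackMatrix_adaptedParam hπ ε hX hl
  have hG0 : 0 < (pullbackMatrix μ (adaptedParam G ε X l q₀) 0).det := by
    obtain ⟨-, h1, -⟩ := hblock.self_of_nhds
    rw [map_zero] at h1
    rw [h1]
    exact mul_pos hX hH0
  have hL1 := laplaceBeltrami_eq μ (f := fun q => f (orbitProj G q)) hΨs hG0.ne'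
    ((hf.comp hπ.contMDiff) _)
  have hL2 := laplaceBeltrami_eq μ₀ (f := f) hβs hH0.ne' (hf _)
  rw [hΨ0] at hL1
  rw [hβ0] at hL2
  have hfΨ : (fun z => f (orbitProj G (adaptedParam G ε X l q₀ z))) =
      fun z => (fun u => f (orbitProj G (affineSlice q₀ l u))) (coordProj (ε ∘ Sum.inl) z) :=
    funext fun z => congrArg f (orbitProj_adaptedParam z)
  rw [hL1, hL2, hfΨ]
  have hσ : DifferentiableAt ℝ (sliceDensity G μ X l q₀) 0 :=
    ((contDiffAt_gram_inertia_affineSlice (G := G) (μ := μ) X l q₀).sqrt hX.ne').differentiableAt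
      (by simp)
  have hF : ContDiffAt ℝ ∞ (fun u => f (orbitProj G (affineSlice q₀ l u))) 0 :=
    ((hf _).comp 0 hβs).contDiffAt
  have hdet : ∀ᶠ u in 𝓝 0,
      √(pullbackMatrix μ (adaptedParam G ε X l q₀) (coordIncl (ε ∘ Sum.inl) u)).det =
        sliceDensity G μ X l q₀ u *
          √(pullbackMatrix μ₀ (fun u => orbitProj G (affineSlice q₀ l u)) u).det := by
    filter_upwards [hblock] with u hu
    rw [hu.2.1, Real.sqrt_mul hu.1.le]
    rfl
  have hoff : ∀ v a, ∀ᶠ t : ℝ in 𝓝 0, (pullbackMatrix μ (adaptedParam G ε X l q₀)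
      (t • EuclideanSpace.single (ε (Sum.inr v)) 1))⁻¹ (ε (Sum.inr v)) (ε (Sum.inl a)) = 0 := by
    intro v a
    have ht : Tendsto (fun t : ℝ => t • EuclideanSpace.single (ε (Sum.inr v)) (1 : ℝ)) (𝓝 0)
        (𝓝 0) :=
      (by fun_prop : Continuous fun t : ℝ => t • EuclideanSpace.single (ε (Sum.inr v)) (1 : ℝ))
        |>.tendsto' 0 0 (zero_smul _ _)
    filter_upwards [ht.eventually hdom, ht.eventually
      ((contDiffAt_det hGs).continuousAt.eventually (lt_mem_nhds hG0))] with t h1 h2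
    have h3 : coordProj (ε ∘ Sum.inl) (t • EuclideanSpace.single (ε (Sum.inr v)) (1 : ℝ)) = 0 := by
      rw [map_smul, coordProj_inl_single_inr, smul_zero]
    have h4 := pullbackMatrix_adaptedParam_mixed hμ hπ.contMDiff hl' h1 h3 hβd
    exact inv_inr_inl_eq_zero ε (ne_of_gt h2) h4
      (fun v a => (pullbackForm_symm μ _ _ _ _).trans (h4 a v)) v a
  have key := coordLaplacian_comp_coordProj ε hGs hG0 hHs hH0 hσ hF hdet
    (hblock.mono fun u hu => hu.2.2) hoff
  exact key

/-- The Laplacian of a function pulled back from the orbit space is the Laplacian downstairs,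
corrected by the logarithmic gradient of the density of the orbits. -/
theorem laplaceBeltrami_comp_orbitProj (hμ : IsIsometricAction G μ)
    (hπ : IsRiemannianSubmersion μ μ₀ (orbitProj G : Q → _)) (hip : IsAdInvariantInner ip)
    (hrm : m + r = n) {e : Q → Fin r → GroupLieAlgebra (𝓡 d) G}
    (he : ∀ q, IsOrthonormalBasisPerp n ip q (e q))
    {δ f : MulAction.orbitRel.Quotient G Q → ℝ} (hδ : ContMDiff (𝓡 m) 𝓘(ℝ, ℝ) ∞ δ)
    (hδe : ∀ q, δ (orbitProj G q) = inertiaDensity μ q (e q))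
    (hf : ContMDiff (𝓡 m) 𝓘(ℝ, ℝ) ∞ f) (q₀ : Q) :
    laplaceBeltrami μ (fun q => f (orbitProj G q)) q₀ =
      laplaceBeltrami μ₀ f (orbitProj G q₀) +
        derivAlong (gradient μ₀ (fun b => Real.log (δ b)) (orbitProj G q₀)) f := by
  obtain ⟨l₀, hl, hl'⟩ := exists_rightInverse_orthogonal_ker
    (L := (show LinearMap.BilinForm ℝ (EuclideanSpace ℝ (Fin n)) from μ.form q₀))
    (fun v w => μ.symm q₀ v w) (fun v hv => μ.pos q₀ v hv)
    (D := (projDeriv m n G q₀).toLinearMap) (hπ.surjective q₀)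
  let l : EuclideanSpace ℝ (Fin m) →L[ℝ] EuclideanSpace ℝ (Fin n) :=
    LinearMap.toContinuousLinearMap l₀
  rw [laplaceBeltrami_comp_orbitProj_eq hμ hπ (finSumFinEquiv.trans (finCongr hrm))
    (det_gram_inertia_affineSlice_pos hip (he q₀) l) hl hl' hf]
  congr 1
  have hβd := hasMFDerivAt_orbitProj_affineSlice hπ.contMDiff q₀ (l := l) hl
  have hβs : ContMDiffAt (𝓡 m) (𝓡 m) ∞ (fun u => orbitProj G (affineSlice q₀ l u)) 0 :=
    contMDiffAt_orbitProj_affineSlice hπ.contMDiff q₀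
      (by rw [map_zero]; exact chart_add_zero_mem_target q₀)
  have hδpos : ∀ q : Q, 0 < δ (orbitProj G q) := fun q =>
    (inertiaDensity_pos μ hip (he q)).trans_eq (hδe q).symm
  have hlog : ContMDiffAt (𝓡 m) 𝓘(ℝ, ℝ) ∞ (fun b => Real.log (δ b))
      (orbitProj G (affineSlice q₀ l 0)) :=
    (Real.contDiffAt_log.2 (hδpos _).ne').contMDiffAt.comp _ (hδ _)
  have hρ : DifferentiableAt ℝ (fun u => δ (orbitProj G (affineSlice q₀ l u))) 0 :=
    (((hδ _).comp 0 hβs).contDiffAt).differentiableAt (by simp)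
  obtain ⟨h0, h1⟩ := fderiv_sliceDensity hip he l q₀ hρ fun u => hδe _
  have h2 := derivAlong_gradient_eq (μ₀ := μ₀) hβd (hlog.mdifferentiableAt (by simp))
    ((hf _).mdifferentiableAt (by simp))
  rw [affineSlice_zero] at h2
  rw [h2]
  refine Finset.sum_congr rfl fun a _ => ?_
  congr 1
  rw [pderiv, pderiv, h1, h0, fderiv.log hρ (hδpos _).ne', smul_apply, smul_eq_mul, div_eq_inv_mul]

end Formula

end RiemannianAction

end

theorem mainTheorem6 {d n m : ℕ}
    {G : Type*} [TopologicalSpace G] [T2Space G] [SecondCountableTopology G]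
    [ChartedSpace (EuclideanSpace ℝ (Fin d)) G] [Group G] [LieGroup (𝓡 d) ∞ G]
    {Q : Type*} [TopologicalSpace Q] [T2Space Q] [SecondCountableTopology Q]
    [ChartedSpace (EuclideanSpace ℝ (Fin n)) Q] [IsManifold (𝓡 n) ∞ Q]
    [MulAction G Q] [ContMDiffSMul (𝓡 d) (𝓡 n) ∞ G Q] [ProperSMul G Q]
    (hG : RiemannianAction.IsSingleOrbitType G Q)
    (μ : RiemannianAction.Metric n Q) (hμ : RiemannianAction.IsIsometricAction G μ)
    [ChartedSpace (EuclideanSpace ℝ (Fin m)) (MulAction.orbitRel.Quotient G Q)]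
    [IsManifold (𝓡 m) ∞ (MulAction.orbitRel.Quotient G Q)]
    (μ₀ : RiemannianAction.Metric m (MulAction.orbitRel.Quotient G Q))
    (hπ : RiemannianAction.IsRiemannianSubmersion μ μ₀ (RiemannianAction.orbitProj G))
    (ip : LinearMap.BilinForm ℝ (GroupLieAlgebra (𝓡 d) G))
    (hip : RiemannianAction.IsAdInvariantInner ip)
    (k : Q → ℕ) (e : (q : Q) → Fin (k q) → GroupLieAlgebra (𝓡 d) G)
    (he : ∀ q, RiemannianAction.IsOrthonormalBasisPerp n ip q (e q)) :
    (∀ q, 0 < RiemannianAction.inertiaDensity μ q (e q)) ∧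
    ∃ δ : C^∞⟮𝓡 m, MulAction.orbitRel.Quotient G Q; ℝ⟯,
      (∀ q, δ (RiemannianAction.orbitProj G q) = RiemannianAction.inertiaDensity μ q (e q)) ∧
      (∃! Δ₀ : C^∞⟮𝓡 m, MulAction.orbitRel.Quotient G Q; ℝ⟯ →ₗ[ℝ]
          C^∞⟮𝓡 m, MulAction.orbitRel.Quotient G Q; ℝ⟯,
        ∀ f q, Δ₀ f (RiemannianAction.orbitProj G q) =
          RiemannianAction.laplaceBeltrami μ (fun x => f (RiemannianAction.orbitProj G x)) q) ∧
      ∀ Δ₀ : C^∞⟮𝓡 m, MulAction.orbitRel.Quotient G Q; ℝ⟯ →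
          C^∞⟮𝓡 m, MulAction.orbitRel.Quotient G Q; ℝ⟯,
        (∀ f q, Δ₀ f (RiemannianAction.orbitProj G q) =
          RiemannianAction.laplaceBeltrami μ (fun x => f (RiemannianAction.orbitProj G x)) q) →
        ∀ f b, Δ₀ f b = RiemannianAction.laplaceBeltrami μ₀ f b +
          RiemannianAction.derivAlong
            (RiemannianAction.gradient μ₀ (fun x => Real.log (δ x)) b) f := by
  open RiemannianAction in
  have hsurj : ∀ q : Q, Function.Surjective (projDeriv m n G q) := hπ.surjective
  -- the spaces `𝔤_q^⊥` all have the dimension `n - m` of the orbits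
  have hsum : ∀ q, k q + m = n := fun q =>
    card_add_of_isOrthonormalBasisPerp hπ.contMDiff hip (hsurj q) (he q)
  obtain rfl : k = fun _ => n - m := funext fun q => Nat.eq_sub_of_add_eq (hsum q)
  have hpos := fun q => inertiaDensity_pos μ hip (he q)
  obtain ⟨δ, hδ⟩ := exists_orbitProj_eq_inertiaDensity hπ.contMDiff hsurj hμ hip he
  have hrep : ∀ b : MulAction.orbitRel.Quotient G Q, ∃ q : Q, orbitProj G q = b :=
    Quotient.exists_rep
  have key : ∀ (f : C^∞⟮𝓡 m, MulAction.orbitRel.Quotient G Q; ℝ⟯) (q : Q),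
      laplaceBeltrami μ (fun x => f (orbitProj G x)) q =
        laplaceBeltrami μ₀ f (orbitProj G q) +
          derivAlong (gradient μ₀ (fun x => Real.log (δ x)) (orbitProj G q)) f := fun f q =>
    laplaceBeltrami_comp_orbitProj hμ hπ hip (by have := hsum q; omega) he δ.contMDiff hδ
      f.contMDiff q
  have hcomp : ∀ f : C^∞⟮𝓡 m, MulAction.orbitRel.Quotient G Q; ℝ⟯,
      ContMDiff (𝓡 n) 𝓘(ℝ, ℝ) ∞ fun x : Q => f (orbitProj G x) := fun f =>
    f.contMDiff.comp hπ.contMDiff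
  -- the right-hand side of the formula is smooth because its pull-back is `Δ^Q (π^* f)`
  let D : C^∞⟮𝓡 m, MulAction.orbitRel.Quotient G Q; ℝ⟯ →
      C^∞⟮𝓡 m, MulAction.orbitRel.Quotient G Q; ℝ⟯ :=
    fun f => ⟨fun b => laplaceBeltrami μ₀ f b +
        derivAlong (gradient μ₀ (fun x => Real.log (δ x)) b) f,
      contMDiff_of_comp_orbitProj hπ.contMDiff hsurj
        ((contMDiff_laplaceBeltrami μ (hcomp f)).congr fun q => (key f q).symm)⟩
  have hD : ∀ f q, D f (orbitProj G q) = laplaceBeltrami μ (fun x => f (orbitProj G x)) q :=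
    fun f q => (key f q).symm
  refine ⟨hpos, δ, hδ, ⟨{ toFun := D, map_add' := fun f g => ?_, map_smul' := fun c f => ?_ }, hD,
    fun Δ hΔ => ?_⟩, fun Δ hΔ f b => ?_⟩
  · ext b
    obtain ⟨q, rfl⟩ := hrep b
    refine (hD _ q).trans ((laplaceBeltrami_add μ (hcomp f) (hcomp g) q).trans ?_)
    exact congrArg₂ (· + ·) (hD f q).symm (hD g q).symm
  · ext b
    obtain ⟨q, rfl⟩ := hrep b
    refine (hD _ q).trans ((laplaceBeltrami_const_mul μ _ c q).trans ?_)
    exact congrArg (c * ·) (hD f q).symm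
  · ext f b
    obtain ⟨q, rfl⟩ := hrep b
    exact (hΔ f q).trans (hD f q).symm
  · obtain ⟨q, rfl⟩ := hrep b
    exact (hΔ f q).trans (key f q)
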